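/- Let $F=\langle x_0,x_1\mid [x_0x_1^{-1},x_0^{-1}x_1x_0],\,[x_0x_1^{-1},x_0^{-2}x_1x_0^{2}]\rangle$ be Thompson's group, and for a word $w$ in $x_0^{\pm1},x_1^{\pm1}$ let $\ell(w)$ be the geodesic length of the element represented by $w$, i.e. the least length of a word in $x_0^{\pm1},x_1^{\pm1}$ representing the same element of $F$. A *forest diagram* is a pair of finite rows of binary trees (top and bottom), possibly trivial (a single leaf), with equally many leaves in total, the $i$-th leaf of one row facing the $i$-th leaf of the other, and with one tree pointed in each row; rows may be extended at either end by facing trivial unpointed trees. A pair of facing carets, both of whose children are leaves, is a pair of *common carets*, and is cancelled by replacing each of the two carets by a leaf; facing trivial unpointed trees at the two ends are deleted. The letters act on forest diagrams as follows (each action being followed by these cancellations and deletions): $x_0^{\pm1}$ moves the top pointer one tree to the right, respectively left; $x_1$ joins the pointed top tree and the next one to its right by a caret and points to the new tree; $x_1^{-1}$ deletes the root caret of the pointed top tree and points to the left one of the two resulting trees, or, if the pointed top tree is a single leaf, attaches a caret to the facing bottom leaf, while the top leaf is replaced by two trivial trees, the left one being pointed. The diagram $D(w)$ of $w=s_1\cdots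 s_n$ is obtained from the empty diagram (no carets, both pointers at the same place) by applying $s_n,\dots,s_1$ in this order (left multiplication). Each gap between neighbouring leaves of a row gets the first label that applies: L if it lies between two trees, left of the pointer; N if it is inside a tree and the leaf to its right is the leftmost leaf of some caret to the right of the gap; X if it lies between two trees and the tree to its right is nontrivial; R if it lies between two trees, right of the pointer; I otherwise. The weight of a column (a pair of facing gaps) is given by its two labels according to the symmetric table $$\begin{array}{c|ccccc} & I & N & L & R & X\\ \hline I&2&4&2&1&3\\ N&4&4&2&3&3\\ L&2&2&2&1&1\\ R&1&3&1&2&2\\ X&3&3&1&2&2\end{array}$$ and the weight of a diagram is the sum of the weights of its columns. Then: 1. For every word $w$, $\ell(w)$ is the weight of $D(w)$. 2. $\ell(w)$ can be computed in time $O(n^2)$ and space $O(n)$, where $n$ is the length of $w$. Precisely, there is a Turing machine with finitely many stacks over finite alphabets which, on the input $w$ (a word over the four-letter alphabet $\{x_0^{\pm1},x_1^{\pm1}\}$), outputs $\ell(w)$ in binary within $T(n)$ steps and never stores more than $S(n)$ symbols on its stacks, with $T(n)=O(n^2)$ and $S(n)=O(n)$. -/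

import Mathlib

namespace ThompsonF

/-! ### Thompson's group `F` and its geodesic length -/

/-- The two standard generators. -/
inductive Gen
  | x0
  | x1
  deriving DecidableEq

/-- A letter is a generator with a sign: `(g, true)` is `g` and `(g, false)` is `g⁻¹`
(the convention of `FreeGroup`). -/
abbrev Letter : Type := Gen × Bool

open scoped commutatorElement in
/-- The two relators `[x₀x₁⁻¹, x₀⁻¹x₁x₀]` and `[x₀x₁⁻¹, x₀⁻²x₁x₀²]`. -/
def relators : Set (FreeGroup Gen) :=
  let a := FreeGroup.of Gen.x0
  let b := FreeGroup.of Gen.x1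
  {⁅a * b⁻¹, a⁻¹ * b * a⁆, ⁅a * b⁻¹, (a ^ 2)⁻¹ * b * a ^ 2⁆}

/-- Thompson's group `F`. -/
abbrev F : Type := PresentedGroup relators

/-- The element of `F` represented by a word. -/
def element (w : List Letter) : F := PresentedGroup.mk relators (FreeGroup.mk w)

/-- The geodesic length of an element of `F`: the least length of a word representing it. -/
noncomputable def geodesicLength (g : F) : ℕ :=
  sInf {k | ∃ v : List Letter, v.length = k ∧ element v = g}

/-! ### Forest diagrams

Binary trees are `BinaryTree Unit`: the leaves are `nil`, the carets are `node () l r`. -/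

/-- A binary tree, possibly consisting of a single leaf (a trivial tree). -/
abbrev PlaneTree : Type := BinaryTree Unit

namespace PlaneTree

open BinaryTree

/-- For each leaf, from left to right: is it the left leaf of a caret both of whose children are
leaves? -/
def exposed : PlaneTree → List Bool
  | nil => [false]
  | node _ nil nil => [true, false]
  | node _ l r => exposed l ++ exposed r

/-- If leaf number `i` (from the left, starting with `0`) is the left leaf of a caret both of whose
children are leaves, delete that caret, which leaves a single leaf in its place. -/
def collapse : ℕ → PlaneTree → PlaneTree
  | _, nil => nil
  | i, node _ nil nil => if i = 0 then nil else node () nil nil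
  | i, node _ l r =>
      if i < l.numLeaves then node () (collapse i l) r
      else node () l (collapse (i - l.numLeaves) r)

/-- Attach a caret to leaf number `i`. -/
def expand : ℕ → PlaneTree → PlaneTree
  | _, nil => node () nil nil
  | i, node _ l r =>
      if i < l.numLeaves then node () (expand i l) r
      else node () l (expand (i - l.numLeaves) r)

end PlaneTree

/-- Apply `f` to the tree containing leaf number `i` of a row of trees; `f` is also told
the number of this leaf within its tree. -/
def modifyRow (f : ℕ → PlaneTree → PlaneTree) : ℕ → List PlaneTree → List PlaneTree
  | _, [] => []
  | i, t :: ts =>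
      if i < t.numLeaves then f i t :: ts else t :: modifyRow f (i - t.numLeaves) ts

/-- A finite row of binary trees, one of which is pointed: `left` are the trees to the left of the
pointed tree `cur` and `right` those to its right, both lists starting with the tree nearest to
`cur`. -/
@[ext] structure PointedForest where
  left : List PlaneTree
  cur : PlaneTree
  right : List PlaneTree
  deriving DecidableEq

namespace PointedForest

/-- All trees, from left to right. -/
def trees (P : PointedForest) : List PlaneTree := P.left.reverse ++ P.cur :: P.right

/-- The number of leaves to the left of the pointed tree. -/
def leavesBefore (P : PointedForest) : ℕ := (P.left.map BinaryTree.numLeaves).sum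

/-- `PlaneTree.exposed` for the leaves of the whole row. -/
def exposed (P : PointedForest) : List Bool := P.trees.flatMap PlaneTree.exposed

/-- Apply `f` to the tree containing leaf number `i`. -/
def modify (f : ℕ → PlaneTree → PlaneTree) (i : ℕ) (P : PointedForest) : PointedForest :=
  if i < P.leavesBefore then
    { P with left := (modifyRow f i P.left.reverse).reverse }
  else if i < P.leavesBefore + P.cur.numLeaves then
    { P with cur := f (i - P.leavesBefore) P.cur }
  else
    { P with right := modifyRow f (i - (P.leavesBefore + P.cur.numLeaves)) P.right }

/-- Add a trivial tree at the left end. -/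
def padLeft (P : PointedForest) : PointedForest :=
  { P with left := P.left ++ [BinaryTree.nil] }

/-- Add a trivial tree at the right end. -/
def padRight (P : PointedForest) : PointedForest :=
  { P with right := P.right ++ [BinaryTree.nil] }

end PointedForest

/-- The number of consecutive trivial trees at the end of a list. -/
def trivialSuffix (l : List PlaneTree) : ℕ :=
  (l.reverse.takeWhile (fun t => decide (t = BinaryTree.nil))).length

/-- A forest diagram: two pointed forests, leaf number `i` of the one facing leaf number `i` of the
other. -/
@[ext] structure ForestDiagram where
  top : PointedForest
  bottom : PointedForest
  deriving DecidableEq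

namespace ForestDiagram

open BinaryTree

/-- The empty forest diagram: no carets, and both pointers at the same place. -/
def empty : ForestDiagram := ⟨⟨[], nil, []⟩, ⟨[], nil, []⟩⟩

/-- Cancel a pair of common carets (two facing carets with leaves as children), if there is one. -/
def cancel (D : ForestDiagram) : ForestDiagram :=
  match (List.zipWith (· && ·) D.top.exposed D.bottom.exposed).findIdx? id with
  | none => D
  | some i => ⟨D.top.modify PlaneTree.collapse i, D.bottom.modify PlaneTree.collapse i⟩

/-- Remove the empty columns at the two ends: the leaves at the far left and the far right that are
trivial trees without pointer in both forests. -/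
def trim (D : ForestDiagram) : ForestDiagram :=
  let a := min (trivialSuffix D.top.left) (trivialSuffix D.bottom.left)
  let b := min (trivialSuffix D.top.right) (trivialSuffix D.bottom.right)
  ⟨⟨D.top.left.rdrop a, D.top.cur, D.top.right.rdrop b⟩,
    ⟨D.bottom.left.rdrop a, D.bottom.cur, D.bottom.right.rdrop b⟩⟩

/-- Add an empty column on the left. -/
def padLeft (D : ForestDiagram) : ForestDiagram := ⟨D.top.padLeft, D.bottom.padLeft⟩

/-- Add an empty column on the right. -/
def padRight (D : ForestDiagram) : ForestDiagram := ⟨D.top.padRight, D.bottom.padRight⟩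

/-- If the pointed tree of the top forest is the last one, make room on its right. -/
def roomRight (D : ForestDiagram) : ForestDiagram :=
  if D.top.right = [] then D.padRight else D

/-- If the pointed tree of the top forest is the first one, make room on its left. -/
def roomLeft (D : ForestDiagram) : ForestDiagram :=
  if D.top.left = [] then D.padLeft else D

/-- Move the top pointer one tree to the right (within the diagram). -/
def shiftRight : ForestDiagram → ForestDiagram
  | ⟨⟨l, t, u :: r⟩, B⟩ => ⟨⟨t :: l, u, r⟩, B⟩
  | D => D

/-- Move the top pointer one tree to the left (within the diagram). -/
def shiftLeft : ForestDiagram → ForestDiagram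
  | ⟨⟨u :: l, t, r⟩, B⟩ => ⟨⟨l, u, t :: r⟩, B⟩
  | D => D

/-- Join the pointed tree of the top forest and the next tree on its right by a caret; the pointer
is on the new tree. -/
def addCaret : ForestDiagram → ForestDiagram
  | ⟨⟨l, t, u :: r⟩, B⟩ => ⟨⟨l, node () t u, r⟩, B⟩
  | D => D

/-- If the pointed tree of the top forest has a caret, delete its top caret and point to the left
one of the resulting two trees. Otherwise the pointed tree is a single leaf: attach a caret to the
leaf of the bottom forest that faces it; on top, the leaf is replaced by two trivial trees, the left
one of which is pointed. -/
def removeCaret : ForestDiagram → ForestDiagram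
  | ⟨⟨l, node _ t u, r⟩, B⟩ => ⟨⟨l, t, u :: r⟩, B⟩
  | ⟨⟨l, nil, r⟩, B⟩ =>
      ⟨⟨l, nil, nil :: r⟩, B.modify PlaneTree.expand (PointedForest.leavesBefore ⟨l, nil, r⟩)⟩

/-- The effect of (left) multiplication by a letter on a forest diagram. A multiplication creates
at most one pair of common carets. -/
def mul : Letter → ForestDiagram → ForestDiagram
  | (Gen.x0, true), D => D.roomRight.shiftRight.trim
  | (Gen.x0, false), D => D.roomLeft.shiftLeft.trim
  | (Gen.x1, true), D => D.roomRight.addCaret.cancel.trim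
  | (Gen.x1, false), D => D.removeCaret.cancel.trim

/-- The forest diagram of a word, obtained from the empty diagram by multiplying by
one letter at a time. -/
def ofWord (w : List Letter) : ForestDiagram := w.foldr mul empty

end ForestDiagram

/-! ### Labels of gaps and weight of a diagram -/

/-- The labels of the gaps between neighbouring leaves. -/
inductive Label
  | I
  | N
  | L
  | R
  | X
  deriving DecidableEq

open Label

/-- The labels of the gaps inside a tree: `N` if the leaf to the right of the gap starts
a caret, else `I`. -/
def PlaneTree.labels : PlaneTree → List Label
  | .nil => []
  | .node _ l r =>
      PlaneTree.labels l ++ (if r = .nil then I else N) :: PlaneTree.labels r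

/-- The labels of all gaps of a pointed forest, from left to right. A gap between two trees gets `L`
if it is to the left of the pointer; else `X` if the tree to its right has a caret; else `R`. -/
def PointedForest.labels (P : PointedForest) : List Label :=
  P.left.reverse.flatMap (fun t => PlaneTree.labels t ++ [L]) ++
    PlaneTree.labels P.cur ++
    P.right.flatMap (fun t => (if t = .nil then R else X) :: PlaneTree.labels t)

/-- The weight of a column with given labels of its two gaps. -/
def columnWeight : Label → Label → ℕ
  | I, I => 2 | I, N => 4 | I, L => 2 | I, R => 1 | I, X => 3
  | N, I => 4 | N, N => 4 | N, L => 2 | N, R => 3 | N, X => 3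
  | L, I => 2 | L, N => 2 | L, L => 2 | L, R => 1 | L, X => 1
  | R, I => 1 | R, N => 3 | R, L => 1 | R, R => 2 | R, X => 2
  | X, I => 3 | X, N => 3 | X, L => 1 | X, R => 2 | X, X => 2

/-- The weight of a forest diagram: the sum of the weights of its columns. -/
def ForestDiagram.weight (D : ForestDiagram) : ℕ :=
  (List.zipWith columnWeight D.top.labels D.bottom.labels).sum

end ThompsonF

/-! ### Space used by a multi-stack Turing machine -/

/-- The number of symbols stored on all stacks of a configuration. -/
def Turing.FinTM2.space (M : Turing.FinTM2) (c : M.Cfg) : ℕ :=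
  letI := M.kFin
  ∑ k : M.K, (c.stk k).length

/-- A machine computing `f` in space `S`: on each input `a`, no configuration of the run stores
more than `S n` symbols (input and output included), where `n` is the length of the encoded
input. -/
def Turing.TM2ComputableInTime.InSpace {α β αΓ βΓ : Type} {ea : α → List αΓ} {eb : β → List βΓ}
    {f : α → β} (M : Turing.TM2ComputableInTime ea eb f) (S : ℕ → ℕ) : Prop :=
  ∀ (a : α) (c : M.tm.Cfg),
    StateTransition.Reaches M.tm.step
      (Turing.initList M.tm (List.map M.inputAlphabet.invFun (ea a))) c →
    M.tm.space c ≤ S (ea a).length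

namespace ThompsonF

/-! The top row is kept as a row of trees, while the bottom row is recorded only on the leaves: for
each bottom leaf, the kind of the gap on its left and the number of carets whose leftmost leaf it
is. In such a `State` every letter acts locally at the pointer, and a common caret is a top caret
over two leaves with bottom data `(d, k + 1)` and `(i, 0)`.

On reduced states the generators are permutations, and each relator acts trivially because it
commutes two operations on disjoint trees. Hence `F` acts, and the state of a word depends only on
its element. Conversely `State.val` reads the element off a state, in the form x₀ⁿ p q⁻¹ x₀⁻ᵐ with p
and q the positive words that build the two forests; so equal states mean equal elements
(`State.element_eq_iff`). `Rep` says that a state describes a forest diagram; it is preserved by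
every letter (`Rep.mul`) and keeps the weight (`Rep.weight`).

For the length it suffices that the weight behaves like a distance to the identity. It vanishes on
the empty diagram, a letter raises it by at most one (`State.weight_cons_le`), and at every other
diagram some letter lowers it (`State.exists_weight_lt`). The first two facts make the weight a
lower bound for the length; the third gives a descending path to the empty state, and
`element_eq_iff` turns this path into a word. Both estimates are read off the table: a letter
relabels the first column of one tree (L against R or X, I against R, N against X, where the entries
always differ by exactly one), creates or deletes a column, or does both when an empty column on the
left is involved.

The machine stores the trees as prefix codes on two stacks that meet at the pointer. A letter costs
time linear in the code, and the code grows by a bounded amount per letter (`Machine.size_mul_le`),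
so all letters together cost O(n²). The weight is then found in one scan with a binary counter,
again in O(n²). For the space, the run is cut into stretches of linear length that begin at small
configurations; a step adds at most four symbols, so no stretch exceeds linear space. -/

/-! ### Reduced states and the action of F on them. -/

/-- The kind of the gap to the left of a leaf: inside a tree, to the left of a tree that is left of
the pointer, is the pointed tree, or is right of the pointer. -/
inductive Kind
  | i
  | l
  | p
  | r
  deriving DecidableEq

/-- Trees whose leaves carry the kind of a gap and the number of carets starting at a leaf, both
taken from the facing row. -/
inductive LTree
  | leaf (d : Kind) (k : ℕ)
  | node (a b : LTree)
  deriving DecidableEq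

namespace LTree

/-- Join two trees by a caret, and cancel it against the facing caret if possible. -/
def join : LTree → LTree → LTree
  | leaf d (k + 1), leaf Kind.i 0 => leaf d k
  | a, b => node a b

/-- Undo `join`. -/
def split : LTree → LTree × LTree
  | leaf d k => (leaf d (k + 1), leaf Kind.i 0)
  | node a b => (a, b)

/-- No caret faces a common caret. -/
def Normal : LTree → Prop
  | leaf _ _ => True
  | node a b => Normal a ∧ Normal b ∧ join a b = node a b

theorem join_cases (a b : LTree) :
    (∃ d k, a = leaf d (k + 1) ∧ b = leaf Kind.i 0 ∧ join a b = leaf d k) ∨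
      join a b = node a b := by
  unfold join
  split
  · exact Or.inl ⟨_, _, rfl, rfl, rfl⟩
  · exact Or.inr rfl

@[simp] theorem split_join (a b : LTree) : split (join a b) = (a, b) := by
  rcases join_cases a b with ⟨d, k, rfl, rfl, h⟩ | h <;> rw [h] <;> rfl

theorem Normal.join_split {t : LTree} (h : t.Normal) : join t.split.1 t.split.2 = t := by
  cases t with
  | leaf d k => rfl
  | node a b => exact h.2.2

theorem Normal.join {a b : LTree} (ha : a.Normal) (hb : b.Normal) : (join a b).Normal := by
  rcases join_cases a b with ⟨d, k, rfl, rfl, h⟩ | h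
  · rw [h]; trivial
  · rw [h]; exact ⟨ha, hb, h⟩

theorem Normal.split {t : LTree} (h : t.Normal) : t.split.1.Normal ∧ t.split.2.Normal := by
  cases t with
  | leaf d k => exact ⟨trivial, trivial⟩
  | node a b => exact ⟨h.1, h.2.1⟩

end LTree

open LTree

/-- The trivial tree facing a trivial tree to the left of the pointer. -/
abbrev dl : LTree := leaf Kind.l 0

/-- The trivial tree facing a trivial tree to the right of the pointer. -/
abbrev dr : LTree := leaf Kind.r 0

/-- Put a tree in front of a list that is thought of as continued by `d` forever. -/
def tcons (d t : LTree) : List LTree → List LTree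
  | [] => if t = d then [] else [t]
  | u :: l => t :: u :: l

/-- The first tree of a list that is thought of as continued by `d` forever. -/
def thead (d : LTree) : List LTree → LTree
  | [] => d
  | t :: _ => t

/-- A list of trees that does not end with `d`. -/
def Trimmed (d : LTree) : List LTree → Prop
  | [] => True
  | t :: l => tcons d t l = t :: l ∧ Trimmed d l

@[simp] theorem thead_tcons (d t : LTree) (l : List LTree) : thead d (tcons d t l) = t := by
  cases l with
  | nil => by_cases h : t = d <;> simp [tcons, thead, h]
  | cons => rfl

@[simp] theorem tail_tcons (d t : LTree) (l : List LTree) : (tcons d t l).tail = l := by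
  cases l with
  | nil => by_cases h : t = d <;> simp [tcons, h]
  | cons => rfl

theorem Trimmed.tcons_eq {d : LTree} {l : List LTree} (h : Trimmed d l) :
    tcons d (thead d l) l.tail = l := by
  cases l with
  | nil => simp [tcons, thead]
  | cons => exact h.1

theorem Trimmed.tail {d : LTree} {l : List LTree} (h : Trimmed d l) : Trimmed d l.tail := by
  cases l with
  | nil => exact h
  | cons => exact h.2

theorem Trimmed.tcons {d : LTree} {l : List LTree} (h : Trimmed d l) (t : LTree) :
    Trimmed d (tcons d t l) := by
  cases l with
  | nil =>
    by_cases e : t = d <;> simp [ThompsonF.tcons, e, Trimmed]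
  | cons => exact ⟨rfl, h⟩

/-- A forest diagram, given by the top row together with the data of the bottom row on its
leaves. -/
@[ext] structure State where
  left : List LTree
  cur : LTree
  right : List LTree

namespace State

/-- The state of the empty diagram. -/
def init : State := ⟨[], leaf Kind.p 0, []⟩

/-- The effect of a letter. -/
def mul : Letter → State → State
  | (Gen.x0, true), S => ⟨tcons dl S.cur S.left, thead dr S.right, S.right.tail⟩
  | (Gen.x0, false), S => ⟨S.left.tail, thead dl S.left, tcons dr S.cur S.right⟩
  | (Gen.x1, true), S => ⟨S.left, join S.cur (thead dr S.right), S.right.tail⟩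
  | (Gen.x1, false), S => ⟨S.left, S.cur.split.1, tcons dr S.cur.split.2 S.right⟩

/-- The state of a word. -/
def ofWord (w : List Letter) : State := w.foldr mul init

/-- Nothing can be cancelled or removed. -/
structure Reduced (S : State) : Prop where
  left_normal : ∀ t ∈ S.left, t.Normal
  cur_normal : S.cur.Normal
  right_normal : ∀ t ∈ S.right, t.Normal
  left_trimmed : Trimmed dl S.left
  right_trimmed : Trimmed dr S.right

theorem normal_thead {d : LTree} (hd : d.Normal) {l : List LTree} (h : ∀ t ∈ l, t.Normal) :
    (thead d l).Normal := by
  cases l with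
  | nil => exact hd
  | cons t l => exact h t (by simp)

theorem normal_tcons {d t : LTree} (ht : t.Normal) {l : List LTree} (h : ∀ t ∈ l, t.Normal) :
    ∀ u ∈ tcons d t l, u.Normal := by
  cases l with
  | nil =>
    intro u hu
    by_cases e : t = d
    · simp [tcons, e] at hu
    · simp [tcons, e] at hu
      rwa [hu]
  | cons v l =>
    intro u hu
    rcases List.mem_cons.1 hu with rfl | hu
    · exact ht
    · exact h u hu

theorem reduced_init : init.Reduced :=
  ⟨by simp [init], trivial, by simp [init], trivial, trivial⟩

theorem Reduced.mul {S : State} (h : S.Reduced) (s : Letter) : (mul s S).Reduced := by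
  obtain ⟨g, b⟩ := s
  cases g <;> cases b
  · exact ⟨fun t ht => h.left_normal t (List.mem_of_mem_tail ht),
      normal_thead (d := dl) trivial h.left_normal, normal_tcons h.cur_normal h.right_normal,
      h.left_trimmed.tail, h.right_trimmed.tcons _⟩
  · exact ⟨normal_tcons h.cur_normal h.left_normal, normal_thead (d := dr) trivial h.right_normal,
      fun t ht => h.right_normal t (List.mem_of_mem_tail ht),
      h.left_trimmed.tcons _, h.right_trimmed.tail⟩
  · exact ⟨h.left_normal, h.cur_normal.split.1, normal_tcons h.cur_normal.split.2 h.right_normal,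
      h.left_trimmed, h.right_trimmed.tcons _⟩
  · exact ⟨h.left_normal, h.cur_normal.join (normal_thead (d := dr) trivial h.right_normal),
      fun t ht => h.right_normal t (List.mem_of_mem_tail ht), h.left_trimmed,
      h.right_trimmed.tail⟩

/-- Splitting after joining, or popping after pushing, always restores the data. The opposite order
needs normality (a removed caret must not have been cancellable) and trimmed ends (an empty column
must not be lost). -/
theorem mul_not_mul {S : State} (h : S.Reduced) (g : Gen) (b : Bool) :
    mul (g, !b) (mul (g, b) S) = S := by
  cases g <;> cases b
  · ext1 <;> simp [mul, h.left_trimmed.tcons_eq]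
  · ext1 <;> simp [mul, h.right_trimmed.tcons_eq]
  · ext1 <;> simp [mul, h.cur_normal.join_split]
  · ext1 <;> simp [mul, h.right_trimmed.tcons_eq]

theorem reduced_ofWord (w : List Letter) : (ofWord w).Reduced := by
  induction w with
  | nil => exact reduced_init
  | cons s w ih => exact ih.mul s

/-- A generator permutes the reduced states. -/
def genPerm (g : Gen) : Equiv.Perm {S : State // S.Reduced} where
  toFun S := ⟨mul (g, true) S.1, S.2.mul _⟩
  invFun S := ⟨mul (g, false) S.1, S.2.mul _⟩
  left_inv S := Subtype.ext (mul_not_mul S.2 g true)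
  right_inv S := Subtype.ext (mul_not_mul S.2 g false)

open scoped commutatorElement in
-- The element x₀x₁⁻¹ splits the pointed tree and steps onto its right half, which leaves the trees
-- to its right alone. The conjugates x₀⁻¹x₁x₀ and x₀⁻²x₁x₀² join two of those trees and return the
-- pointer. The operations act on different trees and commute.
theorem lift_genPerm_relators : ∀ x ∈ relators, FreeGroup.lift genPerm x = 1 := by
  rintro x (rfl | rfl) <;>
  · simp only [map_commutatorElement, commutatorElement_eq_one_iff_mul_comm, map_mul, map_inv,
      FreeGroup.lift_apply_of, map_pow]
    refine Equiv.ext fun S => Subtype.ext ?_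
    simp [Equiv.Perm.mul_apply, genPerm, pow_two, Equiv.Perm.inv_def, Equiv.symm, mul]

/-- The action of Thompson's group on reduced states. -/
def action : F →* Equiv.Perm {S : State // S.Reduced} :=
  PresentedGroup.toGroup (f := genPerm) lift_genPerm_relators

theorem action_element (w : List Letter) :
    (action (element w) ⟨init, reduced_init⟩).1 = ofWord w := by
  have : action (element w) = FreeGroup.lift genPerm (FreeGroup.mk w) := rfl
  rw [this, FreeGroup.lift_mk]
  induction w with
  | nil => rfl
  | cons s w ih =>
    obtain ⟨g, b⟩ := s
    rw [List.map_cons, List.prod_cons, Equiv.Perm.mul_apply, ofWord, List.foldr_cons, ← ofWord,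
      ← ih]
    · cases b <;> rfl
    · rfl

theorem ofWord_eq_of_element_eq {v w : List Letter} (h : element v = element w) :
    ofWord v = ofWord w := by
  rw [← action_element, ← action_element, h]

end State

end ThompsonF

/-! ### The element of F described by a state. -/

namespace ThompsonF

/-- The generator `x₀` of `F`. -/
abbrev fx0 : F := PresentedGroup.of Gen.x0

/-- The generator `x₁` of `F`. -/
abbrev fx1 : F := PresentedGroup.of Gen.x1

/-- Conjugation by `x₀`. -/
def sh (g : F) : F := fx0⁻¹ * g * fx0

@[simp] theorem sh_one : sh 1 = 1 := by simp [sh]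

@[simp] theorem sh_mul (g h : F) : sh (g * h) = sh g * sh h := by simp [sh, mul_assoc]

theorem iterate_sh_one (n : ℕ) : sh^[n] 1 = 1 := Function.iterate_fixed sh_one n

theorem iterate_sh_mul (n : ℕ) (g h : F) : sh^[n] (g * h) = sh^[n] g * sh^[n] h := by
  induction n generalizing g h with
  | zero => rfl
  | succ n ih => simp [Function.iterate_succ, ih]

theorem iterate_sh_pow (n : ℕ) (g : F) (k : ℕ) : sh^[n] (g ^ k) = sh^[n] g ^ k := by
  induction k with
  | zero => simp [iterate_sh_one]
  | succ k ih => rw [pow_succ, iterate_sh_mul, ih, pow_succ]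

theorem pow_mul_iterate_sh (n : ℕ) (g : F) : fx0 ^ n * sh^[n] g = g * fx0 ^ n := by
  induction n generalizing g with
  | zero => simp
  | succ n ih =>
    rw [pow_succ', Function.iterate_succ_apply', mul_assoc]
    simp only [sh]
    rw [← mul_assoc (fx0 ^ n), ← mul_assoc (fx0 ^ n)]
    have h : fx0 ^ n * fx0⁻¹ = fx0⁻¹ * fx0 ^ n := (Commute.refl fx0).inv_right.pow_left n
    rw [h, mul_assoc fx0⁻¹, ih]
    have h' : fx0 ^ n * fx0 = fx0 * fx0 ^ n := (Commute.refl fx0).pow_left n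
    rw [mul_assoc, mul_assoc g, h']
    group

open scoped commutatorElement in
theorem commute_sh_fx1 :
    Commute (fx0 * fx1⁻¹) (sh fx1) ∧ Commute (fx0 * fx1⁻¹) (sh (sh fx1)) := by
  have h1 : PresentedGroup.mk relators _ = 1 :=
    PresentedGroup.one_of_mem (rels := relators) (Set.mem_insert _ _)
  have h2 : PresentedGroup.mk relators _ = 1 :=
    PresentedGroup.one_of_mem (rels := relators) (Set.mem_insert_of_mem _ rfl)
  simp only [map_commutatorElement, commutatorElement_eq_one_iff_commute, map_mul, map_inv,
    map_pow] at h1 h2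
  refine ⟨h1, ?_⟩
  have : sh (sh fx1) = (fx0 ^ 2)⁻¹ * fx1 * fx0 ^ 2 := by
    simp only [sh, pow_two, mul_inv_rev, mul_assoc]
  rw [this]
  exact h2

/-- Elements that can be moved across `x₁`. -/
def Passes (g : F) : Prop := sh g * fx1 = fx1 * sh (sh g)

/-- Restated as membership in a centralizer, the property is visibly closed under products and
inverses. -/
theorem passes_iff (g : F) : Passes g ↔ Commute (fx0 * fx1⁻¹) (sh g) := by
  unfold Passes Commute SemiconjBy
  have e : sh (sh g) = fx0⁻¹ * sh g * fx0 := rfl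
  rw [e]
  constructor
  · intro h
    calc fx0 * fx1⁻¹ * sh g = fx0 * fx1⁻¹ * (sh g * fx1) * fx1⁻¹ := by group
      _ = sh g * (fx0 * fx1⁻¹) := by rw [h]; group
  · intro h
    calc sh g * fx1 = fx1 * fx0⁻¹ * (fx0 * fx1⁻¹ * sh g) * fx1 := by group
      _ = _ := by rw [h]; group

theorem Passes.mul {g h : F} (hg : Passes g) (hh : Passes h) : Passes (g * h) := by
  rw [passes_iff] at *
  rw [sh_mul]
  exact hg.mul_right hh

theorem passes_one : Passes 1 := by simp [Passes]

theorem Passes.pow {g : F} (hg : Passes g) (k : ℕ) : Passes (g ^ k) := by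
  induction k with
  | zero => simpa using passes_one
  | succ k ih => rw [pow_succ]; exact ih.mul hg

/-- With xₙ₊₁ = x₀⁻ⁿx₁x₀ⁿ these are the relations xⱼx₁ = x₁xⱼ₊₁ for j ≥ 2 of the infinite
presentation. The two relators are the first two of them, and the others follow by induction. -/
theorem passes_iterate_sh_fx1 (n : ℕ) : Passes (sh^[n] fx1) := by
  have key : sh fx1 * fx1 = fx1 * sh (sh fx1) := (passes_iff _).2 commute_sh_fx1.1
  suffices Passes (sh^[n] fx1) ∧ Passes (sh^[n + 1] fx1) from this.1
  induction n with
  | zero => exact ⟨key, (passes_iff _).2 commute_sh_fx1.2⟩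
  | succ n ih =>
    refine ⟨ih.2, ?_⟩
    have h := congrArg (sh^[n + 1]) key
    rw [iterate_sh_mul, iterate_sh_mul, ← Function.iterate_succ_apply,
      ← Function.iterate_succ_apply, ← Function.iterate_succ_apply] at h
    -- The shifted first relation expresses a generator by the two preceding ones, which commute
    -- with x₀x₁⁻¹ by induction.
    have h' : sh^[n + 2 + 1] fx1 = (sh^[n + 1] fx1)⁻¹ * (sh^[n + 2] fx1 * sh^[n + 1] fx1) := by
      rw [h]; simp
    rw [passes_iff] at ih ⊢
    rw [passes_iff] at ih
    rw [← Function.iterate_succ_apply' sh] at *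
    rw [← Function.iterate_succ_apply' sh] at ih
    rw [h']
    exact ih.1.inv_right.mul_right (ih.2.mul_right ih.1)

/-- The element that builds a forest, given by the numbers of carets starting at its leaves. -/
def build : List ℕ → F
  | [] => 1
  | k :: ks => fx1 ^ k * sh (build ks)

theorem build_append (A B : List ℕ) : build (A ++ B) = build A * sh^[A.length] (build B) := by
  induction A with
  | nil => simp [build]
  | cons k A ih =>
    rw [List.cons_append, build, ih, build, List.length_cons, Function.iterate_succ_apply', sh_mul,
      mul_assoc]

theorem passes_iterate_sh_build (n : ℕ) (ks : List ℕ) : Passes (sh^[n] (build ks)) := by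
  induction ks generalizing n with
  | nil => rw [build, iterate_sh_one]; exact passes_one
  | cons k ks ih =>
    rw [build, iterate_sh_mul, iterate_sh_pow, ← Function.iterate_succ_apply]
    exact ((passes_iterate_sh_fx1 n).pow k).mul (ih _)

/-- A caret on two neighbouring leaves can be built first, as the rightmost factor: the x₁ of this
caret moves to the right past everything built behind it, which lowers the indices there by one.
When both rows contain the caret, these last factors cancel in the quotient. -/
theorem build_succ_zero (A B : List ℕ) (k : ℕ) :
    build (A ++ (k + 1) :: 0 :: B) = build (A ++ k :: B) * sh^[A.length] fx1 := by
  rw [build_append, build_append, mul_assoc, ← iterate_sh_mul]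
  congr 2
  have := passes_iterate_sh_build 0 B
  simp only [Passes, Function.iterate_zero, id] at this
  rw [build, build, build, pow_zero, one_mul, pow_succ, mul_assoc, ← this, mul_assoc]

namespace LTree

/-- The numbers of carets starting at the leaves, with `k` added at the first leaf. -/
def tops (k : ℕ) : LTree → List ℕ
  | leaf _ _ => [k]
  | node a b => tops (k + 1) a ++ tops 0 b

/-- The data on the leaves. -/
def bots : LTree → List (Kind × ℕ)
  | leaf d k => [(d, k)]
  | node a b => bots a ++ bots b

theorem length_tops (k : ℕ) (t : LTree) : (tops k t).length = (bots t).length := by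
  induction t generalizing k with
  | leaf => rfl
  | node a b iha ihb => simp [tops, bots, iha, ihb]

theorem build_tops_append (k : ℕ) (t : LTree) (B : List ℕ) :
    build (tops k t ++ B) = fx1 ^ k * build (tops 0 t ++ B) := by
  induction t generalizing k B with
  | leaf => simp [tops, build]
  | node a b iha _ =>
    simp only [tops, List.append_assoc]
    rw [iha, iha (0 + 1), pow_succ, zero_add, pow_one, mul_assoc]

/-- A generator on the left of the word is indexed by trees, one on its right by leaves. Passing the
word of `t` therefore trades the one tree `t` for its leaves. -/
theorem sh_mul_build_tops (n : ℕ) (t : LTree) :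
    sh^[n + 1] fx1 * build (tops 0 t) =
      build (tops 0 t) * sh^[n + (tops 0 t).length] fx1 := by
  induction t generalizing n with
  | leaf => simp [tops, build]
  | node a b iha ihb =>
    simp only [tops, List.length_append]
    have hl : (tops (0 + 1) a).length = (tops 0 a).length := by simp only [length_tops]
    rw [build_tops_append, build_append, hl, zero_add, pow_one]
    have h1 : sh^[n + 1] fx1 * fx1 = fx1 * sh^[n + 1 + 1] fx1 := by
      have := passes_iterate_sh_fx1 n
      rwa [Passes, ← Function.iterate_succ_apply' sh, ← Function.iterate_succ_apply' sh] at this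
    rw [← mul_assoc, h1, mul_assoc, ← mul_assoc _ (build (tops 0 a)), iha, mul_assoc (build _)]
    have h2 : n + 1 + (tops 0 a).length = (tops 0 a).length + (n + 1) := by omega
    rw [h2, Function.iterate_add_apply, ← iterate_sh_mul, ihb, iterate_sh_mul,
      ← Function.iterate_add_apply]
    have h3 : (tops 0 a).length + (n + (tops 0 b).length) =
      n + ((tops 0 a).length + (tops 0 b).length) := by omega
    rw [h3]
    simp only [mul_assoc]

end LTree

open LTree

theorem sh_mul_build_flatMap (A : List LTree) :
    sh^[A.length] fx1 * build (A.flatMap (tops 0)) =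
      build (A.flatMap (tops 0)) * sh^[(A.flatMap (tops 0)).length] fx1 := by
  induction A with
  | nil => simp [build]
  | cons t A ih =>
    rw [List.flatMap_cons, build_append, List.length_cons, ← mul_assoc, sh_mul_build_tops,
      mul_assoc, List.length_append, Nat.add_comm A.length, Function.iterate_add_apply,
      ← iterate_sh_mul, ih, iterate_sh_mul, Function.iterate_add_apply, mul_assoc]

/-- The number of trees of the bottom row to the left of its pointer. -/
def leftCount (ts : List LTree) : ℕ := ((ts.flatMap bots).map Prod.fst).count Kind.l

/-- The element of `F` of a diagram with `n` trees to the left of the pointer. -/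
def value (n : ℕ) (ts : List LTree) : F :=
  fx0 ^ n * build (ts.flatMap (tops 0)) * (build ((ts.flatMap bots).map Prod.snd))⁻¹ *
    (fx0 ^ leftCount ts)⁻¹

theorem value_append_dr (n : ℕ) (ts : List LTree) : value n (ts ++ [dr]) = value n ts := by
  have h : build [0] = 1 := by simp [build]
  simp [value, leftCount, tops, bots, build_append, h, iterate_sh_one]

theorem value_dl_cons (n : ℕ) (ts : List LTree) : value (n + 1) (dl :: ts) = value n ts := by
  simp [value, leftCount, tops, bots, build, sh, pow_succ, mul_assoc]

theorem length_tops_flatMap (A : List LTree) :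
    (A.flatMap (tops 0)).length = ((A.flatMap bots).map Prod.snd).length := by
  induction A with
  | nil => rfl
  | cons t A ih => simp [length_tops]

/-- Both positive words end in the same generator at the cancelled caret. The lost leaf has kind
`i`, so the exponent that records the bottom pointer is unchanged. -/
theorem value_join (n : ℕ) (A B : List LTree) (a b : LTree) :
    value n (A ++ join a b :: B) = value n (A ++ node a b :: B) := by
  rcases join_cases a b with ⟨d, k, rfl, rfl, h⟩ | h
  · rw [h]
    simp only [value, leftCount, List.flatMap_append, List.flatMap_cons, tops, bots,
      List.map_append, List.map_cons, List.cons_append,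
      List.nil_append]
    rw [build_succ_zero, build_succ_zero, length_tops_flatMap]
    have : List.count Kind.l (List.map Prod.fst (A.flatMap bots) ++ d :: Kind.i ::
        List.map Prod.fst (B.flatMap bots)) = List.count Kind.l
        (List.map Prod.fst (A.flatMap bots) ++ d :: List.map Prod.fst (B.flatMap bots)) := by
      simp [List.count_cons]
    rw [this]
    group
  · rw [h]

/-- The new caret sits over the trees `a` and `b`, so its generator is indexed by `A.length`. Moving
it to the left past the power of x₀ that records the top pointer turns it into x₁. -/
theorem value_node (A B : List LTree) (a b : LTree) :
    value A.length (A ++ node a b :: B) = fx1 * value A.length (A ++ a :: b :: B) := by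
  simp only [value, leftCount, List.flatMap_append, List.flatMap_cons, tops, bots,
      List.append_assoc]
  rw [build_append, build_tops_append, build_append (A.flatMap (tops 0)), zero_add, pow_one,
    iterate_sh_mul, ← mul_assoc (build _), ← sh_mul_build_flatMap]
  simp only [← mul_assoc]
  rw [pow_mul_iterate_sh]

namespace State

/-- All trees, from left to right. -/
def trees (S : State) : List LTree := S.left.reverse ++ S.cur :: S.right

/-- The element of `F` of a state. -/
def val (S : State) : F := value S.left.length S.trees

theorem val_tcons_left (u t : LTree) (l r : List LTree) :
    val ⟨tcons dl u l, t, r⟩ = val ⟨u :: l, t, r⟩ := by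
  cases l with
  | cons => rfl
  | nil =>
    by_cases h : u = dl
    · subst h; simp [tcons, val, trees, value_dl_cons]
    · simp [tcons, h]

theorem val_tcons_right (u t : LTree) (l r : List LTree) :
    val ⟨l, t, tcons dr u r⟩ = val ⟨l, t, u :: r⟩ := by
  cases r with
  | cons => rfl
  | nil =>
    by_cases h : u = dr
    · subst h
      simp only [tcons, val, trees, if_true]
      rw [← value_append_dr]; simp
    · simp [tcons, h]

theorem val_thead_left (t : LTree) (l r : List LTree) :
    val ⟨thead dl l :: l.tail, t, r⟩ = val ⟨l, t, r⟩ := by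
  cases l with
  | cons => rfl
  | nil => rw [← val_tcons_left]; simp [tcons, thead]

theorem val_thead_right (t : LTree) (l r : List LTree) :
    val ⟨l, t, thead dr r :: r.tail⟩ = val ⟨l, t, r⟩ := by
  cases r with
  | cons => rfl
  | nil => rw [← val_tcons_right]; simp [tcons, thead]

theorem val_join (l : List LTree) (t u : LTree) (r : List LTree) :
    val ⟨l, join t u, r⟩ = fx1 * val ⟨l, t, u :: r⟩ := by
  have := value_node l.reverse r t u
  rw [List.length_reverse] at this
  simp only [val, trees]
  rw [value_join, this]

theorem val_move (l : List LTree) (t u : LTree) (r : List LTree) :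
    val ⟨t :: l, u, r⟩ = fx0 * val ⟨l, t, u :: r⟩ := by
  simp [val, trees, value, pow_succ', mul_assoc]

theorem element_cons (g : Gen) (b : Bool) (w : List Letter) :
    element ((g, b) :: w) =
      (cond b (PresentedGroup.of g) (PresentedGroup.of g)⁻¹) * element w := by
  have : FreeGroup.mk ((g, b) :: w) = FreeGroup.mk [(g, b)] * FreeGroup.mk w := by simp
  rw [element, this, map_mul, ← element]
  congr 1
  cases b
  · have : FreeGroup.mk [(g, false)] = (FreeGroup.of g)⁻¹ := rfl
    rw [element, this, map_inv]; rfl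
  · rfl

theorem val_mul {S : State} (h : S.Reduced) (g : Gen) (b : Bool) :
    val (mul (g, b) S) = (cond b (PresentedGroup.of g) (PresentedGroup.of g)⁻¹) * val S := by
  obtain ⟨l, t, r⟩ := S
  cases g <;> cases b
  · simp only [mul, cond_false]
    rw [eq_inv_mul_iff_mul_eq, val_tcons_right, ← val_move, val_thead_left]
  · simp only [mul, cond_true]
    rw [val_tcons_left, val_move, val_thead_right]
  · simp only [mul, cond_false]
    rw [eq_inv_mul_iff_mul_eq, val_tcons_right, ← val_join, h.cur_normal.join_split]
  · simp only [mul, cond_true]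
    rw [val_join, val_thead_right]

/-- This makes the action faithful: the state of a word determines its element. -/
theorem val_ofWord (w : List Letter) : val (ofWord w) = element w := by
  induction w with
  | nil =>
    simp [ofWord, init, val, trees, value, leftCount, tops, bots, build, element]
    rfl
  | cons s w ih =>
    obtain ⟨g, b⟩ := s
    rw [element_cons, ← ih]
    exact val_mul (reduced_ofWord w) g b

theorem element_eq_iff {v w : List Letter} : element v = element w ↔ ofWord v = ofWord w :=
  ⟨ofWord_eq_of_element_eq, fun h => by rw [← val_ofWord, ← val_ofWord, h]⟩

end State

end ThompsonF

/-! ### Rows of trees as lists of leaf data. -/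

namespace ThompsonF

open BinaryTree

/-- The data of a row at a leaf: the kind of the gap on its left and the number of carets that
start there. -/
abbrev Col : Type := Kind × ℕ

/-- The data at the leaves of a tree; `d` is the kind of the gap to the left of the tree, and `k` is
added at the first leaf. -/
def PlaneTree.row (d : Kind) : ℕ → PlaneTree → List Col
  | k, nil => [(d, k)]
  | k, node _ a b => PlaneTree.row d (k + 1) a ++ PlaneTree.row Kind.i 0 b

/-- The data at the leaves of a row. -/
def PointedForest.row (P : PointedForest) : List Col :=
  P.left.reverse.flatMap (PlaneTree.row Kind.l 0) ++ (PlaneTree.row Kind.p 0 P.cur ++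
    P.right.flatMap (PlaneTree.row Kind.r 0))

/-- The label of a gap. -/
def label : Col → Label
  | (Kind.i, 0) => Label.I
  | (Kind.i, _ + 1) => Label.N
  | (Kind.l, _) => Label.L
  | (Kind.p, _) => Label.L
  | (Kind.r, 0) => Label.R
  | (Kind.r, _ + 1) => Label.X

/-- Attach a caret to the `n`-th leaf. -/
def rowExpand : ℕ → List Col → List Col
  | _, [] => []
  | 0, x :: l => (x.1, x.2 + 1) :: (Kind.i, 0) :: l
  | n + 1, x :: l => x :: rowExpand n l

/-- Delete the caret whose left leaf is the `n`-th leaf. -/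
def rowCollapse : ℕ → List Col → List Col
  | 0, x :: _ :: l => (x.1, x.2 - 1) :: l
  | n + 1, x :: l => x :: rowCollapse n l
  | _, l => l

/-- For each leaf: is it the left leaf of a caret with leaves as children? -/
def rowExposed : List Col → List Bool
  | [] => []
  | [_] => [false]
  | x :: y :: l => (decide (x.2 ≠ 0) && decide (y = (Kind.i, 0))) :: rowExposed (y :: l)

theorem rowExpand_append_left {n : ℕ} {A : List Col} (h : n < A.length) (B : List Col) :
    rowExpand n (A ++ B) = rowExpand n A ++ B := by
  induction A generalizing n with
  | nil => simp at h
  | cons x A ih =>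
    cases n with
    | zero => rfl
    | succ n =>
      simp only [List.length_cons, Nat.add_lt_add_iff_right] at h
      simp [rowExpand, ih h]

theorem rowExpand_append_right (n : ℕ) (A B : List Col) :
    rowExpand (A.length + n) (A ++ B) = A ++ rowExpand n B := by
  induction A with
  | nil => simp
  | cons x A ih =>
    rw [List.length_cons, Nat.add_right_comm, List.cons_append, rowExpand, ih, List.cons_append]

theorem rowCollapse_append_left {n : ℕ} {A : List Col} (h : n + 1 < A.length) (B : List Col) :
    rowCollapse n (A ++ B) = rowCollapse n A ++ B := by
  induction A generalizing n with
  | nil => simp at h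
  | cons x A ih =>
    cases n with
    | zero =>
      cases A with
      | nil => simp at h
      | cons => rfl
    | succ n =>
      simp only [List.length_cons, Nat.add_lt_add_iff_right] at h
      simp [rowCollapse, ih h]

theorem rowCollapse_append_right (n : ℕ) (A B : List Col) :
    rowCollapse (A.length + n) (A ++ B) = A ++ rowCollapse n B := by
  induction A with
  | nil => simp
  | cons x A ih =>
    rw [List.length_cons, Nat.add_right_comm, List.cons_append, rowCollapse, ih, List.cons_append]

namespace PlaneTree

@[simp] theorem length_row (d : Kind) (k : ℕ) (t : PlaneTree) :
    (row d k t).length = t.numLeaves := by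
  induction t generalizing d k with
  | nil => rfl
  | node _ a b iha ihb => simp [row, iha, ihb, numLeaves]

theorem row_ne_nil (d : Kind) (k : ℕ) (t : PlaneTree) : row d k t ≠ [] := by
  cases t with
  | nil => simp [row]
  | node _ a b =>
    intro h
    have := congrArg List.length h
    rw [length_row] at this
    have := numLeaves_pos (node () a b)
    simp_all

/-- The row of a tree starts with its leftmost carets. -/
theorem row_eq_cons (d : Kind) (k : ℕ) (t : PlaneTree) :
    ∃ j l, row d k t = (d, k + j) :: l ∧ (j = 0 ↔ t = nil) ∧ ∀ k', row d k' t = (d, k' + j) :: l := by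
  induction t generalizing d k with
  | nil => exact ⟨0, [], rfl, by simp, fun _ => rfl⟩
  | node _ a b iha _ =>
    obtain ⟨j, l, h1, -, h3⟩ := iha d (k + 1)
    refine ⟨j + 1, l ++ row Kind.i 0 b, ?_, by simp, fun k' => ?_⟩
    · rw [row, h1, List.cons_append]; congr 2; omega
    · rw [row, h3, List.cons_append]; congr 2; omega

theorem row_expand {n : ℕ} {t : PlaneTree} (h : n < t.numLeaves) (d : Kind) (k : ℕ) :
    row d k (expand n t) = rowExpand n (row d k t) := by
  induction t generalizing d k n with
  | nil =>
    simp only [numLeaves, Nat.lt_one_iff] at h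
    subst h
    simp [expand, row, rowExpand]
  | node _ a b iha ihb =>
    rw [expand, row]
    by_cases hn : n < a.numLeaves
    · rw [if_pos hn, row, iha hn, rowExpand_append_left (by simpa using hn)]
    · obtain ⟨m, rfl⟩ := Nat.exists_eq_add_of_le (not_lt.1 hn)
      simp only [numLeaves] at h
      rw [if_neg hn, row, Nat.add_sub_cancel_left, ihb (by omega)]
      have := rowExpand_append_right m (row d (k + 1) a) (row Kind.i 0 b)
      rw [length_row] at this
      exact this.symm

theorem exposed_node {a b : PlaneTree} (h : a ≠ nil ∨ b ≠ nil) :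
    exposed (node () a b) = exposed a ++ exposed b := by
  cases a <;> cases b <;> simp_all [exposed]

theorem length_exposed (t : PlaneTree) : (exposed t).length = t.numLeaves := by
  induction t with
  | nil => rfl
  | node _ a b iha ihb =>
    by_cases h : a ≠ nil ∨ b ≠ nil
    · rw [exposed_node h]; simp [iha, ihb, numLeaves]
    · push Not at h; obtain ⟨rfl, rfl⟩ := h; rfl

theorem exposed_lt {t : PlaneTree} {n : ℕ} (h : (exposed t)[n]? = some true) :
    n + 1 < t.numLeaves := by
  induction t generalizing n with
  | nil => cases n <;> simp [exposed] at h
  | node _ a b iha ihb =>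
    by_cases hab : a ≠ nil ∨ b ≠ nil
    · rw [exposed_node hab, List.getElem?_append, length_exposed] at h
      rw [numLeaves]
      split at h
      · have := iha h; omega
      · have := ihb h; omega
    · push Not at hab
      obtain ⟨rfl, rfl⟩ := hab
      match n with
      | 0 => simp [numLeaves]
      | 1 => simp [exposed] at h
      | n + 2 => simp [exposed] at h

theorem collapse_node {a b : PlaneTree} (h : a ≠ nil ∨ b ≠ nil) (n : ℕ) :
    collapse n (node () a b) = if n < a.numLeaves then node () (collapse n a) b
      else node () a (collapse (n - a.numLeaves) b) := by
  cases a <;> cases b <;> simp_all [collapse]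

theorem row_collapse {n : ℕ} {t : PlaneTree} (h : (exposed t)[n]? = some true) (d : Kind) (k : ℕ) :
    row d k (collapse n t) = rowCollapse n (row d k t) := by
  induction t generalizing d k n with
  | nil => cases n <;> simp [exposed] at h
  | node _ a b iha ihb =>
    by_cases hab : a ≠ nil ∨ b ≠ nil
    · rw [exposed_node hab, List.getElem?_append, length_exposed] at h
      rw [collapse_node hab, row]
      split at h
      next hn =>
        rw [if_pos hn, row, iha h, rowCollapse_append_left]
        simpa using exposed_lt h
      next hn =>
        obtain ⟨m, rfl⟩ := Nat.exists_eq_add_of_le (not_lt.1 hn)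
        rw [Nat.add_sub_cancel_left] at h
        rw [if_neg hn, row, Nat.add_sub_cancel_left, ihb h]
        have := rowCollapse_append_right m (row d (k + 1) a) (row Kind.i 0 b)
        rw [length_row] at this
        exact this.symm
    · push Not at hab
      obtain ⟨rfl, rfl⟩ := hab
      match n with
      | 0 => simp [collapse, row, rowCollapse]
      | 1 => simp [exposed] at h
      | n + 2 => simp [exposed] at h

end PlaneTree

/-- The only test that crosses the seam compares the last leaf of `A` with the first leaf of `B`;
the hypothesis makes it fail. -/
theorem rowExposed_append {A B : List Col} (hA : ∀ x ∈ A.getLast?, x.2 = 0 ∨ B.head? ≠ some (Kind.i, 0)) :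
    rowExposed (A ++ B) = rowExposed A ++ rowExposed B := by
  induction A with
  | nil => rfl
  | cons x A ih =>
    cases A with
    | nil =>
      cases B with
      | nil => simp [rowExposed]
      | cons y B =>
        simp only [List.getLast?_singleton, Option.mem_def, Option.some.injEq, List.head?_cons,
          forall_eq', ne_eq] at hA
        simp only [List.singleton_append, rowExposed, List.cons.injEq, and_true]
        rcases hA with hA | hA <;> simp [hA]
    | cons y A =>
      simp only [List.cons_append, rowExposed]
      rw [← List.cons_append, ih]
      intro z hz; exact hA z (by simpa using hz)

namespace PlaneTree

theorem row_getLast? {d : Kind} {k : ℕ} {t : PlaneTree} (h : t ≠ nil ∨ k = 0) :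
    ∀ x ∈ (row d k t).getLast?, x.2 = 0 := by
  induction t generalizing d k with
  | nil => simp_all [row]
  | node _ a b _ ihb =>
    intro x hx
    rw [row, List.getLast?_append_of_ne_nil _ (row_ne_nil _ _ _)] at hx
    exact ihb (Or.inr rfl) x hx

theorem exposed_eq (d : Kind) (k : ℕ) (t : PlaneTree) : rowExposed (row d k t) = exposed t := by
  induction t generalizing d k with
  | nil => rfl
  | node _ a b iha ihb =>
    by_cases hab : a ≠ nil ∨ b ≠ nil
    · rw [exposed_node hab, row, rowExposed_append, iha, ihb]
      intro x hx
      by_cases ha : a = nil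
      · right
        have hb : b ≠ nil := by tauto
        obtain ⟨j, l, h1, h2, -⟩ := row_eq_cons Kind.i 0 b
        rw [h1]
        have : j ≠ 0 := fun h => hb (h2.1 h)
        simpa
      · exact Or.inl (row_getLast? (Or.inl ha) x hx)
    · push Not at hab
      obtain ⟨rfl, rfl⟩ := hab
      simp [row, rowExposed, exposed]

theorem labels_eq (d : Kind) (k : ℕ) (t : PlaneTree) :
    (row d k t).map label = label ((row d k t).headD (d, 0)) :: labels t := by
  induction t generalizing d k with
  | nil => rfl
  | node _ a b iha ihb =>
    obtain ⟨j, l, h1, h2, -⟩ := row_eq_cons Kind.i 0 b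
    have hh : ∀ e : Col, ((row d (k + 1) a) ++ row Kind.i 0 b).headD e =
        (row d (k + 1) a).headD e := by
      obtain ⟨j, l, h1, -⟩ := row_eq_cons d (k + 1) a
      simp [h1]
    rw [row, List.map_append, iha, ihb, hh, labels, h1]
    rcases j with _ | j
    · simp [h2.1 rfl, label]
    · have : b ≠ nil := fun h => by simpa using h2.2 h
      simp [this, label]

end PlaneTree

namespace PointedForest

/-- The data of a leaf describe the gap on its left, and the leftmost leaf has no such gap; hence
the tail. -/
theorem labels_eq (P : PointedForest) : P.labels = P.row.tail.map label := by
  have key : ∀ (d : Kind), (∀ k, label (d, k) = Label.L) → ∀ t : PlaneTree,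
      (PlaneTree.row d 0 t).map label = Label.L :: PlaneTree.labels t := by
    intro d hd t
    rw [PlaneTree.labels_eq]
    obtain ⟨j, l, h1, -⟩ := PlaneTree.row_eq_cons d 0 t
    simp [h1, hd]
  have h1 : ∀ A : List PlaneTree, Label.L :: A.flatMap (fun t => PlaneTree.labels t ++ [Label.L]) =
      (A.flatMap (PlaneTree.row Kind.l 0)).map label ++ [Label.L] := by
    intro A
    induction A with
    | nil => rfl
    | cons t A ih =>
      rw [List.flatMap_cons, List.flatMap_cons, List.map_append, key _ (fun _ => rfl),
        List.append_assoc, List.append_assoc, ← ih]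
      simp
  have h2 : P.right.flatMap (fun t => (if t = .nil then Label.R else Label.X) ::
      PlaneTree.labels t) = (P.right.flatMap (PlaneTree.row Kind.r 0)).map label := by
    rw [List.map_flatMap]
    congr 1
    funext t
    rw [PlaneTree.labels_eq]
    obtain ⟨j, l, h1, h2, -⟩ := PlaneTree.row_eq_cons Kind.r 0 t
    rw [h1]
    rcases j with _ | j
    · simp [h2.1 rfl, label]
    · have : t ≠ nil := fun h => by simpa using h2.2 h
      simp [this, label]
  -- A virtual gap labelled `L` in front of the row lets every tree be treated alike.
  have h3 : Label.L :: P.labels = P.row.map label := by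
    rw [labels, h2, ← List.cons_append, ← List.cons_append, h1, row, List.map_append,
      List.map_append, key Kind.p (fun _ => rfl)]
    simp
  have := congrArg List.tail h3
  rwa [List.tail_cons, ← List.map_tail] at this

theorem length_row_left (P : PointedForest) :
    (P.left.reverse.flatMap (PlaneTree.row Kind.l 0)).length = P.leavesBefore := by
  rw [List.length_flatMap, leavesBefore, ← List.sum_reverse, ← List.map_reverse]
  simp

theorem exposed_flatMap (d : Kind) (A : List PlaneTree) (C : List Col) :
    rowExposed (A.flatMap (PlaneTree.row d 0) ++ C) =
      A.flatMap PlaneTree.exposed ++ rowExposed C := by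
  induction A with
  | nil => rfl
  | cons t A ih =>
    rw [List.flatMap_cons, List.append_assoc, rowExposed_append, PlaneTree.exposed_eq, ih]
    · simp
    · intro x hx
      exact Or.inl (PlaneTree.row_getLast? (Or.inr rfl) x hx)

theorem exposed_eq (P : PointedForest) : P.exposed = rowExposed P.row := by
  have h2 := exposed_flatMap Kind.r P.right []
  rw [List.append_nil] at h2
  rw [row, exposed_flatMap, rowExposed_append, PlaneTree.exposed_eq,
    h2]
  · simp [exposed, trees, rowExposed]
  · intro x hx
    exact Or.inl (PlaneTree.row_getLast? (Or.inr rfl) x hx)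

section modify

variable {f : ℕ → PlaneTree → PlaneTree} {g : ℕ → List Col → List Col} {q : PlaneTree → List Bool}

theorem row_modifyRow (hq : ∀ t, (q t).length = t.numLeaves)
    (hg : ∀ n A B, g (A.length + n) (A ++ B) = A ++ g n B)
    (hf : ∀ n t, (q t)[n]? = some true → ∀ d B,
      g n (PlaneTree.row d 0 t ++ B) = PlaneTree.row d 0 (f n t) ++ B)
    (d : Kind) (A : List PlaneTree) (n : ℕ) (h : (A.flatMap q)[n]? = some true) (B : List Col) :
    g n (A.flatMap (PlaneTree.row d 0) ++ B) =
      (modifyRow f n A).flatMap (PlaneTree.row d 0) ++ B := by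
  induction A generalizing n with
  | nil => simp at h
  | cons t A ih =>
    rw [List.flatMap_cons, List.getElem?_append, hq] at h
    rw [modifyRow, List.flatMap_cons, List.append_assoc]
    split at h
    next hn => rw [if_pos hn, hf n t h, List.flatMap_cons, List.append_assoc]
    next hn =>
      obtain ⟨m, rfl⟩ := Nat.exists_eq_add_of_le (not_lt.1 hn)
      rw [Nat.add_sub_cancel_left] at h
      rw [if_neg hn, Nat.add_sub_cancel_left, List.flatMap_cons, List.append_assoc, ← ih m h]
      have := hg m (PlaneTree.row d 0 t) (A.flatMap (PlaneTree.row d 0) ++ B)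
      rwa [PlaneTree.length_row] at this

/-- Stated for a general operation so as to cover both `collapse` and `expand`; `q` marks the leaves
of a tree at which the operation on trees agrees with the operation `g` on lists. -/
theorem row_modify (hq : ∀ t, (q t).length = t.numLeaves)
    (hg : ∀ n A B, g (A.length + n) (A ++ B) = A ++ g n B)
    (hf : ∀ n t, (q t)[n]? = some true → ∀ d B,
      g n (PlaneTree.row d 0 t ++ B) = PlaneTree.row d 0 (f n t) ++ B)
    (P : PointedForest) (n : ℕ) (h : (P.trees.flatMap q)[n]? = some true) :
    (P.modify f n).row = g n P.row := by
  have hl : (P.left.reverse.flatMap q).length = P.leavesBefore := by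
    rw [List.length_flatMap, leavesBefore, ← List.sum_reverse, ← List.map_reverse]
    simp [hq]
  rw [trees, List.flatMap_append, List.getElem?_append, hl] at h
  rw [modify]
  split at h
  next hn =>
    rw [if_pos hn, row.eq_1 P, row_modifyRow hq hg hf _ _ _ h, row, List.reverse_reverse]
  next hn =>
    obtain ⟨m, rfl⟩ := Nat.exists_eq_add_of_le (not_lt.1 hn)
    rw [if_neg hn, Nat.add_sub_cancel_left]
    simp only [Nat.add_lt_add_iff_left, Nat.add_sub_add_left]
    have hg' := hg m (P.left.reverse.flatMap (PlaneTree.row Kind.l 0))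
      (PlaneTree.row Kind.p 0 P.cur ++ P.right.flatMap (PlaneTree.row Kind.r 0))
    rw [length_row_left, ← row] at hg'
    rw [hg']
    rw [Nat.add_sub_cancel_left, List.flatMap_cons, List.getElem?_append, hq] at h
    split at h
    next hm => rw [if_pos hm, hf _ _ h, row]
    next hm =>
      obtain ⟨j, rfl⟩ := Nat.exists_eq_add_of_le (not_lt.1 hm)
      have := hg j (PlaneTree.row Kind.p 0 P.cur) (P.right.flatMap (PlaneTree.row Kind.r 0))
      rw [PlaneTree.length_row] at this
      rw [Nat.add_sub_cancel_left] at h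
      have h' := row_modifyRow hq hg hf Kind.r _ _ h []
      rw [List.append_nil, List.append_nil] at h'
      rw [if_neg hm, this, Nat.add_sub_cancel_left, row, h']

end modify

theorem row_modify_collapse (P : PointedForest) (n : ℕ) (h : P.exposed[n]? = some true) :
    (P.modify PlaneTree.collapse n).row = rowCollapse n P.row :=
  row_modify PlaneTree.length_exposed rowCollapse_append_right
    (fun n t hn d B => by
      rw [PlaneTree.row_collapse hn, rowCollapse_append_left]
      simpa using PlaneTree.exposed_lt hn) P n h

theorem row_modify_expand (P : PointedForest) (n : ℕ) (h : n < P.row.length) :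
    (P.modify PlaneTree.expand n).row = rowExpand n P.row := by
  -- A caret may be attached to any leaf, so every leaf is marked.
  refine row_modify (q := fun t => List.replicate t.numLeaves true) (fun t => by simp)
    rowExpand_append_right (fun n t hn d B => ?_) P n ?_
  · have hn : n < t.numLeaves := by
      by_contra h
      simp [h] at hn
    rw [PlaneTree.row_expand hn, rowExpand_append_left (by simpa)]
  · have hl : P.row.length = (P.trees.flatMap fun t => List.replicate t.numLeaves true).length := by
      simp [row, trees, List.length_flatMap]
    rw [hl] at h
    rw [List.getElem?_eq_getElem h]
    have : ∀ b ∈ P.trees.flatMap fun t => List.replicate t.numLeaves true, b = true := by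
      intro b hb
      rw [List.mem_flatMap] at hb
      obtain ⟨t, -, ht⟩ := hb
      exact List.eq_of_mem_replicate ht
    rw [this _ (List.getElem_mem h)]

end PointedForest

end ThompsonF

/-! ### States as descriptions of forest diagrams. -/

namespace ThompsonF

open BinaryTree

/-- Cancellation is possible at neighbouring columns (top first). -/
def Redex (x y : Col × Col) : Prop :=
  x.1.2 ≠ 0 ∧ x.2.2 ≠ 0 ∧ y = ((Kind.i, 0), (Kind.i, 0))

instance (x y : Col × Col) : Decidable (Redex x y) := by unfold Redex; infer_instance

/-- For each column: is cancellation possible with the next one? -/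
def redexes : List (Col × Col) → List Bool
  | [] => []
  | [_] => [false]
  | x :: y :: C => decide (Redex x y) :: redexes (y :: C)

theorem zipWith_rowExposed (C : List (Col × Col)) :
    List.zipWith (· && ·) (rowExposed (C.map Prod.fst)) (rowExposed (C.map Prod.snd)) =
      redexes C := by
  induction C with
  | nil => rfl
  | cons x C ih =>
    cases C with
    | nil => rfl
    | cons y C =>
      simp only [List.map_cons, rowExposed, List.zipWith_cons_cons, redexes]
      simp only [List.map_cons] at ih
      rw [ih]
      congr 1
      rw [Bool.eq_iff_iff]
      simp only [Redex, Prod.ext_iff, Bool.and_eq_true, decide_eq_true_eq]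
      tauto

theorem redexes_append {A B : List (Col × Col)}
    (h : ∀ x ∈ A.getLast?, ∀ y ∈ B.head?, ¬ Redex x y) :
    redexes (A ++ B) = redexes A ++ redexes B := by
  induction A with
  | nil => rfl
  | cons x A ih =>
    cases A with
    | nil =>
      cases B with
      | nil => simp [redexes]
      | cons y B =>
        have := h x (by simp) y (by simp)
        simp [redexes, this]
    | cons y A =>
      simp only [List.cons_append, redexes]
      rw [← List.cons_append, ih]
      intro z hz
      exact h z (by simpa using hz)

theorem length_redexes (C : List (Col × Col)) : (redexes C).length = C.length := by
  induction C with
  | nil => rfl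
  | cons x C ih => cases C with
    | nil => rfl
    | cons y C => simpa [redexes] using ih

namespace LTree

/-- The underlying tree. -/
def shape : LTree → PlaneTree
  | leaf _ _ => nil
  | node a b => BinaryTree.node () (shape a) (shape b)

/-- The columns at the leaves of a tree (top first). -/
def cols (d : Kind) : ℕ → LTree → List (Col × Col)
  | k, leaf e m => [((d, k), (e, m))]
  | k, node a b => cols d (k + 1) a ++ cols Kind.i 0 b

theorem map_fst_cols (d : Kind) (k : ℕ) (t : LTree) :
    (cols d k t).map Prod.fst = PlaneTree.row d k (shape t) := by
  induction t generalizing d k with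
  | leaf => rfl
  | node a b iha ihb => simp [cols, shape, PlaneTree.row, iha, ihb]

theorem map_snd_cols (d : Kind) (k : ℕ) (t : LTree) : (cols d k t).map Prod.snd = bots t := by
  induction t generalizing d k with
  | leaf => rfl
  | node a b iha ihb => simp [cols, bots, iha, ihb]

theorem cols_ne_nil (d : Kind) (k : ℕ) (t : LTree) : cols d k t ≠ [] := fun h =>
  PlaneTree.row_ne_nil d k (shape t) (by rw [← map_fst_cols, h]; rfl)

/-- Only the first column of a tree depends on what is to the left of the tree. -/
theorem cols_eq_cons (t : LTree) : ∃ j y C, (∀ d k, cols d k t = ((d, k + j), y) :: C) ∧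
    (j = 0 ↔ ∃ e m, t = leaf e m) ∧ (∀ e m, t = leaf e m → y = (e, m) ∧ C = []) := by
  induction t with
  | leaf e m => exact ⟨0, (e, m), [], by simp [cols]⟩
  | node a b iha _ =>
    obtain ⟨j, y, C, h, -⟩ := iha
    refine ⟨j + 1, y, C ++ cols Kind.i 0 b, fun d k => ?_, by simp, by simp⟩
    rw [cols, h, List.cons_append, Nat.add_assoc, Nat.add_comm 1]

theorem shape_eq_nil {t : LTree} (h : shape t = nil) : ∃ d k, t = leaf d k := by
  cases t with
  | leaf d k => exact ⟨d, k, rfl⟩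
  | node => simp [shape] at h

theorem top_getLast?_cols {d : Kind} {k : ℕ} {t : LTree} (h : shape t ≠ nil ∨ k = 0) :
    ∀ x ∈ (cols d k t).getLast?, x.1.2 = 0 := by
  intro x hx
  apply PlaneTree.row_getLast? (d := d) h
  rw [← map_fst_cols, List.getLast?_map]
  exact Option.mem_map_of_mem _ hx

/-- A redex at the seam of two subtrees forces both to be leaves: a nontrivial left subtree ends in
a leaf at which no top caret starts, and the column behind the seam must have top data `(i, 0)`.
This is exactly the case in which `join` would have cancelled. -/
theorem Normal.redexes_cols {t : LTree} (h : t.Normal) (d : Kind) (k : ℕ) :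
    true ∉ redexes (cols d k t) := by
  induction t generalizing d k with
  | leaf => simp [cols, redexes]
  | node a b iha ihb =>
    rw [cols, redexes_append]
    · simp [iha h.1, ihb h.2.1]
    · intro x hx y hy hr
      obtain ⟨j, z, C, hC, hj, hl⟩ := cols_eq_cons b
      rw [hC] at hy
      simp only [List.head?_cons, Option.mem_def, Option.some.injEq] at hy
      subst hy
      by_cases ha : shape a = nil
      · obtain ⟨e, m, rfl⟩ := shape_eq_nil ha
        simp only [cols, List.getLast?_singleton, Option.mem_def, Option.some.injEq] at hx
        subst hx
        obtain ⟨-, hm, h2⟩ := hr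
        simp only [Prod.mk.injEq, true_and, Nat.zero_add] at h2
        obtain ⟨e', m', rfl⟩ := hj.1 h2.1
        rw [(hl _ _ rfl).1] at h2
        simp only [Prod.mk.injEq] at h2
        obtain ⟨-, rfl, rfl⟩ := h2
        obtain ⟨m, rfl⟩ := Nat.exists_eq_succ_of_ne_zero hm
        simp [Normal, LTree.join] at h
      · exact hr.1 (top_getLast?_cols (Or.inl ha) x hx)

end LTree

open LTree

theorem redexes_cols_append (k : ℕ) (d : Kind) {t : LTree} (hk : shape t ≠ nil ∨ k = 0)
    (C : List (Col × Col)) :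
    redexes (cols d k t ++ C) = redexes (cols d k t) ++ redexes C :=
  redexes_append fun x hx _ _ hr => hr.1 (top_getLast?_cols hk x hx)

theorem redexes_flatMap (d : Kind) (A : List LTree) (C : List (Col × Col)) :
    redexes (A.flatMap (cols d 0) ++ C) =
      A.flatMap (fun t => redexes (cols d 0 t)) ++ redexes C := by
  induction A with
  | nil => rfl
  | cons t A ih =>
    rw [List.flatMap_cons, List.append_assoc, redexes_cols_append 0 d (Or.inr rfl), ih]
    simp

namespace State

/-- The columns of a state. -/
def cols (S : State) : List (Col × Col) :=
  S.left.reverse.flatMap (LTree.cols Kind.l 0) ++ (LTree.cols Kind.p 0 S.cur ++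
    S.right.flatMap (LTree.cols Kind.r 0))

/-- The top row. -/
def top (S : State) : PointedForest := ⟨S.left.map shape, shape S.cur, S.right.map shape⟩

theorem map_fst_cols (S : State) : S.cols.map Prod.fst = S.top.row := by
  simp [cols, top, PointedForest.row, List.map_flatMap, LTree.map_fst_cols, List.flatMap_map,
    ← List.map_reverse]

theorem map_snd_cols (S : State) : S.cols.map Prod.snd = S.trees.flatMap bots := by
  simp [cols, trees, List.map_flatMap, LTree.map_snd_cols]

theorem redexes_cols (S : State) : redexes S.cols =
    S.left.reverse.flatMap (fun t => redexes (LTree.cols Kind.l 0 t)) ++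
      (redexes (LTree.cols Kind.p 0 S.cur) ++
        S.right.flatMap (fun t => redexes (LTree.cols Kind.r 0 t))) := by
  have := redexes_flatMap Kind.r S.right []
  simp only [List.append_nil, redexes] at this
  rw [cols, redexes_flatMap, redexes_cols_append 0 _ (Or.inr rfl), this]

end State

theorem not_mem_redexes_flatMap {A : List LTree} (h : ∀ t ∈ A, t.Normal) (d : Kind) :
    true ∉ A.flatMap (fun t => redexes (LTree.cols d 0 t)) := by
  rw [List.mem_flatMap]
  rintro ⟨t, ht, h'⟩
  exact (h t ht).redexes_cols d 0 h'

/-- A forest diagram is described by a state. -/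
structure Rep (D : ForestDiagram) (S : State) : Prop where
  top : D.top = S.top
  bottom : D.bottom.row = S.trees.flatMap bots

namespace Rep

variable {D : ForestDiagram} {S : State}

theorem zipWith_exposed (h : Rep D S) :
    List.zipWith (· && ·) D.top.exposed D.bottom.exposed = redexes S.cols := by
  rw [PointedForest.exposed_eq, PointedForest.exposed_eq, h.top, h.bottom, ← S.map_fst_cols,
    ← S.map_snd_cols, zipWith_rowExposed]

theorem cancel (h : Rep D S) (hl : ∀ t ∈ S.left, t.Normal) (hc : S.cur.Normal)
    (hr : ∀ t ∈ S.right, t.Normal) : D.cancel = D := by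
  have : (List.zipWith (· && ·) D.top.exposed D.bottom.exposed).findIdx? id = none := by
    rw [h.zipWith_exposed, List.findIdx?_eq_none_iff, S.redexes_cols]
    intro b hb
    by_contra hb'
    simp only [id, Bool.not_eq_false] at hb'
    subst hb'
    rw [List.mem_append, List.mem_append] at hb
    rcases hb with hb | hb | hb
    · exact not_mem_redexes_flatMap (by simpa using hl) _ hb
    · exact hc.redexes_cols _ _ hb
    · exact not_mem_redexes_flatMap hr _ hb
  rw [ForestDiagram.cancel, this]

theorem leavesBefore (h : Rep D S) :
    D.top.leavesBefore = (S.left.reverse.flatMap bots).length := by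
  rw [← PointedForest.length_row_left, h.top]
  simp only [List.length_flatMap, State.top, ← List.map_reverse, List.map_map]
  congr 2
  funext t
  rw [Function.comp_apply, ← LTree.map_fst_cols, ← LTree.map_snd_cols Kind.l 0, List.length_map,
    List.length_map]

/-- The trees to the left are normal, so the search finds the first leaf of the pointed tree. -/
theorem cancel_redex {l r : List LTree} {d : Kind} {k : ℕ}
    (h : Rep D ⟨l, LTree.node (leaf d (k + 1)) (leaf Kind.i 0), r⟩) (hl : ∀ t ∈ l, t.Normal) :
    Rep D.cancel ⟨l, leaf d k, r⟩ := by
  have hi : (List.zipWith (· && ·) D.top.exposed D.bottom.exposed).findIdx? id =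
      some D.top.leavesBefore := by
    have h1 : (l.reverse.flatMap fun t => redexes (LTree.cols Kind.l 0 t)).findIdx? id = none := by
      rw [List.findIdx?_eq_none_iff]
      intro b hb
      by_contra hb'
      simp only [id, Bool.not_eq_false] at hb'
      subst hb'
      exact not_mem_redexes_flatMap (by simpa using hl) _ hb
    have h2 : (l.reverse.flatMap fun t => redexes (LTree.cols Kind.l 0 t)).length =
        (l.reverse.flatMap bots).length := by
      simp only [List.length_flatMap, length_redexes]
      congr 2
      funext t
      rw [← LTree.map_snd_cols Kind.l 0, List.length_map]
    rw [h.zipWith_exposed, State.redexes_cols, List.findIdx?_append, h1, h2, h.leavesBefore]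
    simp [LTree.cols, redexes, Redex, List.findIdx?_cons]
  have hb : D.bottom.exposed[D.top.leavesBefore]? = some true := by
    obtain ⟨hlt, h', -⟩ := List.findIdx?_eq_some_iff_getElem.1 hi
    simp only [List.getElem_zipWith, id, Bool.and_eq_true] at h'
    rw [List.getElem?_eq_some_iff]
    exact ⟨_, h'.2⟩
  rw [ForestDiagram.cancel, hi]
  constructor
  · have h0 : D.top.cur.numLeaves = 2 := by rw [h.top]; rfl
    simp only [PointedForest.modify, lt_irrefl, if_false]
    rw [if_pos (by omega), h.top]
    simp [State.top, shape, PlaneTree.collapse]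
  · rw [PointedForest.row_modify_collapse _ _ hb, h.leavesBefore, h.bottom]
    simp only [State.trees, List.flatMap_append, List.flatMap_cons, bots]
    have := rowCollapse_append_right 0 (l.reverse.flatMap bots)
      ((d, k + 1) :: (Kind.i, 0) :: r.flatMap bots)
    simpa [rowCollapse] using this

end Rep

/-! ### Removing empty columns -/

@[simp] theorem trivialSuffix_nil : trivialSuffix [] = 0 := rfl

theorem trivialSuffix_append (l : List PlaneTree) (t : PlaneTree) :
    trivialSuffix (l ++ [t]) = if t = nil then trivialSuffix l + 1 else 0 := by
  by_cases h : t = nil <;> simp [trivialSuffix, h]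

theorem exists_of_trivialSuffix_ne_zero {l : List PlaneTree} (h : trivialSuffix l ≠ 0) :
    ∃ l', l = l' ++ [nil] := by
  rcases List.eq_nil_or_concat' l with rfl | ⟨l', t, rfl⟩
  · simp at h
  · rw [trivialSuffix_append] at h
    by_cases ht : t = nil
    · exact ⟨l', by rw [ht]⟩
    · simp [ht] at h

theorem Trimmed.ne_of_append {d u : LTree} {l : List LTree} (h : Trimmed d (l ++ [u])) :
    u ≠ d := by
  induction l with
  | nil =>
    rintro rfl
    simp [Trimmed, ThompsonF.tcons] at h
  | cons t l ih => exact ih h.2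

/-- Remove a single tree `d`. -/
def trimOne (d : LTree) (l : List LTree) : List LTree := if l = [d] then [] else l

theorem trimOne_cons (d t : LTree) (l : List LTree) : trimOne d (t :: l) = tcons d t l := by
  cases l with
  | nil => by_cases h : t = d <;> simp [trimOne, tcons, h]
  | cons => simp [trimOne, tcons]

theorem Trimmed.trimOne {d : LTree} {l : List LTree} (h : Trimmed d l) :
    ThompsonF.trimOne d l = l := by
  rw [ThompsonF.trimOne, if_neg]
  rintro rfl
  simp [Trimmed, ThompsonF.tcons] at h

theorem Trimmed.cons_or {d : LTree} {l : List LTree} (h : Trimmed d l) (t : LTree) :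
    Trimmed d (t :: l) ∨ t :: l = [d] := by
  cases l with
  | nil =>
    by_cases e : t = d
    · exact Or.inr (by rw [e])
    · exact Or.inl ⟨by simp [ThompsonF.tcons, e], trivial⟩
  | cons => exact Or.inl ⟨rfl, h⟩

theorem PlaneTree.row_head? (d : Kind) (t : PlaneTree) :
    (row d 0 t).head? = some (d, 0) ↔ t = nil := by
  obtain ⟨j, l, h1, h2, -⟩ := PlaneTree.row_eq_cons d 0 t
  rw [h1, ← h2]; simp

theorem PlaneTree.row_getLast?_eq (d : Kind) (k : ℕ) (t : PlaneTree) :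
    ∃ x, (row d k t).getLast? = some x ∧ (t = nil ∧ x = (d, k) ∨ t ≠ nil ∧ x = (Kind.i, 0)) := by
  induction t generalizing d k with
  | nil => simp [row]
  | node _ a b _ ih =>
    obtain ⟨x, h1, h2⟩ := ih Kind.i 0
    refine ⟨x, ?_, Or.inr ⟨by simp, by tauto⟩⟩
    rw [row, List.getLast?_append_of_ne_nil _ (row_ne_nil _ _ _), h1]

namespace PointedForest

/-- The bottom forest is known only through its data; these still show whether a trivial unpointed
tree stands at the left end. -/
theorem row_head? (P : PointedForest) :
    P.row.head? = some (Kind.l, 0) ↔ ∃ l, P.left = l ++ [nil] := by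
  obtain ⟨l, t, r⟩ := P
  rcases List.eq_nil_or_concat' l with rfl | ⟨l', u, rfl⟩
  · obtain ⟨j, C, h1, -⟩ := PlaneTree.row_eq_cons Kind.p 0 t
    simp [row, h1]
  · simp only [row, List.reverse_append, List.reverse_singleton, List.singleton_append,
      List.flatMap_cons, List.append_assoc]
    rw [List.head?_append_of_ne_nil _ (PlaneTree.row_ne_nil _ _ _), PlaneTree.row_head?]
    simp [List.append_singleton_inj]

theorem row_getLast? (P : PointedForest) :
    P.row.getLast? = some (Kind.r, 0) ↔ ∃ l, P.right = l ++ [nil] := by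
  obtain ⟨l, t, r⟩ := P
  rcases List.eq_nil_or_concat' r with rfl | ⟨r', u, rfl⟩
  · simp only [row, List.flatMap_nil, List.append_nil]
    obtain ⟨x, h1, h2⟩ := PlaneTree.row_getLast?_eq Kind.p 0 t
    rw [List.getLast?_append_of_ne_nil _ (PlaneTree.row_ne_nil _ _ _), h1]
    rcases h2 with ⟨-, rfl⟩ | ⟨-, rfl⟩ <;> simp
  · simp only [row, List.flatMap_append, List.flatMap_cons, List.flatMap_nil, List.append_nil]
    obtain ⟨x, h1, h2⟩ := PlaneTree.row_getLast?_eq Kind.r 0 u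
    rw [← List.append_assoc, ← List.append_assoc,
      List.getLast?_append_of_ne_nil _ (PlaneTree.row_ne_nil _ _ _), h1]
    rcases h2 with ⟨h, rfl⟩ | ⟨h, rfl⟩ <;> simp [List.append_singleton_inj, h]

end PointedForest

namespace Rep

variable {D : ForestDiagram} {S : State}

/-- A letter creates at most one empty column on this side, and only as the sole tree of the list.
So `trim` removes at most one column here. -/
theorem trim_left (h : Rep D S) (hS : Trimmed dl S.left ∨ S.left = [dl]) :
    (Trimmed dl S.left ∧ min (trivialSuffix D.top.left) (trivialSuffix D.bottom.left) = 0) ∨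
    (S.left = [dl] ∧ min (trivialSuffix D.top.left) (trivialSuffix D.bottom.left) = 1 ∧
      ∃ l, D.bottom.left = l ++ [nil]) := by
  rcases hS with hS | hS
  · refine Or.inl ⟨hS, ?_⟩
    by_contra hne
    obtain ⟨l1, h1⟩ := exists_of_trivialSuffix_ne_zero (l := D.top.left) (by omega)
    have h2 := exists_of_trivialSuffix_ne_zero (l := D.bottom.left) (by omega)
    rw [← PointedForest.row_head?, h.bottom, State.trees] at h2
    rw [h.top, State.top] at h1
    rcases List.eq_nil_or_concat' S.left with h0 | ⟨l, u, h0⟩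
    · simp [h0] at h1
    · rw [h0] at h1 h2 hS
      simp only [List.map_append, List.map_cons, List.map_nil, List.append_singleton_inj] at h1
      obtain ⟨d, k, rfl⟩ := shape_eq_nil h1.2
      simp only [List.reverse_append, List.reverse_singleton, List.cons_append,
        List.flatMap_cons, bots, List.head?_cons, Option.some.injEq,
        Prod.mk.injEq] at h2
      obtain ⟨rfl, rfl⟩ := h2
      exact hS.ne_of_append rfl
  · refine Or.inr ⟨hS, ?_⟩
    have h2 : D.bottom.row.head? = some (Kind.l, 0) := by
      rw [h.bottom, State.trees, hS]; simp [bots]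
    rw [PointedForest.row_head?] at h2
    refine ⟨?_, h2⟩
    obtain ⟨l, h2⟩ := h2
    have h1 : D.top.left = [] ++ [nil] := by rw [h.top, State.top, hS]; rfl
    rw [h1, h2, trivialSuffix_append, trivialSuffix_append, if_pos rfl, if_pos rfl]
    simp

theorem trim_right (h : Rep D S) (hS : Trimmed dr S.right ∨ S.right = [dr]) :
    (Trimmed dr S.right ∧ min (trivialSuffix D.top.right) (trivialSuffix D.bottom.right) = 0) ∨
    (S.right = [dr] ∧ min (trivialSuffix D.top.right) (trivialSuffix D.bottom.right) = 1 ∧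
      ∃ l, D.bottom.right = l ++ [nil]) := by
  rcases hS with hS | hS
  · refine Or.inl ⟨hS, ?_⟩
    by_contra hne
    obtain ⟨l1, h1⟩ := exists_of_trivialSuffix_ne_zero (l := D.top.right) (by omega)
    have h2 := exists_of_trivialSuffix_ne_zero (l := D.bottom.right) (by omega)
    rw [← PointedForest.row_getLast?, h.bottom, State.trees] at h2
    rw [h.top, State.top] at h1
    rcases List.eq_nil_or_concat' S.right with h0 | ⟨l, u, h0⟩
    · simp [h0] at h1
    · rw [h0] at h1 h2 hS
      simp only [List.map_append, List.map_cons, List.map_nil, List.append_singleton_inj] at h1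
      obtain ⟨d, k, rfl⟩ := shape_eq_nil h1.2
      rw [← List.cons_append, ← List.append_assoc, List.flatMap_append] at h2
      simp only [List.flatMap_cons, bots, List.flatMap_nil, List.append_nil,
        List.getLast?_concat, Option.some.injEq, Prod.mk.injEq] at h2
      obtain ⟨rfl, rfl⟩ := h2
      exact hS.ne_of_append rfl
  · refine Or.inr ⟨hS, ?_⟩
    have h2 : D.bottom.row.getLast? = some (Kind.r, 0) := by
      rw [h.bottom, State.trees, hS, ← List.singleton_append (l := [dr]), ← List.append_assoc,
        List.flatMap_append]
      simp [bots]
    rw [PointedForest.row_getLast?] at h2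
    refine ⟨?_, h2⟩
    obtain ⟨l, h2⟩ := h2
    have h1 : D.top.right = [] ++ [nil] := by rw [h.top, State.top, hS]; rfl
    rw [h1, h2, trivialSuffix_append, trivialSuffix_append, if_pos rfl, if_pos rfl]
    simp

theorem trim (h : Rep D S) (hl : Trimmed dl S.left ∨ S.left = [dl])
    (hr : Trimmed dr S.right ∨ S.right = [dr]) :
    Rep D.trim ⟨trimOne dl S.left, S.cur, trimOne dr S.right⟩ := by
  have hL := h.trim_left hl
  have hR := h.trim_right hr
  have hb := h.bottom
  have ht := h.top
  rw [ForestDiagram.trim]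
  obtain ⟨⟨tl, tc, tr⟩, bl, bc, br⟩ := D
  obtain ⟨l, t, r⟩ := S
  simp only [State.top, PointedForest.mk.injEq, State.trees, PointedForest.row] at *
  obtain ⟨rfl, rfl, rfl⟩ := ht
  have hrow : ∀ d, PlaneTree.row d 0 nil = [(d, 0)] := fun _ => rfl
  have hdl : trimOne dl [dl] = [] := by simp [trimOne]
  have hdr : trimOne dr [dr] = [] := by simp [trimOne]
  have hrd : ∀ A : List PlaneTree, A.rdrop 0 = A := fun A => by simp [List.rdrop]
  have hrd' : ∀ (A : List PlaneTree) (x : PlaneTree), (A ++ [x]).rdrop 1 = A :=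
    fun A x => by simp [List.rdrop]
  rcases hL with ⟨hL, ha⟩ | ⟨rfl, ha, bl, rfl⟩ <;> rcases hR with ⟨hR, hb'⟩ | ⟨rfl, hb', br, rfl⟩ <;>
    rw [ha, hb']
  · rw [hL.trimOne, hR.trimOne]
    simp only [hrd]
    exact ⟨rfl, hb⟩
  · rw [hL.trimOne, hdr]
    simp only [hrd, hrd', List.flatMap_append, List.flatMap_cons, bots, List.flatMap_nil, hrow,
      ← List.append_assoc, List.append_nil, List.append_singleton_inj, and_true] at hb ⊢
    refine ⟨rfl, ?_⟩
    simp only [PointedForest.row, State.trees, List.flatMap_append, List.flatMap_cons,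
      List.flatMap_nil, List.append_nil, ← List.append_assoc]
    exact hb
  · rw [hdl, hR.trimOne]
    simp only [hrd, hrd', List.reverse_append, List.reverse_singleton, List.flatMap_cons, bots,
      hrow, List.cons_append, List.cons.injEq, true_and] at hb ⊢
    exact ⟨rfl, hb⟩
  · rw [hdl, hdr]
    simp only [hrd', List.reverse_append, List.reverse_singleton, List.flatMap_append,
      List.flatMap_cons, bots, List.flatMap_nil, hrow, List.append_nil,
      List.cons_append, List.cons.injEq, true_and] at hb ⊢
    refine ⟨rfl, ?_⟩
    simp only [PointedForest.row, State.trees, List.flatMap_cons,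
      List.flatMap_nil, List.append_nil, List.reverse_nil, List.nil_append]
    simpa only [← List.append_assoc, List.append_singleton_inj, and_true, List.nil_append] using hb

/-- Each letter on diagrams is a local move followed by cancellation and trimming. The state
performs the last two in advance, in `join` and `tcons`, and supplies missing room by `thead`. -/
theorem mul (h : Rep D S) (hS : S.Reduced) (s : Letter) :
    Rep (ForestDiagram.mul s D) (State.mul s S) := by
  obtain ⟨g, b⟩ := s
  have hL := hS.left_trimmed
  have hR := hS.right_trimmed
  have hLn := hS.left_normal
  have hRn := hS.right_normal
  have hCn := hS.cur_normal
  have roomR : Rep D.roomRight ⟨S.left, S.cur, thead dr S.right :: S.right.tail⟩ := by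
    obtain ⟨⟨tl, tc, tr⟩, bl, bc, br⟩ := D
    obtain ⟨l, t, r⟩ := S
    obtain ⟨h1, h2⟩ := h
    simp only [State.top, PointedForest.mk.injEq, State.trees] at h1 h2
    obtain ⟨rfl, rfl, rfl⟩ := h1
    cases r with
    | nil =>
      refine ⟨rfl, ?_⟩
      simp only [ForestDiagram.roomRight, List.map_nil, if_true, ForestDiagram.padRight,
        PointedForest.padRight, PointedForest.row] at h2 ⊢
      rw [List.flatMap_append, ← List.append_assoc, ← List.append_assoc, List.append_assoc _ _
        (List.flatMap _ br), h2]
      simp [State.trees, PlaneTree.row, bots, thead]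
    | cons u r => exact ⟨rfl, h2⟩
  have roomL : Rep D.roomLeft ⟨thead dl S.left :: S.left.tail, S.cur, S.right⟩ := by
    obtain ⟨⟨tl, tc, tr⟩, bl, bc, br⟩ := D
    obtain ⟨l, t, r⟩ := S
    obtain ⟨h1, h2⟩ := h
    simp only [State.top, PointedForest.mk.injEq, State.trees] at h1 h2
    obtain ⟨rfl, rfl, rfl⟩ := h1
    cases l with
    | nil =>
      refine ⟨rfl, ?_⟩
      simp only [ForestDiagram.roomLeft, List.map_nil, if_true, ForestDiagram.padLeft,
        PointedForest.padLeft, PointedForest.row] at h2 ⊢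
      rw [List.reverse_append, List.flatMap_append, List.append_assoc, h2]
      simp [State.trees, PlaneTree.row, bots, thead]
    | cons u r => exact ⟨rfl, h2⟩
  cases g <;> cases b
  · have h1 : Rep D.roomLeft.shiftLeft ⟨S.left.tail, thead dl S.left, S.cur :: S.right⟩ := by
      obtain ⟨h1, h2⟩ := roomL
      revert h1 h2
      obtain ⟨⟨tl, tc, tr⟩, B⟩ := D.roomLeft
      rintro h1 h2
      simp only [State.top, PointedForest.mk.injEq, State.trees] at h1 h2
      obtain ⟨rfl, rfl, rfl⟩ := h1
      exact ⟨rfl, by simpa [ForestDiagram.shiftLeft, State.trees] using h2⟩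
    have := h1.trim (Or.inl hL.tail) (hR.cons_or _)
    rwa [hL.tail.trimOne, trimOne_cons] at this
  · have h1 : Rep D.roomRight.shiftRight ⟨S.cur :: S.left, thead dr S.right, S.right.tail⟩ := by
      obtain ⟨h1, h2⟩ := roomR
      revert h1 h2
      obtain ⟨⟨tl, tc, tr⟩, B⟩ := D.roomRight
      rintro h1 h2
      simp only [State.top, PointedForest.mk.injEq, State.trees] at h1 h2
      obtain ⟨rfl, rfl, rfl⟩ := h1
      exact ⟨rfl, by simpa [ForestDiagram.shiftRight, State.trees] using h2⟩
    have := h1.trim (hL.cons_or _) (Or.inl hR.tail)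
    rwa [hR.tail.trimOne, trimOne_cons] at this
  · have h1 : Rep D.removeCaret ⟨S.left, S.cur.split.1, S.cur.split.2 :: S.right⟩ := by
      have hlb := h.leavesBefore
      obtain ⟨⟨tl, tc, tr⟩, B⟩ := D
      obtain ⟨l, t, r⟩ := S
      obtain ⟨h1, h2⟩ := h
      simp only [State.top, PointedForest.mk.injEq, State.trees] at h1 h2
      obtain ⟨rfl, rfl, rfl⟩ := h1
      cases t with
      | node p q =>
        refine ⟨rfl, ?_⟩
        change B.row = _
        simpa [State.trees, bots, LTree.split] using h2
      | leaf d k =>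
        refine ⟨rfl, ?_⟩
        simp only [shape, ForestDiagram.removeCaret] at hlb ⊢
        rw [PointedForest.row_modify_expand, h2, hlb, State.trees]
        · have := rowExpand_append_right 0 (l.reverse.flatMap bots) ((d, k) :: r.flatMap bots)
          simpa [rowExpand, bots, LTree.split] using this
        · rw [hlb, h2]; simp [bots]
    have h2 : Rep D.removeCaret.cancel ⟨S.left, S.cur.split.1, S.cur.split.2 :: S.right⟩ := by
      rw [h1.cancel hLn hCn.split.1]
      · exact h1
      · intro t ht
        rcases List.mem_cons.1 ht with rfl | ht
        · exact hCn.split.2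
        · exact hRn t ht
    have := h2.trim (Or.inl hL) (hR.cons_or _)
    rwa [hL.trimOne, trimOne_cons] at this
  · have h1 : Rep D.roomRight.addCaret
        ⟨S.left, LTree.node S.cur (thead dr S.right), S.right.tail⟩ := by
      obtain ⟨h1, h2⟩ := roomR
      revert h1 h2
      obtain ⟨⟨tl, tc, tr⟩, B⟩ := D.roomRight
      rintro h1 h2
      simp only [State.top, PointedForest.mk.injEq, State.trees] at h1 h2
      obtain ⟨rfl, rfl, rfl⟩ := h1
      exact ⟨rfl, by simpa [ForestDiagram.addCaret, State.trees, bots] using h2⟩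
    have h2 : Rep D.roomRight.addCaret.cancel
        ⟨S.left, LTree.join S.cur (thead dr S.right), S.right.tail⟩ := by
      rcases join_cases S.cur (thead dr S.right) with ⟨d, k, e1, e2, e⟩ | e
      · rw [e]
        rw [e1, e2] at h1
        exact h1.cancel_redex hLn
      · have hn : (LTree.join S.cur (thead dr S.right)).Normal :=
          hCn.join (State.normal_thead (d := dr) trivial hRn)
        rw [e] at hn ⊢
        rw [h1.cancel hLn hn]
        · exact h1
        · exact fun t ht => hRn t (List.mem_of_mem_tail ht)
    have := h2.trim (Or.inl hL) (Or.inl hR.tail)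
    rwa [hL.trimOne, hR.tail.trimOne] at this

end Rep

theorem rep_ofWord (w : List Letter) : Rep (ForestDiagram.ofWord w) (State.ofWord w) := by
  induction w with
  | nil => exact ⟨rfl, rfl⟩
  | cons s w ih => exact ih.mul (State.reduced_ofWord w) s

/-- The weight of a column given by its data. -/
def colWeight (x : Col × Col) : ℕ := columnWeight (label x.1) (label x.2)

/-- The weight of a state. -/
def State.weight (S : State) : ℕ := (S.cols.tail.map colWeight).sum

theorem Rep.weight {D : ForestDiagram} {S : State} (h : Rep D S) : D.weight = S.weight := by
  rw [ForestDiagram.weight, PointedForest.labels_eq, PointedForest.labels_eq, h.top, h.bottom,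
    ← S.map_fst_cols, ← S.map_snd_cols, State.weight, ← List.map_tail, ← List.map_tail]
  generalize S.cols.tail = C
  induction C with
  | nil => rfl
  | cons x C ih =>
    simp only [List.map_cons, List.zipWith_cons_cons, List.sum_cons]
    rw [ih, colWeight]

end ThompsonF

namespace ThompsonF

open BinaryTree LTree

/-! ### Neighbouring columns of a row -/

/-- Which data can follow each other in a row. -/
structure Next (x y : Col) : Prop where
  of_ne : x.2 ≠ 0 → y.1 = Kind.i
  of_l : x = (Kind.l, 0) → y.1 = Kind.l ∨ y.1 = Kind.p
  of_p : x = (Kind.p, 0) → y.1 = Kind.r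
  of_r : x = (Kind.r, 0) → y.1 = Kind.r

/-- Properties of the row of a pointed forest. -/
structure RowOk (R : List Col) : Prop where
  chain : R.IsChain Next
  head : ∀ x ∈ R.head?, x.1 = Kind.l ∨ x.1 = Kind.p
  last : ∀ x ∈ R.getLast?, x.2 = 0 ∧ x.1 ≠ Kind.l

theorem PlaneTree.isChain_row (d : Kind) (k : ℕ) (t : PlaneTree) :
    (row d k t).IsChain Next := by
  induction t generalizing d k with
  | nil => simp [row]
  | node _ a b iha ihb =>
    rw [row, List.isChain_append]
    refine ⟨iha _ _, ihb _ _, fun x hx y hy => ?_⟩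
    obtain ⟨j, C, h1, -⟩ := row_eq_cons Kind.i 0 b
    rw [h1] at hy
    simp only [List.head?_cons, Option.mem_def, Option.some.injEq] at hy
    obtain ⟨z, h2, h3⟩ := row_getLast?_eq d (k + 1) a
    rw [h2] at hx
    cases hx
    subst hy
    rcases h3 with ⟨-, rfl⟩ | ⟨-, rfl⟩ <;> constructor <;> simp

theorem PlaneTree.isChain_row_append (d : Kind) (t : PlaneTree) {C : List Col}
    (hC : C.IsChain Next) (h : ∀ y ∈ C.head?, Next (d, 0) y) :
    (row d 0 t ++ C).IsChain Next := by
  rw [List.isChain_append]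
  refine ⟨isChain_row _ _ _, hC, fun x hx y hy => ?_⟩
  obtain ⟨z, h2, h3⟩ := row_getLast?_eq d 0 t
  rw [h2] at hx
  cases hx
  rcases h3 with ⟨-, rfl⟩ | ⟨-, rfl⟩
  · exact h y hy
  · constructor <;> simp

theorem PlaneTree.kind_head?_row (d : Kind) (t : PlaneTree) (C : List Col) :
    ∀ y ∈ (row d 0 t ++ C).head?, y.1 = d := by
  obtain ⟨j, l, h1, -⟩ := row_eq_cons d 0 t
  rw [h1]; simp

/-- These constraints on neighbouring data exclude the columns for which the weight estimates would
fail. -/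
theorem PointedForest.rowOk (P : PointedForest) : RowOk P.row := by
  obtain ⟨l, t, r⟩ := P
  constructor
  · have hr : (r.flatMap (PlaneTree.row Kind.r 0)).IsChain Next ∧
        ∀ y ∈ (r.flatMap (PlaneTree.row Kind.r 0)).head?, y.1 = Kind.r := by
      induction r with
      | nil => simp
      | cons u r ih =>
        rw [List.flatMap_cons]
        exact ⟨PlaneTree.isChain_row_append _ _ ih.1
          fun y hy => by constructor <;> simp [ih.2 y hy], PlaneTree.kind_head?_row _ _ _⟩
    have hc := PlaneTree.isChain_row_append Kind.p t hr.1
      (fun y hy => by constructor <;> simp [hr.2 y hy])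
    have hl : ∀ (A : List PlaneTree), (A.flatMap (PlaneTree.row Kind.l 0) ++
        (PlaneTree.row Kind.p 0 t ++ r.flatMap (PlaneTree.row Kind.r 0))).IsChain Next ∧
        ∀ y ∈ (A.flatMap (PlaneTree.row Kind.l 0) ++
        (PlaneTree.row Kind.p 0 t ++ r.flatMap (PlaneTree.row Kind.r 0))).head?,
          y.1 = Kind.l ∨ y.1 = Kind.p := by
      intro A
      induction A with
      | nil => exact ⟨hc, fun y hy => Or.inr (PlaneTree.kind_head?_row _ _ _ y hy)⟩
      | cons u A ih =>
        rw [List.flatMap_cons, List.append_assoc]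
        exact ⟨PlaneTree.isChain_row_append _ _ ih.1
          fun y hy => by constructor <;> simp [ih.2 y hy],
          fun y hy => Or.inl (PlaneTree.kind_head?_row _ _ _ y hy)⟩
    exact (hl l.reverse).1
  · intro x hx
    simp only [row] at hx
    cases h : l.reverse with
    | nil =>
      rw [h] at hx
      exact Or.inr (PlaneTree.kind_head?_row _ _ _ x hx)
    | cons u A =>
      rw [h, List.flatMap_cons, List.append_assoc] at hx
      exact Or.inl (PlaneTree.kind_head?_row _ _ _ x hx)
  · intro x hx
    rcases List.eq_nil_or_concat' r with rfl | ⟨r', u, rfl⟩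
    · simp only [row, List.flatMap_nil, List.append_nil] at hx
      obtain ⟨z, h1, h2⟩ := PlaneTree.row_getLast?_eq Kind.p 0 t
      rw [List.getLast?_append_of_ne_nil _ (PlaneTree.row_ne_nil _ _ _), h1] at hx
      cases hx
      rcases h2 with ⟨-, rfl⟩ | ⟨-, rfl⟩ <;> simp
    · simp only [row, List.flatMap_append, List.flatMap_cons, List.flatMap_nil,
        List.append_nil] at hx
      obtain ⟨z, h1, h2⟩ := PlaneTree.row_getLast?_eq Kind.r 0 u
      rw [← List.append_assoc, ← List.append_assoc,
        List.getLast?_append_of_ne_nil _ (PlaneTree.row_ne_nil _ _ _), h1] at hx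
      cases hx
      rcases h2 with ⟨h, rfl⟩ | ⟨h, rfl⟩ <;> simp

/-! ### The weight and the letters -/

/-- The total weight of a list of columns. -/
def colsWeight (C : List (Col × Col)) : ℕ := (C.map colWeight).sum

theorem colsWeight_append (C E : List (Col × Col)) :
    colsWeight (C ++ E) = colsWeight C + colsWeight E := by simp [colsWeight]

theorem colsWeight_cons (x : Col × Col) (C : List (Col × Col)) :
    colsWeight (x :: C) = colWeight x + colsWeight C := by simp [colsWeight]

/-- The total weight of the columns of trees of kind `d`. -/
def treesWeight (d : Kind) (A : List LTree) : ℕ :=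
  (A.map fun t => colsWeight (LTree.cols d 0 t)).sum

theorem treesWeight_cons (d : Kind) (t : LTree) (A : List LTree) :
    treesWeight d (t :: A) = colsWeight (LTree.cols d 0 t) + treesWeight d A := by
  simp [treesWeight]

@[simp] theorem treesWeight_nil (d : Kind) : treesWeight d [] = 0 := rfl

theorem colsWeight_flatMap (d : Kind) (A : List LTree) :
    colsWeight (A.flatMap (LTree.cols d 0)) = treesWeight d A := by
  induction A with
  | nil => rfl
  | cons t A ih => rw [List.flatMap_cons, colsWeight_append, ih, treesWeight_cons]

/-- The top labels of these two kinds are both `L`, whatever the caret count, and only the first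
column of the tree depends on kind and count. -/
theorem colsWeight_cols_l (k k' : ℕ) (t : LTree) :
    colsWeight (LTree.cols Kind.p k t) = colsWeight (LTree.cols Kind.l k' t) := by
  obtain ⟨j, y, C, h, -⟩ := cols_eq_cons t
  rw [h, h, colsWeight_cons, colsWeight_cons]
  rfl

/-- The row of `L` in the table differs in every entry by one from that of `R` and from that of `X`.
-/
theorem colWeight_r_l (j : ℕ) (y : Col) :
    colWeight ((Kind.l, j), y) ≤ colWeight ((Kind.r, j), y) + 1 ∧
      colWeight ((Kind.r, j), y) ≤ colWeight ((Kind.l, j), y) + 1 := by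
  obtain ⟨d, m⟩ := y
  rcases d <;> rcases m <;> rcases j <;> simp [colWeight, label, columnWeight]

theorem colWeight_r_i (j : ℕ) (y : Col) :
    colWeight ((Kind.i, j), y) ≤ colWeight ((Kind.r, j), y) + 1 ∧
      colWeight ((Kind.r, j), y) ≤ colWeight ((Kind.i, j), y) + 1 := by
  obtain ⟨d, m⟩ := y
  rcases d <;> rcases m <;> rcases j <;> simp [colWeight, label, columnWeight]

theorem colsWeight_r_l (t : LTree) :
    colsWeight (LTree.cols Kind.l 0 t) ≤ colsWeight (LTree.cols Kind.r 0 t) + 1 ∧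
      colsWeight (LTree.cols Kind.r 0 t) ≤ colsWeight (LTree.cols Kind.l 0 t) + 1 := by
  obtain ⟨j, y, C, h, -⟩ := cols_eq_cons t
  simp only [h, colsWeight_cons, Nat.zero_add]
  have := colWeight_r_l j y
  omega

theorem colsWeight_r_i (t : LTree) :
    colsWeight (LTree.cols Kind.i 0 t) ≤ colsWeight (LTree.cols Kind.r 0 t) + 1 ∧
      colsWeight (LTree.cols Kind.r 0 t) ≤ colsWeight (LTree.cols Kind.i 0 t) + 1 := by
  obtain ⟨j, y, C, h, -⟩ := cols_eq_cons t
  simp only [h, colsWeight_cons, Nat.zero_add]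
  have := colWeight_r_i j y
  omega

namespace LTree

theorem bots_eq_cons (t : LTree) : ∃ j y C B, (∀ d k, cols d k t = ((d, k + j), y) :: C) ∧
    bots t = y :: B ∧ (j = 0 → t = leaf y.1 y.2 ∧ C = []) := by
  obtain ⟨j, y, C, h, h1, h2⟩ := cols_eq_cons t
  refine ⟨j, y, C, C.map Prod.snd, h, ?_, fun hj => ?_⟩
  · rw [← map_snd_cols Kind.l 0, h]; rfl
  · obtain ⟨e, m, rfl⟩ := h1.1 hj
    obtain ⟨rfl, rfl⟩ := h2 e m rfl
    exact ⟨rfl, rfl⟩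

end LTree

namespace State

/-- A state that can occur, as far as its bottom row is concerned. -/
def BotOk (S : State) : Prop := RowOk (S.trees.flatMap bots)

theorem botOk_ofWord (w : List Letter) : (ofWord w).BotOk := by
  rw [BotOk, ← (rep_ofWord w).bottom]
  exact PointedForest.rowOk _

theorem colsWeight_cols (S : State) : colsWeight S.cols = treesWeight Kind.l S.left +
    (colsWeight (LTree.cols Kind.l 0 S.cur) + treesWeight Kind.r S.right) := by
  rw [cols, colsWeight_append, colsWeight_append, colsWeight_flatMap, colsWeight_flatMap,
    colsWeight_cols_l 0 0]
  congr 1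
  rw [treesWeight, treesWeight, List.map_reverse, List.sum_reverse]

/-- In the first column both kinds are `l` or `p`, so it would count as a column of type (L, L).
Including it makes the total additive over trees, at the cost of the constant 2. -/
theorem BotOk.weight {S : State} (h : S.BotOk) : colsWeight S.cols = S.weight + 2 := by
  have hh := h.head
  rw [← S.map_snd_cols] at hh
  have hk : ∀ x ∈ S.cols.head?, x.1.1 = Kind.l ∨ x.1.1 = Kind.p := by
    intro x hx
    apply (PointedForest.rowOk S.top).head
    rw [← S.map_fst_cols, List.head?_map]
    exact Option.mem_map_of_mem _ hx
  rw [State.weight]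
  cases hc : S.cols with
  | nil =>
    have : LTree.cols Kind.p 0 S.cur ≠ [] := cols_ne_nil _ _ _
    simp [cols, this] at hc
  | cons x C =>
    rw [hc] at hh hk
    have h1 := hk x rfl
    have h2 := hh x.2 rfl
    rw [colsWeight_cons, Nat.add_comm]
    congr 1
    obtain ⟨⟨a, b⟩, c, d⟩ := x
    rcases h1 with rfl | rfl <;> rcases h2 with rfl | rfl <;> rfl

theorem treesWeight_tcons (t : LTree) (l : List LTree) :
    treesWeight Kind.l (tcons dl t l) ≤ treesWeight Kind.l (t :: l) := by
  cases l with
  | nil => by_cases h : t = dl <;> simp [tcons, h]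
  | cons => exact le_rfl

/-- The old pointed tree keeps the label `L` in front of it; only the tree that becomes pointed has
its first label changed. -/
theorem weight_mul_x0 {S : State} (hS : S.BotOk) :
    colsWeight (mul (Gen.x0, true) S).cols ≤ colsWeight S.cols + 1 ∧
      colsWeight S.cols ≤ colsWeight (mul (Gen.x0, true) S).cols + 1 := by
  obtain ⟨l, t, r⟩ := S
  rw [colsWeight_cols, colsWeight_cols]
  simp only [mul]
  -- Here the first column, which counts 2, becomes empty and is trimmed. The next bottom label is
  -- then `L`, so the column behind it rises from 1 to 2: a net loss of 1.
  by_cases hd : l = [] ∧ t = dl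
  · obtain ⟨rfl, rfl⟩ := hd
    cases r with
    | nil =>
      have := hS.last (Kind.l, 0) (by simp [trees, bots])
      simp at this
    | cons u r =>
      obtain ⟨j, y, C, B, h, h1, -⟩ := bots_eq_cons u
      have hn : Next (Kind.l, 0) y := by
        have := hS.chain
        simp only [trees, List.reverse_nil, List.nil_append, List.flatMap_cons, bots, h1,
          List.cons_append, List.isChain_cons_cons] at this
        exact this.1
      have := hn.of_l rfl
      obtain ⟨d, m⟩ := y
      simp only [tcons, if_true, thead, List.tail_cons, treesWeight_nil, treesWeight_cons, h,
        colsWeight_cons, Nat.zero_add, LTree.cols]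
      rcases this with h' | h' <;> simp only at h' <;> subst h' <;> cases j <;>
        simp [colWeight, label, columnWeight, colsWeight] <;> omega
  · have ht : tcons dl t l = t :: l := by
      cases l with
      | nil => simp only [true_and] at hd; simp [tcons, hd]
      | cons => rfl
    rw [ht, treesWeight_cons]
    -- Without a tree to the right, an empty column is opened and becomes an (L, R) column of weight
    -- 1.
    cases r with
    | nil =>
      simp only [thead, List.tail_nil, treesWeight_nil, LTree.cols]
      simp only [colsWeight, List.map_cons, List.map_nil, List.sum_cons, colWeight, label,
        columnWeight, List.sum_nil]
      omega
    | cons u r =>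
      simp only [thead, List.tail_cons, treesWeight_cons]
      have := colsWeight_r_l u
      omega

/-- The gap between the two joined trees turns from `R` or `X` into `I` or `N`. The extra caret at
the first leaf of the pointed tree does not change its label `L`. -/
theorem weight_mul_x1 (S : State) :
    colsWeight (mul (Gen.x1, true) S).cols ≤ colsWeight S.cols + 1 ∧
      colsWeight S.cols ≤ colsWeight (mul (Gen.x1, true) S).cols + 1 := by
  obtain ⟨l, t, r⟩ := S
  rw [colsWeight_cols, colsWeight_cols]
  simp only [mul]
  cases r with
  | nil =>
    have : LTree.join t dr = LTree.node t dr := by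
      rcases join_cases t dr with ⟨d, k, -, h, -⟩ | h
      · simp at h
      · exact h
    rw [thead, this, LTree.cols, ← colsWeight_cols_l 0 0 t, List.tail_nil, treesWeight_nil,
      colsWeight_append, ← colsWeight_cols_l (0 + 1) (0 + 1) t, colsWeight_cols_l 0 (0 + 1) t,
      colsWeight_cols_l (0 + 1) (0 + 1) t]
    simp only [LTree.cols, colsWeight, List.map_cons, List.map_nil, List.sum_cons, colWeight,
      label, columnWeight, List.sum_nil]
    omega
  | cons u r =>
    simp only [thead, List.tail_cons, treesWeight_cons]
    -- A cancellation deletes an (R, I) column of weight 1. The remaining column keeps its weight,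
    -- since `L` faces `I` and `N` with the same weight, and likewise `R` and `X`.
    rcases join_cases t u with ⟨d, k, rfl, rfl, h⟩ | h
    · rw [h]
      simp only [LTree.cols, colsWeight_cons]
      rcases d <;> rcases k <;>
        simp [colWeight, label, columnWeight, colsWeight] <;> omega
    · rw [h, LTree.cols, colsWeight_append, ← colsWeight_cols_l 0 (0 + 1) t,
        colsWeight_cols_l 0 0 t]
      have := colsWeight_r_i u
      omega

/-- The bound for an inverse letter is the lower bound for the positive letter that undoes it; hence
the two-sided `key`. -/
theorem weight_cons_le (s : Letter) (w : List Letter) :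
    (ofWord (s :: w)).weight ≤ (ofWord w).weight + 1 := by
  have key : ∀ (g : Gen) (v : List Letter),
      (ofWord ((g, true) :: v)).weight ≤ (ofWord v).weight + 1 ∧
      (ofWord v).weight ≤ (ofWord ((g, true) :: v)).weight + 1 := by
    intro g v
    have h1 := (botOk_ofWord v).weight
    have h2 := (botOk_ofWord ((g, true) :: v)).weight
    rw [ofWord, List.foldr_cons, ← ofWord] at h2 ⊢
    cases g
    · have := weight_mul_x0 (botOk_ofWord v)
      omega
    · have := weight_mul_x1 (ofWord v)
      omega
  obtain ⟨g, b⟩ := s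
  cases b
  · have := (key g ((g, false) :: w)).2
    have e : ofWord ((g, true) :: (g, false) :: w) = ofWord w :=
      mul_not_mul (reduced_ofWord w) g false
    rwa [e] at this
  · exact (key g w).1

theorem weight_ofWord_le (w : List Letter) : (ofWord w).weight ≤ w.length := by
  induction w with
  | nil => simp [ofWord, init, State.weight, State.cols, LTree.cols]
  | cons s w ih =>
    have := weight_cons_le s w
    rw [List.length_cons]
    omega

/-- A caret at the pointer is removed if this helps. Otherwise the pointer moves towards a place
where something can be undone, or an available cancellation is carried out. -/
theorem exists_weight_lt {S : State} (hS : S.Reduced) (hB : S.BotOk) (hne : S ≠ init) :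
    ∃ s, colsWeight (mul s S).cols < colsWeight S.cols := by
  obtain ⟨l, t, r⟩ := S
  have hchain := hB.chain
  simp only [trees, List.flatMap_append, List.flatMap_cons] at hchain
  have hc1 := (List.isChain_append.1 hchain).2.1
  cases t with
  | node a b =>
    -- Removing the caret turns `I` into `R`, or `N` into `X`. This fails to help only for `I`
    -- facing `R`; then all bottom trees further on lie right of the pointer, and moving right turns
    -- a weight 2 into 1. If nothing follows, the detached leaf is trimmed instead.
    by_cases hb : b = dr ∧ r ≠ []
    · obtain ⟨rfl, hr⟩ := hb
      obtain ⟨u, r, rfl⟩ := List.exists_cons_of_ne_nil hr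
      refine ⟨(Gen.x0, true), ?_⟩
      obtain ⟨j, y, C, B, h, h1, -⟩ := bots_eq_cons u
      have hy : y.1 = Kind.r := by
        have := (List.isChain_append.1 hc1).2.2 (Kind.r, 0) (by simp [bots]) y (by simp [h1])
        exact this.of_r rfl
      rw [colsWeight_cols, colsWeight_cols]
      have ht : tcons dl (LTree.node a dr) l = LTree.node a dr :: l := by cases l <;> simp [tcons]
      simp only [mul, ht, thead, List.tail_cons, treesWeight_cons, h, colsWeight_cons]
      obtain ⟨d, m⟩ := y
      simp only at hy
      subst hy
      cases j <;> cases m <;> simp [colWeight, label, columnWeight] <;> omega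
    · refine ⟨(Gen.x1, false), ?_⟩
      rw [colsWeight_cols, colsWeight_cols]
      simp only [mul, LTree.split, LTree.cols, colsWeight_append]
      rw [← colsWeight_cols_l 0 (0 + 1) a, colsWeight_cols_l 0 0 a]
      have key : treesWeight Kind.r (tcons dr b r) <
          colsWeight (LTree.cols Kind.i 0 b) + treesWeight Kind.r r := by
        by_cases hb' : b = dr
        · have hr : r = [] := by tauto
          subst hr hb'
          simp [tcons, LTree.cols, colsWeight, colWeight, label, columnWeight]
        · have ht : tcons dr b r = b :: r := by cases r <;> simp [tcons, hb']
          rw [ht, treesWeight_cons]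
          obtain ⟨j, ⟨d, m⟩, C, B, h, h1, h2⟩ := bots_eq_cons b
          simp only [h, colsWeight_cons]
          cases j with
          | zero =>
            obtain ⟨rfl, rfl⟩ := h2 rfl
            cases d <;> cases m <;> simp [colWeight, label, columnWeight] at hb' ⊢
          | succ j => cases d <;> cases m <;> simp [colWeight, label, columnWeight]
      omega
  | leaf d k =>
    have hhead : l = [] → d = Kind.l ∨ d = Kind.p := by
      rintro rfl
      exact hB.head (d, k) (by simp [trees, bots])
    -- Moving left turns the first label of the old pointed tree, a single leaf, from `L` into `R`.
    -- This gains against `I` and `L`; against `R` at the right end the column is trimmed.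
    have left : ∀ v l', l = v :: l' → (d = Kind.i ∨ r = [] ∨ d = Kind.l) → k = 0 →
        (r = [] → d ≠ Kind.l) →
        colsWeight (mul (Gen.x0, false) ⟨l, leaf d k, r⟩).cols <
          colsWeight (cols ⟨l, leaf d k, r⟩) := by
      rintro v l' rfl hd rfl hdr
      rw [colsWeight_cols, colsWeight_cols]
      simp only [mul, thead, List.tail_cons, treesWeight_cons]
      have key : treesWeight Kind.r (tcons dr (leaf d 0) r) <
          colsWeight (LTree.cols Kind.l 0 (leaf d 0)) + treesWeight Kind.r r := by
        by_cases hr : r = []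
        · subst hr
          have := hdr rfl
          cases d <;> simp_all [tcons, LTree.cols, colsWeight, colWeight, label, columnWeight,
            treesWeight]
        · obtain ⟨u, r, rfl⟩ := List.exists_cons_of_ne_nil hr
          simp only [tcons, treesWeight_cons]
          cases d <;> simp_all [LTree.cols, colsWeight, colWeight, label, columnWeight]
      omega
    cases r with
    | nil =>
      have hlast := hB.last (d, k) (by simp [trees, bots])
      obtain ⟨rfl, hd⟩ : k = 0 ∧ d ≠ Kind.l := hlast
      cases l with
      | nil =>
        rcases hhead rfl with rfl | rfl
        · exact absurd rfl hd
        · exact absurd rfl hne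
      | cons v l => exact ⟨_, left v l rfl (Or.inr (Or.inl rfl)) rfl fun _ => hd⟩
    | cons u r =>
      obtain ⟨j, ⟨e, m⟩, C, B, h, h1, h2⟩ := bots_eq_cons u
      have hn : Next (d, k) (e, m) := by
        simp only [bots, List.flatMap_cons, h1, List.cons_append, List.nil_append,
          List.isChain_cons_cons] at hc1
        exact hc1.1
      have right : colWeight ((Kind.l, j), (e, m)) < colWeight ((Kind.r, j), (e, m)) →
          colsWeight (mul (Gen.x0, true) ⟨l, leaf d k, u :: r⟩).cols <
            colsWeight (cols ⟨l, leaf d k, u :: r⟩) := by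
        intro hlt
        rw [colsWeight_cols, colsWeight_cols]
        have := treesWeight_tcons (leaf d k) l
        simp only [mul, thead, List.tail_cons, treesWeight_cons, h, colsWeight_cons,
          Nat.zero_add] at this ⊢
        omega
      by_cases hlt : colWeight ((Kind.l, j), (e, m)) < colWeight ((Kind.r, j), (e, m))
      · exact ⟨_, right hlt⟩
      -- Moving right fails to help only if the next column faces `L`, or is an (R, I) column.
      have hcases : (e = Kind.l ∨ e = Kind.p) ∨ (e = Kind.i ∧ m = 0 ∧ j = 0) := by
        revert hlt
        cases e <;> cases m <;> cases j <;> simp [colWeight, label, columnWeight]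
      rcases hcases with he | ⟨rfl, rfl, rfl⟩
      · have hk : k = 0 := by
          by_contra hk
          have := hn.of_ne hk
          simp only at this
          subst this
          simp at he
        subst hk
        have hd : d = Kind.i ∨ d = Kind.l := by
          cases d
          · exact Or.inl rfl
          · exact Or.inr rfl
          · have := hn.of_p rfl
            simp only at this
            subst this
            simp at he
          · have := hn.of_r rfl
            simp only at this
            subst this
            simp at he
        cases l with
        | cons v l => exact ⟨_, left v l rfl (by tauto) rfl (by simp)⟩
        | nil =>
          have hd : d = Kind.l := by
            rcases hhead rfl with h | h
            · exact h
            · subst h; simp at hd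
          subst hd
          -- There is no tree on the left, but the pointed column is empty once the pointer leaves
          -- it, and trimming gives the gain.
          refine ⟨(Gen.x0, true), ?_⟩
          rw [colsWeight_cols, colsWeight_cols]
          simp only [mul, tcons, if_true, thead, List.tail_cons, treesWeight_nil,
            treesWeight_cons, h, colsWeight_cons, Nat.zero_add, LTree.cols]
          rcases he with rfl | rfl <;> cases j <;>
            simp [colWeight, label, columnWeight, colsWeight] <;> omega
      · obtain ⟨rfl, rfl⟩ := h2 rfl
        -- For `k = 0` the bottom leaf must lie inside a tree and moving left helps; otherwise the
        -- two bottom leaves form a caret, and joining the top leaves cancels it.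
        by_cases hk : k = 0
        · subst hk
          have hd : d = Kind.i := by
            cases d
            · rfl
            · have := hn.of_l rfl; simp at this
            · have := hn.of_p rfl; simp at this
            · have := hn.of_r rfl; simp at this
          subst hd
          cases l with
          | nil => have := hhead rfl; simp at this
          | cons v l => exact ⟨_, left v l rfl (Or.inl rfl) rfl (by simp)⟩
        · obtain ⟨k, rfl⟩ := Nat.exists_eq_succ_of_ne_zero hk
          refine ⟨(Gen.x1, true), ?_⟩
          rw [colsWeight_cols, colsWeight_cols]
          simp only [mul, thead, List.tail_cons, LTree.join, treesWeight_cons, LTree.cols,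
            colsWeight_cons]
          cases d <;> cases k <;> simp [colWeight, label, columnWeight, colsWeight]

end State

/-! ### The weight as geodesic length. -/

/-- For the upper bound, a letter that lowers the weight is prepended and the induction applies; its
inverse then costs one letter. The lower bound holds since every representing word leads to the same
state. -/
theorem geodesicLength_element (w : List Letter) :
    geodesicLength (element w) = (State.ofWord w).weight := by
  apply le_antisymm
  · generalize hn : (State.ofWord w).weight = n
    induction n using Nat.strong_induction_on generalizing w with
    | _ n ih =>
      subst hn
      by_cases h : State.ofWord w = State.init
      · have : element w = element [] := State.element_eq_iff.2 h
        have h0 : geodesicLength (element w) ≤ 0 := Nat.sInf_le ⟨[], rfl, this.symm⟩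
        omega
      · obtain ⟨⟨g, b⟩, hs⟩ := State.exists_weight_lt (State.reduced_ofWord w)
          (State.botOk_ofWord w) h
        have h1 := (State.botOk_ofWord w).weight
        have h2 := (State.botOk_ofWord ((g, b) :: w)).weight
        have h3 : (State.ofWord ((g, b) :: w)).weight < (State.ofWord w).weight := by
          rw [State.ofWord, List.foldr_cons, ← State.ofWord] at h2 ⊢
          omega
        have h4 := ih _ h3 ((g, b) :: w) rfl
        obtain ⟨v, hv, hv'⟩ := Nat.sInf_mem
          (s := {k | ∃ v : List Letter, v.length = k ∧ element v = element ((g, b) :: w)})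
          ⟨_, (g, b) :: w, rfl, rfl⟩
        have h5 : geodesicLength (element w) ≤ v.length + 1 := by
          refine Nat.sInf_le ⟨(g, !b) :: v, rfl, ?_⟩
          rw [State.element_cons, hv', State.element_cons]
          cases b <;> simp
        have h6 : v.length = geodesicLength (element ((g, b) :: w)) := hv
        omega
  · refine le_csInf ⟨_, w, rfl, rfl⟩ ?_
    rintro k ⟨v, rfl, hv⟩
    rw [← State.ofWord_eq_of_element_eq hv]
    exact State.weight_ofWord_le v

theorem geodesicLength_eq_weight (w : List Letter) :
    geodesicLength (element w) = (ForestDiagram.ofWord w).weight := by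
  rw [geodesicLength_element, (rep_ofWord w).weight]

end ThompsonF

namespace ThompsonF

instance : Fintype Gen := ⟨{Gen.x0, Gen.x1}, by rintro (_ | _) <;> simp⟩

instance : Fintype Kind := ⟨{Kind.i, Kind.l, Kind.p, Kind.r}, by rintro (_ | _ | _ | _) <;> simp⟩

/-! ### A machine with stacks

Each step pops a symbol from a stack which depends on the label, then pushes symbols and goes to a
label, both depending on the label and the symbol. -/

namespace Machine

/-- Tape symbols: a caret of the top row, a caret of the bottom row, the end of a tree, the end of a
tree to the left of the pointer, and a leaf. -/
inductive Sym
  | up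
  | down
  | bar
  | lbar
  | tok (d : Kind)
  deriving DecidableEq, Fintype

/-- The stacks. -/
inductive Stk
  | inp
  | rev
  | left
  | right
  | tmp
  | cnt
  | out
  deriving DecidableEq

instance : Fintype Stk :=
  ⟨{.inp, .rev, .left, .right, .tmp, .cnt, .out}, by
    rintro (_ | _ | _ | _ | _ | _ | _) <;> simp⟩

/-- The alphabets of the stacks. -/
def Gam : Stk → Type
  | .inp => Letter
  | .rev => Letter
  | .left => Sym
  | .right => Sym
  | .tmp => Sym
  | .cnt => Sym
  | .out => Bool

/-- A symbol together with a stack. -/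
inductive Item
  | inp (a : Letter)
  | rev (a : Letter)
  | left (s : Sym)
  | right (s : Sym)
  | tmp (s : Sym)
  | cnt (s : Sym)
  | out (b : Bool)
  deriving DecidableEq, Fintype

namespace Item

/-- The item of a symbol of a stack. -/
def mk : (k : Stk) → Gam k → Item
  | .inp, a => .inp a
  | .rev, a => .rev a
  | .left, s => .left s
  | .right, s => .right s
  | .tmp, s => .tmp s
  | .cnt, s => .cnt s
  | .out, b => .out b

/-- The stack of an item. -/
def stk : Item → Stk
  | .inp _ => .inp
  | .rev _ => .rev
  | .left _ => .left
  | .right _ => .right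
  | .tmp _ => .tmp
  | .cnt _ => .cnt
  | .out _ => .out

/-- The symbol of an item. -/
def val : (x : Item) → Gam x.stk
  | .inp a => a
  | .rev a => a
  | .left s => s
  | .right s => s
  | .tmp s => s
  | .cnt s => s
  | .out b => b

end Item

/-- The labels. -/
inductive Q
  | load
  | main
  | right0
  | right1
  | right2
  | right3
  | right4
  | left0
  | left1
  | left2
  | left3
  | left4
  | join0
  | join1 (f : Bool)
  | join2 (f : Bool)
  | join3 (f : Bool)
  | join4
  | split0
  | split1
  | split2
  | split3
  | split4
  | split5
  | split6
  | split7
  | split8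
  | gather
  | weigh (d : Option Kind) (f g : Bool)
  | inc (n : Fin 5)
  | carry (n : Fin 5)
  deriving Fintype

/-- The stack that is read at a label. -/
def src : Q → Stk
  | .load => .inp
  | .main => .rev
  | .right0 => .left
  | .right1 => .right
  | .right2 => .right
  | .right3 => .right
  | .right4 => .right
  | .left0 => .right
  | .left1 => .right
  | .left2 => .right
  | .left3 => .left
  | .left4 => .left
  | .join0 => .right
  | .join1 _ => .right
  | .join2 _ => .right
  | .join3 _ => .tmp
  | .join4 => .right
  | .split0 => .right
  | .split1 => .right
  | .split2 => .cnt
  | .split3 => .right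
  | .split4 => .right
  | .split5 => .right
  | .split6 => .right
  | .split7 => .tmp
  | .split8 => .tmp
  | .gather => .left
  | .weigh _ _ _ => .right
  -- A step always pops. When counting is over, the pop is directed at a stack that is empty during
  -- the scan, so the output survives.
  | .inc n => if n = 0 then .tmp else .out
  | .carry _ => .cnt

/-- The weight of a column with the given kinds of gaps, where it is known if carets start at the
leaves. The first column does not count. -/
def unit (d : Option Kind) (f g : Bool) (e : Kind) : Fin 5 :=
  match d with
  | none => 0
  | some d => Fin.ofNat 5 (colWeight ((d, cond f 1 0), (e, cond g 1 0)))

open Item Machine.Sym Q in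
/-- The program: which symbols are pushed, and the next label. -/
def act : Q → Option Item → List Item × Option Q
  | load, o => match o with
    | some (inp a) => ([rev a], some load)
    | _ => ([right bar, right (tok Kind.p)], some main)
  | main, o => match o with
    | some (rev (Gen.x0, true)) => ([], some right0)
    | some (rev (Gen.x0, false)) => ([], some left0)
    | some (rev (Gen.x1, true)) => ([], some join0)
    | some (rev (Gen.x1, false)) => ([], some split0)
    | _ => ([], some gather)
  | right0, o => match o with
    | some x => ([x], some right3)
    | none => ([], some right1)
  | right1, o => match o with
    | some (right (tok Kind.l)) => ([], some right2)
    | some x => ([x], some right3)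
    | none => ([], none)
  | right2, _ => ([], some right4)
  | right3, o => match o with
    | some (right bar) => ([left bar], some right4)
    | some (right s) => ([left s], some right3)
    | _ => ([], none)
  | right4, o => match o with
    | some x => ([x], some main)
    | none => ([right bar, right (tok Kind.r)], some main)
  | left0, o => match o with
    | some (right (tok Kind.r)) => ([], some left1)
    | some x => ([x], some left3)
    | none => ([], none)
  | left1, _ => ([], some left2)
  | left2, o => match o with
    | some x => ([x, right bar, right (tok Kind.r)], some left3)
    | none => ([], some left3)
  | left3, o => match o with
    | some _ => ([right bar], some left4)
    | none => ([right bar, right (tok Kind.l)], some main)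
  | left4, o => match o with
    | some (left bar) => ([left bar], some main)
    | some (left s) => ([right s], some left4)
    | _ => ([], some main)
  | join0, o => match o with
    | some (right down) => ([tmp down], some (join1 true))
    | some (right s) => ([tmp s], some (join1 false))
    | _ => ([], none)
  | join1 f, o => match o with
    | some (right bar) => ([], some (join2 f))
    | some (right s) => ([tmp s], some (join1 f))
    | _ => ([], none)
  -- The flag says that the pointed tree is a leaf under a bottom caret. Only if the next tree is
  -- also the bare leaf of kind `i` does it stay true, and then one `down` is removed later instead
  -- of adding an `up`.
  | join2 f, o => match o with
    | some (right (tok Kind.i)) => (cond f [] [right (tok Kind.i)], some (join3 f))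
    | some x => ([x], some (join3 false))
    | none => ([right bar, right (tok Kind.r)], some (join3 false))
  | join3 f, o => match o with
    | some (tmp s) => ([right s], some (join3 f))
    | _ => cond f ([], some join4) ([right up], some main)
  | join4, _ => ([], some main)
  | split0, o => match o with
    | some (right up) => ([], some split1)
    | some x => ([x], some split6)
    | none => ([], none)
  -- The stack `cnt` holds one mark for each right subtree still to be read, which shows where the
  -- left subtree of the prefix code ends.
  | split1, o => match o with
    | some (right up) => ([tmp up, cnt bar], some split1)
    | some (right (tok d)) => ([tmp (tok d)], some split2)
    | some (right s) => ([tmp s], some split1)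
    | _ => ([], none)
  | split2, o => match o with
    | some _ => ([], some split1)
    | none => ([], some split3)
  | split3, o => match o with
    | some (right (tok Kind.r)) => ([], some split4)
    | some x => ([x, right bar], some split7)
    | none => ([], none)
  | split4, _ => ([], some split5)
  | split5, o => match o with
    | some x => ([x, right bar, right (tok Kind.r), right bar], some split7)
    | none => ([right bar], some split7)
  | split6, o => match o with
    | some (right bar) => ([right bar, right (tok Kind.i), right bar], some split8)
    | some (right s) => ([tmp s], some split6)
    | _ => ([], none)
  | split7, o => match o with
    | some (tmp s) => ([right s], some split7)
    | _ => ([], some main)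
  | split8, o => match o with
    | some (tmp s) => ([right s], some split8)
    | _ => ([right down], some main)
  | gather, o => match o with
    | some (left bar) => ([right lbar], some gather)
    | some (left s) => ([right s], some gather)
    | _ => ([], some (weigh none false false))
  | weigh d f g, o => match o with
    | some (right up) => ([], some (weigh d true g))
    | some (right down) => ([], some (weigh d f true))
    | some (right bar) => ([], some (weigh (some Kind.r) false false))
    | some (right lbar) => ([], some (weigh (some Kind.l) false false))
    | some (right (tok e)) => ([], some (inc (unit d f g e)))
    | _ => ([], none)
  | inc n, o =>
    if n = 0 then ([], some (weigh (some Kind.i) false false)) else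
    match o with
    | some (out true) => ([cnt bar], some (inc n))
    | _ => ([out true], some (carry (n - 1)))
  | carry n, o => match o with
    | some _ => ([out false], some (carry n))
    | none => ([], some (inc n))

/-- The contents of the stacks. -/
structure Cf where
  inp : List Letter
  rev : List Letter
  left : List Sym
  right : List Sym
  tmp : List Sym
  cnt : List Sym
  out : List Bool

namespace Cf

/-- The contents of the stacks as a function. -/
def stk (c : Cf) : (k : Stk) → List (Gam k)
  | .inp => c.inp
  | .rev => c.rev
  | .left => c.left
  | .right => c.right
  | .tmp => c.tmp
  | .cnt => c.cnt
  | .out => c.out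

/-- The symbol on top of a stack. -/
def peek (c : Cf) : Stk → Option Item
  | .inp => c.inp.head?.map .inp
  | .rev => c.rev.head?.map .rev
  | .left => c.left.head?.map .left
  | .right => c.right.head?.map .right
  | .tmp => c.tmp.head?.map .tmp
  | .cnt => c.cnt.head?.map .cnt
  | .out => c.out.head?.map .out

/-- Remove the symbol on top of a stack. -/
def drop (c : Cf) : Stk → Cf
  | .inp => { c with inp := c.inp.tail }
  | .rev => { c with rev := c.rev.tail }
  | .left => { c with left := c.left.tail }
  | .right => { c with right := c.right.tail }
  | .tmp => { c with tmp := c.tmp.tail }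
  | .cnt => { c with cnt := c.cnt.tail }
  | .out => { c with out := c.out.tail }

/-- Push a symbol. -/
def push (c : Cf) : Item → Cf
  | .inp a => { c with inp := a :: c.inp }
  | .rev a => { c with rev := a :: c.rev }
  | .left s => { c with left := s :: c.left }
  | .right s => { c with right := s :: c.right }
  | .tmp s => { c with tmp := s :: c.tmp }
  | .cnt s => { c with cnt := s :: c.cnt }
  | .out b => { c with out := b :: c.out }

/-- The number of symbols. -/
def space (c : Cf) : ℕ := c.inp.length + c.rev.length + c.left.length + c.right.length +
  c.tmp.length + c.cnt.length + c.out.length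

theorem peek_eq (c : Cf) (k : Stk) : c.peek k = (c.stk k).head?.map (Item.mk k) := by
  cases k <;> rfl

theorem stk_drop (c : Cf) (k : Stk) :
    (c.drop k).stk = Function.update c.stk k (c.stk k).tail := by
  funext j
  cases k <;> cases j <;> rfl

theorem stk_push (c : Cf) (x : Item) :
    (c.push x).stk = Function.update c.stk x.stk (x.val :: c.stk x.stk) := by
  funext j
  cases x <;> cases j <;> rfl

theorem space_push (c : Cf) (x : Item) : (c.push x).space = c.space + 1 := by
  cases x <;> simp only [push, space, List.length_cons] <;> omega

theorem space_foldl_push (xs : List Item) (c : Cf) :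
    (xs.foldl push c).space = c.space + xs.length := by
  induction xs generalizing c with
  | nil => rfl
  | cons x xs ih => rw [List.foldl_cons, ih, space_push, List.length_cons]; omega

theorem space_drop_le (c : Cf) (k : Stk) : (c.drop k).space ≤ c.space := by
  cases k <;> simp only [drop, space, List.length_tail] <;> omega

end Cf

/-- A label, or the end of the computation, with the contents of the stacks. -/
abbrev St : Type := Option Q × Cf

/-- One step. -/
def nxt : St → St
  | (none, c) => (none, c)
  | (some q, c) => ((act q (c.peek (src q))).2, (act q (c.peek (src q))).1.foldl Cf.push (c.drop (src q)))

theorem length_act_le (q : Q) (o : Option Item) : (act q o).1.length ≤ 4 := by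
  unfold act
  repeat' split
  all_goals first | (simp; done) | (cases ‹Bool› <;> simp)

theorem space_nxt_le (x : St) : (nxt x).2.space ≤ x.2.space + 4 := by
  obtain ⟨_ | q, c⟩ := x
  · simp [nxt]
  · have h1 := length_act_le q (c.peek (src q))
    have h2 := c.space_drop_le (src q)
    simp only [nxt, Cf.space_foldl_push]
    omega

/-- Reachability in a number of steps. -/
def Reach (n : ℕ) (x y : St) : Prop := ∃ m ≤ n, nxt^[m] x = y

/-- Reachability in a number of steps with a bound on the space. -/
def Go (n s : ℕ) (x y : St) : Prop :=
  ∃ m ≤ n, nxt^[m] x = y ∧ ∀ i ≤ m, (nxt^[i] x).2.space ≤ s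

theorem Reach.refl (n : ℕ) (x : St) : Reach n x x := ⟨0, Nat.zero_le _, rfl⟩

theorem Reach.head {n : ℕ} {q : Q} {c : Cf} {x y : St} (h : nxt (some q, c) = x)
    (h' : Reach n x y) : Reach (n + 1) (some q, c) y := by
  obtain ⟨m, hm, h'⟩ := h'
  exact ⟨m + 1, by omega, by rw [Function.iterate_succ_apply, h, h']⟩

theorem Reach.trans {m n : ℕ} {x y z : St} (h : Reach m x y) (h' : Reach n y z) :
    Reach (n + m) x z := by
  obtain ⟨i, hi, rfl⟩ := h
  obtain ⟨j, hj, rfl⟩ := h'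
  exact ⟨j + i, by omega, by rw [Function.iterate_add_apply]⟩

theorem Reach.mono {m n : ℕ} {x y : St} (h : Reach m x y) (hmn : m ≤ n) : Reach n x y := by
  obtain ⟨i, hi, h⟩ := h
  exact ⟨i, hi.trans hmn, h⟩

theorem space_iterate_nxt_le (i : ℕ) (x : St) : (nxt^[i] x).2.space ≤ x.2.space + 4 * i := by
  induction i with
  | zero => simp
  | succ i ih =>
    rw [Function.iterate_succ_apply']
    have := space_nxt_le (nxt^[i] x)
    omega

/-- Four symbols per step is crude, but enough when the stretch has linear length. -/
theorem Reach.go {n s : ℕ} {x y : St} (h : Reach n x y) (hs : x.2.space + 4 * n ≤ s) :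
    Go n s x y := by
  obtain ⟨m, hm, h⟩ := h
  refine ⟨m, hm, h, fun i hi => ?_⟩
  have := space_iterate_nxt_le i x
  omega

/-- Times add up while the space bound is shared, so a quadratic run made of linear stretches stays
within linear space. -/
theorem Go.trans {m n s : ℕ} {x y z : St} (h : Go m s x y) (h' : Go n s y z) :
    Go (m + n) s x z := by
  obtain ⟨i, hi, rfl, h⟩ := h
  obtain ⟨j, hj, rfl, h'⟩ := h'
  refine ⟨j + i, by omega, by rw [Function.iterate_add_apply], fun a ha => ?_⟩
  by_cases hai : a ≤ i
  · exact h a hai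
  · obtain ⟨b, rfl⟩ := Nat.exists_eq_add_of_le (not_le.1 hai).le
    rw [Nat.add_comm, Function.iterate_add_apply]
    exact h' b (by omega)

theorem Go.mono {m n s t : ℕ} {x y : St} (h : Go m s x y) (hmn : m ≤ n) (hst : s ≤ t) :
    Go n t x y := by
  obtain ⟨i, hi, h, h'⟩ := h
  exact ⟨i, hi.trans hmn, h, fun a ha => (h' a ha).trans hst⟩

/-! ### The Turing machine -/

open Turing

/-- Push symbols one after the other. -/
def pushAll : List Item → TM2.Stmt Gam Q (Option Item) → TM2.Stmt Gam Q (Option Item)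
  | [], s => s
  | x :: xs, s => .push x.stk (fun _ => x.val) (pushAll xs s)

/-- The last part of a statement. -/
def next : Option Q → TM2.Stmt Gam Q (Option Item)
  | some q => .goto fun _ => q
  -- The prescribed halting configuration has the initial value in its internal variable, so the
  -- symbol last read has to be erased.
  | none => .load (fun _ => none) .halt

/-- Branch according to the symbol read. -/
def branchAll (f : Option Item → TM2.Stmt Gam Q (Option Item)) :
    List (Option Item) → TM2.Stmt Gam Q (Option Item)
  | [] => .halt
  | o :: os => .branch (fun v => decide (v = o)) (f o) (branchAll f os)

/-- The statement of a label. -/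
noncomputable def stmt (q : Q) : TM2.Stmt Gam Q (Option Item) :=
  .pop (src q) (fun _ o => o.map (Item.mk (src q)))
    (branchAll (fun o => pushAll (act q o).1 (next (act q o).2)) Finset.univ.toList)

/-- The Turing machine. -/
noncomputable def tm : FinTM2 where
  K := Stk
  k₀ := .inp
  k₁ := .out
  Γ := Gam
  Λ := Q
  main := .load
  σ := Option Item
  initialState := none
  Γk₀Fin := inferInstanceAs (Fintype Letter)
  m := stmt

theorem stepAux_pushAll (xs : List Item) (s : TM2.Stmt Gam Q (Option Item)) (v : Option Item)
    (c : Cf) : TM2.stepAux (pushAll xs s) v c.stk = TM2.stepAux s v (xs.foldl Cf.push c).stk := by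
  induction xs generalizing c with
  | nil => rfl
  | cons x xs ih =>
    rw [pushAll, TM2.stepAux, List.foldl_cons, ← ih, Cf.stk_push]

theorem stepAux_branchAll (f : Option Item → TM2.Stmt Gam Q (Option Item))
    (os : List (Option Item)) (v : Option Item) (hv : v ∈ os) (S : ∀ k, List (Gam k)) :
    TM2.stepAux (branchAll f os) v S = TM2.stepAux (f v) v S := by
  induction os with
  | nil => simp at hv
  | cons o os ih =>
    rw [branchAll, TM2.stepAux]
    by_cases h : v = o
    · simp [h]
    · simp only [h, decide_false, cond_false]
      exact ih ((List.mem_cons.1 hv).resolve_left h)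

theorem stepAux_stmt (q : Q) (v : Option Item) (d : Cf) :
    TM2.stepAux (stmt q) v d.stk = TM2.stepAux (next (act q (d.peek (src q))).2)
      (d.peek (src q)) ((act q (d.peek (src q))).1.foldl Cf.push (d.drop (src q))).stk := by
  rw [stmt, TM2.stepAux.eq_def]
  simp only
  rw [stepAux_branchAll _ _ _ (by simp), ← Cf.peek_eq, ← Cf.stk_drop, stepAux_pushAll]

/-- A configuration of the Turing machine is described by a label and the contents of the stacks. -/
structure Sim (x : St) (c : tm.Cfg) : Prop where
  label : c.l = x.1
  stk : c.stk = x.2.stk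
  var : x.1 = none → c.var = none

theorem Sim.step {q : Q} {d : Cf} {c : tm.Cfg} (h : Sim (some q, d) c) :
    ∃ c', tm.step c = some c' ∧ Sim (nxt (some q, d)) c' := by
  obtain ⟨l, v, S⟩ := c
  obtain ⟨h1, h2, -⟩ := h
  simp only at h1 h2
  subst h1 h2
  refine ⟨_, rfl, ?_⟩
  have h' : Sim (nxt (some q, d)) (TM2.stepAux (next (act q (d.peek (src q))).2)
      (d.peek (src q)) ((act q (d.peek (src q))).1.foldl Cf.push (d.drop (src q))).stk) := by
    rw [nxt]
    cases (act q (d.peek (src q))).2 with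
    | none => exact ⟨rfl, rfl, fun _ => rfl⟩
    | some q' => exact ⟨rfl, rfl, fun h => by simp at h⟩
  exact (congrArg (fun z : tm.Cfg => Sim (nxt (some q, d)) z) (stepAux_stmt q v d)).mpr h'

theorem Sim.step_none {d : Cf} {c : tm.Cfg} (h : Sim (none, d) c) : tm.step c = none := by
  obtain ⟨l, v, S⟩ := c
  obtain ⟨h1, -, -⟩ := h
  simp only at h1
  subst h1
  rfl

theorem iterate_nxt_none (n : ℕ) (d : Cf) : nxt^[n] (none, d) = (none, d) :=
  Function.iterate_fixed rfl n

/-- `nxt` idles after halting whereas the Turing machine has no further step, so the true number of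
steps may be smaller. -/
theorem Sim.evals {m : ℕ} {x : St} {c : tm.Cfg} (h : Sim x c) (hm : (nxt^[m] x).1 = none) :
    ∃ m' ≤ m, ∃ c', (flip bind tm.step)^[m'] (some c) = some c' ∧ Sim (nxt^[m] x) c' := by
  induction m generalizing x c with
  | zero => exact ⟨0, le_rfl, c, rfl, h⟩
  | succ m ih =>
    obtain ⟨_ | q, d⟩ := x
    · exact ⟨0, Nat.zero_le _, c, rfl, by rwa [iterate_nxt_none]⟩
    · obtain ⟨c1, h1, h2⟩ := h.step
      rw [Function.iterate_succ_apply] at hm ⊢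
      obtain ⟨m', hm', c', h3, h4⟩ := ih h2 hm
      refine ⟨m' + 1, by omega, c', ?_, h4⟩
      rw [Function.iterate_succ_apply, ← h3, ← h1]
      rfl

theorem Sim.reaches {x : St} {c c' : tm.Cfg} (h : Sim x c)
    (hr : StateTransition.Reaches tm.step c c') : ∃ i, Sim (nxt^[i] x) c' := by
  induction hr with
  | refl => exact ⟨0, h⟩
  | tail _ hs ih =>
    obtain ⟨i, hi⟩ := ih
    obtain ⟨y, hy⟩ : ∃ y, nxt^[i] x = y := ⟨_, rfl⟩
    rw [hy] at hi
    obtain ⟨_ | q, d⟩ := y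
    · rw [hi.step_none] at hs
      simp at hs
    · obtain ⟨c1, h1, h2⟩ := hi.step
      rw [h1] at hs
      obtain rfl : c1 = _ := by simpa using hs
      exact ⟨i + 1, by rwa [Function.iterate_succ_apply', hy]⟩

theorem Sim.space {x : St} {c : tm.Cfg} (h : Sim x c) : tm.space c = x.2.space := by
  rw [FinTM2.space, h.stk]
  have hu : (Finset.univ : Finset Stk) = {.inp, .rev, .left, .right, .tmp, .cnt, .out} := rfl
  change ∑ k : Stk, (x.2.stk k).length = _
  rw [hu]
  simp [Cf.stk, Cf.space, Gam]
  omega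

/-- The stacks at the beginning. -/
def initCf (w : List Letter) : Cf := ⟨w, [], [], [], [], [], []⟩

/-- The stacks at the end. -/
def haltCf (b : List Bool) : Cf := ⟨[], [], [], [], [], [], b⟩

theorem sim_init (w : List Letter) : Sim (some .load, initCf w) (initList tm w) := by
  refine ⟨rfl, ?_, fun h => by simp at h⟩
  funext k
  cases k <;> rfl

theorem Sim.eq_haltList {b : List Bool} {c : tm.Cfg} (h : Sim (none, haltCf b) c) :
    c = haltList tm b := by
  obtain ⟨l, v, S⟩ := c
  obtain ⟨h1, h2, h3⟩ := h
  replace h3 : v = none := h3 rfl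
  simp only at h1 h2
  subst h1 h2 h3
  have : (haltCf b).stk = (haltList tm b).stk := by
    funext k
    cases k <;> rfl
  rw [this]
  rfl

end Machine

end ThompsonF

namespace ThompsonF

namespace Machine

open LTree Machine.Sym

/-! ### Codes of trees -/

/-- The code of a tree. -/
def enc : LTree → List Sym
  | leaf d k => List.replicate k down ++ [tok d]
  | node a b => up :: (enc a ++ enc b)

/-- The code of the pointed tree and the trees to its right. -/
def encRight : List LTree → List Sym
  | [] => []
  | t :: r => enc t ++ bar :: encRight r

/-- The code of the trees to the left of the pointed tree. -/
def encLeft : List LTree → List Sym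
  | [] => []
  | t :: l => bar :: ((enc t).reverse ++ encLeft l)

/-- A symbol that occurs in codes of trees. -/
def Inner : Sym → Prop
  | bar => False
  | lbar => False
  | _ => True

theorem inner_enc (t : LTree) : ∀ s ∈ enc t, Inner s := by
  induction t with
  | leaf d k =>
    intro s hs
    rcases List.mem_append.1 hs with hs | hs
    · rw [List.eq_of_mem_replicate hs]; trivial
    · rw [List.mem_singleton.1 hs]; trivial
  | node a b iha ihb =>
    intro s hs
    rcases List.mem_cons.1 hs with rfl | hs
    · trivial
    · rcases List.mem_append.1 hs with hs | hs
      · exact iha s hs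
      · exact ihb s hs

theorem enc_ne_nil (t : LTree) : enc t ≠ [] := by cases t <;> simp [enc]

/-- One symbol of lookahead suffices to recognise a leaf without bottom carets, hence the empty
columns and the cancellable right leaf. -/
theorem enc_eq_tok {t : LTree} {d : Kind} {C X : List Sym} (h : enc t ++ C = tok d :: X) :
    t = leaf d 0 ∧ C = X := by
  cases t with
  | leaf e k =>
    cases k with
    | zero => simpa [enc] using h
    | succ k => simp [enc, List.replicate_succ] at h
  | node => simp [enc] at h

/-! ### Loops -/

section

variable {I V : List Letter} {L R T C : List Sym} {O : List Bool}

theorem loop_right3 (s : List Sym) (hs : ∀ x ∈ s, Inner x) :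
    Reach s.length (some .right3, ⟨I, V, L, s ++ R, T, C, O⟩)
      (some .right3, ⟨I, V, s.reverse ++ L, R, T, C, O⟩) := by
  induction s generalizing L with
  | nil => exact Reach.refl _ _
  | cons x s ih =>
    refine Reach.head (x := (some .right3, ⟨I, V, x :: L, s ++ R, T, C, O⟩)) ?_ ?_
    · have := hs x (by simp)
      cases x <;> first | rfl | exact this.elim
    · rw [List.reverse_cons, List.append_assoc]
      exact ih fun y hy => hs y (by simp [hy])

theorem loop_left4 (s : List Sym) (hs : ∀ x ∈ s, Inner x) :
    Reach s.length (some .left4, ⟨I, V, s ++ L, R, T, C, O⟩)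
      (some .left4, ⟨I, V, L, s.reverse ++ R, T, C, O⟩) := by
  induction s generalizing R with
  | nil => exact Reach.refl _ _
  | cons x s ih =>
    refine Reach.head (x := (some .left4, ⟨I, V, s ++ L, x :: R, T, C, O⟩)) ?_ ?_
    · have := hs x (by simp)
      cases x <;> first | rfl | exact this.elim
    · rw [List.reverse_cons, List.append_assoc]
      exact ih fun y hy => hs y (by simp [hy])

theorem loop_join1 (f : Bool) (s : List Sym) (hs : ∀ x ∈ s, Inner x) :
    Reach s.length (some (.join1 f), ⟨I, V, L, s ++ R, T, C, O⟩)
      (some (.join1 f), ⟨I, V, L, R, s.reverse ++ T, C, O⟩) := by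
  induction s generalizing T with
  | nil => exact Reach.refl _ _
  | cons x s ih =>
    refine Reach.head (x := (some (.join1 f), ⟨I, V, L, s ++ R, x :: T, C, O⟩)) ?_ ?_
    · have := hs x (by simp)
      cases x <;> first | rfl | exact this.elim
    · rw [List.reverse_cons, List.append_assoc]
      exact ih fun y hy => hs y (by simp [hy])

theorem loop_join3 (f : Bool) (s : List Sym) :
    Reach s.length (some (.join3 f), ⟨I, V, L, R, s ++ T, C, O⟩)
      (some (.join3 f), ⟨I, V, L, s.reverse ++ R, T, C, O⟩) := by
  induction s generalizing R with
  | nil => exact Reach.refl _ _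
  | cons x s ih =>
    refine Reach.head (x := (some (.join3 f), ⟨I, V, L, x :: R, s ++ T, C, O⟩)) rfl ?_
    rw [List.reverse_cons, List.append_assoc]
    exact ih

theorem loop_split6 (s : List Sym) (hs : ∀ x ∈ s, Inner x) :
    Reach s.length (some .split6, ⟨I, V, L, s ++ R, T, C, O⟩)
      (some .split6, ⟨I, V, L, R, s.reverse ++ T, C, O⟩) := by
  induction s generalizing T with
  | nil => exact Reach.refl _ _
  | cons x s ih =>
    refine Reach.head (x := (some .split6, ⟨I, V, L, s ++ R, x :: T, C, O⟩)) ?_ ?_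
    · have := hs x (by simp)
      cases x <;> first | rfl | exact this.elim
    · rw [List.reverse_cons, List.append_assoc]
      exact ih fun y hy => hs y (by simp [hy])

theorem loop_split7 (s : List Sym) :
    Reach s.length (some .split7, ⟨I, V, L, R, s ++ T, C, O⟩)
      (some .split7, ⟨I, V, L, s.reverse ++ R, T, C, O⟩) := by
  induction s generalizing R with
  | nil => exact Reach.refl _ _
  | cons x s ih =>
    refine Reach.head (x := (some .split7, ⟨I, V, L, x :: R, s ++ T, C, O⟩)) rfl ?_
    rw [List.reverse_cons, List.append_assoc]
    exact ih

theorem loop_split8 (s : List Sym) :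
    Reach s.length (some .split8, ⟨I, V, L, R, s ++ T, C, O⟩)
      (some .split8, ⟨I, V, L, s.reverse ++ R, T, C, O⟩) := by
  induction s generalizing R with
  | nil => exact Reach.refl _ _
  | cons x s ih =>
    refine Reach.head (x := (some .split8, ⟨I, V, L, x :: R, s ++ T, C, O⟩)) rfl ?_
    rw [List.reverse_cons, List.append_assoc]
    exact ih

/-- In a prefix code a subtree is complete when every `up` has received its right subtree. The
factor 2 pays for the visit to `split2` at each leaf. -/
theorem loop_split1 (t : LTree) :
    Reach (2 * (enc t).length) (some .split1, ⟨I, V, L, enc t ++ R, T, C, O⟩)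
      (some .split2, ⟨I, V, L, R, (enc t).reverse ++ T, C, O⟩) := by
  induction t generalizing R T C with
  | leaf d k =>
    suffices h : ∀ k T, Reach (k + 1)
        (some .split1, ⟨I, V, L, List.replicate k down ++ [tok d] ++ R, T, C, O⟩)
        (some .split2, ⟨I, V, L, R, (List.replicate k down ++ [tok d]).reverse ++ T, C, O⟩) from
      (h k T).mono (by simp [enc])
    intro k
    induction k with
    | zero => exact fun T => Reach.head rfl (Reach.refl _ _)
    | succ k ih =>
      intro T
      refine Reach.head (x := (some .split1,
        ⟨I, V, L, List.replicate k down ++ [tok d] ++ R, down :: T, C, O⟩)) rfl ?_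
      have := ih (down :: T)
      rw [List.replicate_succ, List.cons_append, List.reverse_cons, List.append_assoc _ [down]]
      exact this
  | node a b iha ihb =>
    have h1 : Reach 1 (some .split1, ⟨I, V, L, enc (node a b) ++ R, T, C, O⟩)
        (some .split1, ⟨I, V, L, enc a ++ (enc b ++ R), up :: T, bar :: C, O⟩) := by
      refine Reach.head (n := 0) ?_ (Reach.refl _ _)
      rw [← List.append_assoc]
      rfl
    have h2 := iha (R := enc b ++ R) (T := up :: T) (C := bar :: C)
    have h3 : Reach 1
        (some .split2, ⟨I, V, L, enc b ++ R, (enc a).reverse ++ up :: T, bar :: C, O⟩)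
        (some .split1, ⟨I, V, L, enc b ++ R, (enc a).reverse ++ up :: T, C, O⟩) :=
      Reach.head (n := 0) rfl (Reach.refl _ _)
    have h4 := ihb (R := R) (T := (enc a).reverse ++ up :: T) (C := C)
    have := ((h1.trans h2).trans h3).trans h4
    have e : (enc (node a b)).reverse ++ T =
        (enc b).reverse ++ ((enc a).reverse ++ up :: T) := by simp [enc]
    rw [e]
    refine this.mono ?_
    simp only [enc, List.length_cons, List.length_append]
    omega

end

/-! ### Letters -/

/-- The stacks for a state and the letters that are left. -/
def conf (S : State) (v : List Letter) : Cf :=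
  ⟨[], v, encLeft S.left, encRight (S.cur :: S.right), [], [], []⟩

/-- The number of symbols of the code of a state. -/
def size (S : State) : ℕ := (encLeft S.left).length + (encRight (S.cur :: S.right)).length

theorem Reach.cons {n : ℕ} {q : Q} {c : Cf} {x y : St} (h : nxt (some q, c) = x)
    (h' : Reach (n - 1) x y) (hn : n ≠ 0) : Reach n (some q, c) y :=
  (Reach.head h h').mono (by omega)

theorem run_right3 {l : List LTree} {t : LTree} {r : List LTree} {v : List Letter} :
    Reach ((enc t).length + 2)
      (some .right3, ⟨[], v, encLeft l, encRight (t :: r), [], [], []⟩)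
      (some .main, conf ⟨t :: l, thead dr r, r.tail⟩ v) := by
  have h1 := loop_right3 (I := []) (V := v) (L := encLeft l) (R := bar :: encRight r) (T := [])
    (C := []) (O := []) (enc t) (inner_enc t)
  refine (h1.trans (n := 2) (Reach.head rfl (Reach.head ?_ (Reach.refl 0 _)))).mono (by omega)
  cases r with
  | nil => rfl
  | cons u r =>
    obtain ⟨x, s, hx⟩ := List.exists_cons_of_ne_nil (enc_ne_nil u)
    simp only [encRight, conf, encLeft, hx, thead, List.tail_cons]
    rfl

theorem run_right (S : State) (v : List Letter) :
    Reach ((enc S.cur).length + 5) (some .right0, conf S v)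
      (some .main, conf (State.mul (Gen.x0, true) S) v) := by
  obtain ⟨l, t, r⟩ := S
  simp only [State.mul]
  cases l with
  | cons u l =>
    refine Reach.cons (x := (some .right3,
      ⟨[], v, encLeft (u :: l), encRight (t :: r), [], [], []⟩)) rfl ?_ (by omega)
    exact run_right3.mono (by omega)
  | nil =>
    refine Reach.cons (x := (some .right1, ⟨[], v, [], encRight (t :: r), [], [], []⟩)) rfl ?_
      (by omega)
    by_cases ht : t = dl
    · subst ht
      refine Reach.cons (x := (some .right2, ⟨[], v, [], bar :: encRight r, [], [], []⟩)) rfl ?_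
        (by simp)
      refine Reach.cons (x := (some .right4, ⟨[], v, [], encRight r, [], [], []⟩)) rfl ?_
        (by simp)
      refine Reach.cons (x := (some .main, conf ⟨[], thead dr r, r.tail⟩ v)) ?_ ?_ (by simp [enc])
      · cases r with
        | nil => rfl
        | cons u r =>
          obtain ⟨x, s, hx⟩ := List.exists_cons_of_ne_nil (enc_ne_nil u)
          simp only [encRight, conf, encLeft, hx, thead, List.tail_cons]
          rfl
      · simp only [tcons, if_true]
        exact Reach.refl _ _
    · refine Reach.cons (x := (some .right3, ⟨[], v, [], encRight (t :: r), [], [], []⟩)) ?_ ?_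
        (by omega)
      · obtain ⟨x, s, hx⟩ := List.exists_cons_of_ne_nil (enc_ne_nil t)
        have hx' : x ≠ tok Kind.l := by
          rintro rfl
          exact ht (enc_eq_tok (C := []) (by rw [List.append_nil, hx])).1
        simp only [encRight, hx, List.cons_append]
        rcases x with _ | _ | _ | _ | (_ | _ | _ | _) <;> first | rfl | exact absurd rfl hx'
      · simp only [tcons, ht, if_false]
        exact (run_right3 (l := []) (t := t)).mono (by omega)

theorem run_left3 {l : List LTree} {r : List LTree} {v : List Letter} :
    Reach ((encLeft l).length + 2)
      (some .left3, ⟨[], v, encLeft l, encRight r, [], [], []⟩)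
      (some .main, conf ⟨l.tail, thead dl l, r⟩ v) := by
  cases l with
  | nil => exact (Reach.head rfl (Reach.refl 0 _)).mono (by omega)
  | cons u l =>
    refine Reach.cons (x := (some .left4,
      ⟨[], v, (enc u).reverse ++ encLeft l, bar :: encRight r, [], [], []⟩)) rfl ?_ (by omega)
    have h1 := loop_left4 (I := []) (V := v) (L := encLeft l) (R := bar :: encRight r) (T := [])
      (C := []) (O := []) (enc u).reverse (by simpa using inner_enc u)
    refine (h1.trans (n := 1) (Reach.head ?_ (Reach.refl 0 _))).mono
      (by simp only [encLeft, List.length_cons, List.length_append]; omega)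
    rw [List.reverse_reverse]
    cases l with
    | nil => rfl
    | cons => rfl

theorem run_left (S : State) (v : List Letter) :
    Reach ((encLeft S.left).length + 5) (some .left0, conf S v)
      (some .main, conf (State.mul (Gen.x0, false) S) v) := by
  obtain ⟨l, t, r⟩ := S
  simp only [State.mul]
  by_cases ht : t = dr
  · subst ht
    refine Reach.cons (x := (some .left1, ⟨[], v, encLeft l, bar :: encRight r, [], [], []⟩)) rfl
      ?_ (by omega)
    refine Reach.cons (x := (some .left2, ⟨[], v, encLeft l, encRight r, [], [], []⟩)) rfl
      ?_ (by omega)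
    refine Reach.cons (x := (some .left3, ⟨[], v, encLeft l, encRight (tcons dr dr r),
      [], [], []⟩)) ?_ (run_left3.mono (by omega)) (by omega)
    cases r with
    | nil => rfl
    | cons u r =>
      obtain ⟨x, s, hx⟩ := List.exists_cons_of_ne_nil (enc_ne_nil u)
      simp only [encRight, hx, tcons]
      rfl
  · have htr : tcons dr t r = t :: r := by cases r <;> simp [tcons, ht]
    rw [htr]
    refine Reach.cons (x := (some .left3, ⟨[], v, encLeft l, encRight (t :: r),
      [], [], []⟩)) ?_ (run_left3.mono (by omega)) (by omega)
    obtain ⟨x, s, hx⟩ := List.exists_cons_of_ne_nil (enc_ne_nil t)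
    have hx' : x ≠ tok Kind.r := by
      rintro rfl
      exact ht (enc_eq_tok (C := []) (by rw [List.append_nil, hx])).1
    simp only [conf, encRight, hx, List.cons_append]
    rcases x with _ | _ | _ | _ | (_ | _ | _ | _) <;> first | rfl | exact absurd rfl hx'

/-- Is the tree a leaf facing a caret? -/
def startsDown : LTree → Bool
  | leaf _ (_ + 1) => true
  | _ => false

/-- The code of the pointed tree is moved to `tmp` and back, so that the separator behind it can be
removed and the next tree inspected. -/
theorem run_join (S : State) (v : List Letter) :
    Reach (2 * (enc S.cur).length + 5) (some .join0, conf S v)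
      (some .main, conf (State.mul (Gen.x1, true) S) v) := by
  obtain ⟨l, t, r⟩ := S
  simp only [State.mul]
  have h1 : Reach ((enc t).length)
      (some .join0, conf ⟨l, t, r⟩ v)
      (some (.join1 (startsDown t)),
        ⟨[], v, encLeft l, bar :: encRight r, (enc t).reverse, [], []⟩) := by
    obtain ⟨x, s, hx⟩ := List.exists_cons_of_ne_nil (enc_ne_nil t)
    have hs : ∀ y ∈ s, Inner y := fun y hy => inner_enc t y (by rw [hx]; simp [hy])
    have hf : startsDown t = decide (x = down) := by
      rcases t with ⟨d, _ | k⟩ | ⟨a, b⟩ <;> simp [enc, List.replicate_succ] at hx <;>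
        simp [startsDown, ← hx.1]
    refine Reach.cons (x := (some (.join1 (startsDown t)), ⟨[], v, encLeft l,
      s ++ bar :: encRight r, [x], [], []⟩)) ?_ ?_ (by simp [hx])
    · rw [hf]
      simp only [conf, encRight, hx, List.cons_append]
      cases x <;> rfl
    · have := loop_join1 (I := []) (V := v) (L := encLeft l) (R := bar :: encRight r) (T := [x])
        (C := []) (O := []) (startsDown t) s hs
      rw [hx, List.reverse_cons]
      exact this.mono (by simp)
  have h2 : Reach 1 (some (.join1 (startsDown t)),
        ⟨[], v, encLeft l, bar :: encRight r, (enc t).reverse, [], []⟩)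
      (some (.join2 (startsDown t)), ⟨[], v, encLeft l, encRight r, (enc t).reverse, [], []⟩) :=
    Reach.head rfl (Reach.refl 0 _)
  have h3 : ∀ f R, Reach (enc t).length (some (.join3 f),
        ⟨[], v, encLeft l, R, (enc t).reverse, [], []⟩)
      (some (.join3 f), ⟨[], v, encLeft l, enc t ++ R, [], [], []⟩) := by
    intro f R
    have := loop_join3 (I := []) (V := v) (L := encLeft l) (R := R) (T := [])
        (C := []) (O := []) f (enc t).reverse
    rwa [List.reverse_reverse, List.length_reverse, List.append_nil] at this
  have hr : encRight (thead dr r :: r.tail) = enc (thead dr r) ++ bar :: encRight r.tail := rfl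
  rcases join_cases t (thead dr r) with ⟨d, k, rfl, hu, hj⟩ | hj
  · rw [hj]
    cases r with
    | nil => simp [thead] at hu
    | cons u r =>
      simp only [thead] at hu
      subst hu
      have h4 : Reach 1 (some (.join2 (startsDown (leaf d (k + 1)))),
          ⟨[], v, encLeft l, encRight (leaf Kind.i 0 :: r), (enc (leaf d (k + 1))).reverse, [], []⟩)
          (some (.join3 true),
          ⟨[], v, encLeft l, bar :: encRight r, (enc (leaf d (k + 1))).reverse, [], []⟩) :=
        Reach.head rfl (Reach.refl 0 _)
      refine ((((h1.trans h2).trans h4).trans (h3 true _)).trans (n := 2) (Reach.head rfl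
        (Reach.head rfl (Reach.refl 0 _)))).mono ?_
      omega
  · have hf : ∀ f', Reach 2 (some (.join3 false), ⟨[], v, encLeft l, f', [], [], []⟩)
        (some .main, ⟨[], v, encLeft l, up :: f', [], [], []⟩) := fun f' =>
      (Reach.head rfl (Reach.refl 1 _))
    have h4 : Reach 1 (some (.join2 (startsDown t)),
        ⟨[], v, encLeft l, encRight r, (enc t).reverse, [], []⟩)
        (some (.join3 false), ⟨[], v, encLeft l, encRight (thead dr r :: r.tail),
          (enc t).reverse, [], []⟩) := by
      refine Reach.head ?_ (Reach.refl 0 _)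
      cases r with
      | nil => rfl
      | cons u r =>
        obtain ⟨x, s, hx⟩ := List.exists_cons_of_ne_nil (enc_ne_nil u)
        have hx' : x = tok Kind.i → startsDown t = false := by
          rintro rfl
          obtain ⟨rfl, -⟩ := enc_eq_tok (C := []) (t := u) (by rw [List.append_nil, hx])
          rcases t with ⟨d, _ | k⟩ | ⟨a, b⟩ <;> simp [thead, LTree.join, startsDown] at hj ⊢
        simp only [encRight, hx, thead, List.tail_cons, List.cons_append]
        rcases x with _ | _ | _ | _ | (_ | _ | _ | _) <;> first | rfl | (rw [hx' rfl]; rfl)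
    have := (((h1.trans h2).trans h4).trans (h3 false _)).trans (hf _)
    have e : conf ⟨l, LTree.join t (thead dr r), r.tail⟩ v = ⟨[], v, encLeft l,
        up :: (enc t ++ encRight (thead dr r :: r.tail)), [], [], []⟩ := by
      rw [hj]
      simp [conf, encRight, enc]
    rw [e]
    refine this.mono ?_
    omega

theorem run_split (S : State) (v : List Letter) :
    Reach (3 * (enc S.cur).length + 6) (some .split0, conf S v)
      (some .main, conf (State.mul (Gen.x1, false) S) v) := by
  obtain ⟨l, t, r⟩ := S
  simp only [State.mul]
  cases t with
  | leaf d k =>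
    have h1 : Reach 1 (some .split0, conf ⟨l, leaf d k, r⟩ v)
        (some .split6, conf ⟨l, leaf d k, r⟩ v) := by
      refine Reach.head ?_ (Reach.refl 0 _)
      cases k <;> rfl
    have h2 := loop_split6 (I := []) (V := v) (L := encLeft l) (R := bar :: encRight r) (T := [])
      (C := []) (O := []) (enc (leaf d k)) (inner_enc _)
    have h3 : Reach 1 (some .split6, ⟨[], v, encLeft l, bar :: encRight r,
          (enc (leaf d k)).reverse ++ [], [], []⟩)
        (some .split8, ⟨[], v, encLeft l, bar :: tok Kind.i :: bar :: encRight r,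
          (enc (leaf d k)).reverse ++ [], [], []⟩) :=
      Reach.head rfl (Reach.refl 0 _)
    have h4 := loop_split8 (I := []) (V := v) (L := encLeft l)
      (R := bar :: tok Kind.i :: bar :: encRight r) (T := [])
      (C := []) (O := []) (enc (leaf d k)).reverse
    refine ((((h1.trans h2).trans h3).trans h4).trans (n := 1)
      (Reach.head ?_ (Reach.refl 0 _))).mono ?_
    · have : tcons dr (leaf Kind.i 0) r = leaf Kind.i 0 :: r := by cases r <;> simp [tcons]
      simp only [LTree.split, this]
      rw [List.reverse_reverse]
      rfl
    · simp only [List.length_reverse]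
      omega
  | node a b =>
    have h1 : Reach 1 (some .split0, conf ⟨l, node a b, r⟩ v)
        (some .split1, ⟨[], v, encLeft l, enc a ++ encRight (b :: r), [], [], []⟩) := by
      refine Reach.head ?_ (Reach.refl 0 _)
      simp only [conf, encRight, enc, List.cons_append, List.append_assoc]
      rfl
    have h2 := loop_split1 (I := []) (V := v) (L := encLeft l) (R := encRight (b :: r)) (T := [])
      (C := []) (O := []) a
    have h3 : Reach 1
        (some .split2, ⟨[], v, encLeft l, encRight (b :: r), (enc a).reverse ++ [], [], []⟩)
        (some .split3, ⟨[], v, encLeft l, encRight (b :: r), (enc a).reverse ++ [], [], []⟩) :=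
      Reach.head rfl (Reach.refl 0 _)
    have h4 : Reach 3
        (some .split3, ⟨[], v, encLeft l, encRight (b :: r), (enc a).reverse ++ [], [], []⟩)
        (some .split7, ⟨[], v, encLeft l, bar :: encRight (tcons dr b r),
          (enc a).reverse ++ [], [], []⟩) := by
      by_cases hb : b = dr
      · subst hb
        refine Reach.head (x := (some .split4, ⟨[], v, encLeft l, bar :: encRight r,
          (enc a).reverse ++ [], [], []⟩)) rfl (Reach.head (x := (some .split5, ⟨[], v, encLeft l,
          encRight r, (enc a).reverse ++ [], [], []⟩)) rfl (Reach.head ?_ (Reach.refl 0 _)))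
        cases r with
        | nil => rfl
        | cons u r =>
          obtain ⟨x, s, hx⟩ := List.exists_cons_of_ne_nil (enc_ne_nil u)
          simp only [encRight, hx, tcons]
          rfl
      · have htr : tcons dr b r = b :: r := by cases r <;> simp [tcons, hb]
        rw [htr]
        refine Reach.head (n := 2) ?_ (Reach.refl _ _)
        obtain ⟨x, s, hx⟩ := List.exists_cons_of_ne_nil (enc_ne_nil b)
        have hx' : x ≠ tok Kind.r := by
          rintro rfl
          exact hb (enc_eq_tok (C := []) (by rw [List.append_nil, hx])).1
        simp only [encRight, hx, List.cons_append]
        rcases x with _ | _ | _ | _ | (_ | _ | _ | _) <;> first | rfl | exact absurd rfl hx'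
    have h5 := loop_split7 (I := []) (V := v) (L := encLeft l)
      (R := bar :: encRight (tcons dr b r)) (T := []) (C := []) (O := []) (enc a).reverse
    refine (((((h1.trans h2).trans h3).trans h4).trans h5).trans (n := 1)
      (Reach.head ?_ (Reach.refl 0 _))).mono ?_
    · rw [List.reverse_reverse]
      rfl
    · simp only [List.length_reverse, enc, List.length_cons, List.length_append]
      omega

theorem run_letter (s : Letter) (S : State) (v : List Letter) :
    Reach (3 * size S + 7) (some .main, conf S (s :: v)) (some .main, conf (State.mul s S) v) := by
  have h1 : (enc S.cur).length ≤ size S := by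
    simp only [size, encRight, List.length_append, List.length_cons]
    omega
  have h2 : (encLeft S.left).length ≤ size S := by
    simp only [size]
    omega
  obtain ⟨g, b⟩ := s
  cases g <;> cases b
  · exact Reach.cons (x := (some .left0, conf S v)) rfl
      ((run_left S v).mono (by omega)) (by omega)
  · exact Reach.cons (x := (some .right0, conf S v)) rfl
      ((run_right S v).mono (by omega)) (by omega)
  · exact Reach.cons (x := (some .split0, conf S v)) rfl
      ((run_split S v).mono (by omega)) (by omega)
  · exact Reach.cons (x := (some .join0, conf S v)) rfl
      ((run_join S v).mono (by omega)) (by omega)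

end Machine

end ThompsonF

namespace ThompsonF

namespace Machine

open LTree Machine.Sym

/-! ### Sizes -/

theorem length_encLeft_tcons (t : LTree) (l : List LTree) :
    (encLeft (tcons dl t l)).length ≤ (enc t).length + 1 + (encLeft l).length := by
  cases l with
  | nil => by_cases h : t = dl <;> simp [tcons, h, encLeft]
  | cons u l => simp only [tcons, encLeft, List.length_cons, List.length_append,
      List.length_reverse]; omega

theorem length_encRight_tcons (t : LTree) (r : List LTree) :
    (encRight (tcons dr t r)).length ≤ (enc t).length + 1 + (encRight r).length := by
  cases r with
  | nil => by_cases h : t = dr <;> simp [tcons, h, encRight]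
  | cons u r => simp only [tcons, encRight, List.length_cons, List.length_append]; omega

theorem length_enc_thead_left (l : List LTree) :
    (enc (thead dl l)).length + (encLeft l.tail).length ≤ (encLeft l).length + 1 := by
  cases l with
  | nil => simp [thead, encLeft, enc]
  | cons u l => simp only [thead, encLeft, List.tail_cons, List.length_cons, List.length_append,
      List.length_reverse]; omega

theorem length_enc_thead_right (r : List LTree) :
    (enc (thead dr r)).length + (encRight r.tail).length ≤ (encRight r).length + 1 := by
  cases r with
  | nil => simp [thead, encRight, enc]
  | cons u r => simp only [thead, encRight, List.tail_cons, List.length_cons,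
      List.length_append]; omega

theorem length_enc_join (a b : LTree) :
    (enc (LTree.join a b)).length ≤ (enc a).length + (enc b).length + 1 := by
  rcases join_cases a b with ⟨d, k, rfl, rfl, h⟩ | h
  · rw [h]; simp [enc]
  · rw [h]; simp [enc]

theorem length_enc_split (t : LTree) :
    (enc t.split.1).length + (enc t.split.2).length ≤ (enc t).length + 2 := by
  cases t with
  | leaf d k => simp [LTree.split, enc]
  | node a b => simp [LTree.split, enc]; omega

/-- Each letter adds a bounded number of carets, leaves and separators, so the code after n letters
has length O(n). -/
theorem size_mul_le (s : Letter) (S : State) : size (State.mul s S) ≤ size S + 4 := by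
  obtain ⟨l, t, r⟩ := S
  obtain ⟨g, b⟩ := s
  cases g <;> cases b <;>
    simp only [State.mul, size, encRight, List.length_append, List.length_cons]
  · have h1 := length_encRight_tcons t r
    have h2 := length_enc_thead_left l
    omega
  · have h1 := length_encLeft_tcons t l
    have h2 := length_enc_thead_right r
    omega
  · have h1 := length_encRight_tcons t.split.2 r
    have h2 := length_enc_split t
    omega
  · have h1 := length_enc_join t (thead dr r)
    have h2 := length_enc_thead_right r
    omega

/-! ### Reading off the weight -/

/-- The weight computed from a code. -/
def scan : Option Kind → Bool → Bool → List Sym → ℕ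
  | _, _, _, [] => 0
  | d, _, g, up :: s => scan d true g s
  | d, f, _, down :: s => scan d f true s
  | _, _, _, bar :: s => scan (some Kind.r) false false s
  | _, _, _, lbar :: s => scan (some Kind.l) false false s
  | d, f, g, tok e :: s => unit d f g e + scan (some Kind.i) false false s

theorem scan_le (s : List Sym) (d : Option Kind) (f g : Bool) : scan d f g s ≤ 4 * s.length := by
  induction s generalizing d f g with
  | nil => simp [scan]
  | cons x s ih =>
    rw [List.length_cons]
    cases x with
    | up => have := ih d true g; simp only [scan]; omega
    | down => have := ih d f true; simp only [scan]; omega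
    | bar => have := ih (some Kind.r) false false; simp only [scan]; omega
    | lbar => have := ih (some Kind.l) false false; simp only [scan]; omega
    | tok e =>
      have := ih (some Kind.i) false false
      have := (unit d f g e).isLt
      simp only [scan]
      omega

/-- Labels depend only on whether a caret count is zero, so two flags in the finite control are
enough. -/
theorem val_unit (d e : Kind) (f g : Bool) (k m : ℕ) (hk : k ≠ 0 ↔ f) (hm : m ≠ 0 ↔ g) :
    (unit (some d) f g e : ℕ) = colWeight ((d, k), (e, m)) := by
  cases f <;> cases g <;> simp only [Bool.false_eq_true, iff_false, iff_true, not_not] at hk hm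
  · subst hk hm; cases d <;> cases e <;> rfl
  · obtain ⟨m, rfl⟩ := Nat.exists_eq_succ_of_ne_zero hm
    subst hk; cases d <;> cases e <;> rfl
  · obtain ⟨k, rfl⟩ := Nat.exists_eq_succ_of_ne_zero hk
    subst hm; cases d <;> cases e <;> rfl
  · obtain ⟨k, rfl⟩ := Nat.exists_eq_succ_of_ne_zero hk
    obtain ⟨m, rfl⟩ := Nat.exists_eq_succ_of_ne_zero hm
    cases d <;> cases e <;> rfl

theorem scan_replicate (d : Option Kind) (f : Bool) (m : ℕ) (e : Kind) (s : List Sym) :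
    scan d f false (List.replicate m down ++ tok e :: s) =
      unit d f (decide (m ≠ 0)) e + scan (some Kind.i) false false s := by
  cases m with
  | zero => rfl
  | succ m =>
    rw [List.replicate_succ, List.cons_append, scan]
    induction m with
    | zero => rfl
    | succ m ih => rw [List.replicate_succ, List.cons_append, scan, ih]; simp

theorem scan_enc (t : LTree) (d : Kind) (f : Bool) (k : ℕ) (hk : k ≠ 0 ↔ f) (s : List Sym) :
    scan (some d) f false (enc t ++ s) =
      colsWeight (LTree.cols d k t) + scan (some Kind.i) false false s := by
  induction t generalizing d f k s with
  | leaf e m =>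
    rw [enc, List.append_assoc, List.singleton_append, scan_replicate,
      val_unit d e f (decide (m ≠ 0)) k m hk (by simp)]
    simp [LTree.cols, colsWeight]
  | node a b iha ihb =>
    rw [enc, List.cons_append, scan, List.append_assoc, iha d true (k + 1) (by simp),
      ihb Kind.i false 0 (by simp), LTree.cols, colsWeight_append]
    omega

theorem scan_none_enc (t : LTree) (d : Kind) (f : Bool) (k : ℕ) (s : List Sym) :
    scan none f false (enc t ++ s) =
      colsWeight (LTree.cols d k t).tail + scan (some Kind.i) false false s := by
  induction t generalizing d f k s with
  | leaf e m =>
    rw [enc, List.append_assoc, List.singleton_append, scan_replicate]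
    simp [LTree.cols, colsWeight, unit]
  | node a b iha ihb =>
    rw [enc, List.cons_append, scan, List.append_assoc, iha d true (k + 1),
      scan_enc b Kind.i false 0 (by simp), LTree.cols,
      List.tail_append_of_ne_nil (cols_ne_nil _ _ _), colsWeight_append]
    omega

theorem scan_encRight (d : Option Kind) (f g : Bool) (r : List LTree) :
    scan d f g (bar :: encRight r) = treesWeight Kind.r r := by
  induction r generalizing d f g with
  | nil => rfl
  | cons t r ih =>
    rw [scan, encRight, scan_enc t Kind.r false 0 (by simp), ih, treesWeight_cons]

/-- Mark the ends of trees as being to the left of the pointer. -/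
def mark : Sym → Sym
  | bar => lbar
  | s => s

theorem map_mark_enc (t : LTree) : (enc t).map mark = enc t := by
  refine (List.map_congr_left fun s hs => ?_).trans (List.map_id _)
  have := inner_enc t s hs
  cases s <;> first | rfl | exact this.elim

/-- The code of a state on a single stack. -/
def tape (S : State) : List Sym :=
  ((encLeft S.left).map mark).reverse ++ encRight (S.cur :: S.right)

/-- The left trees come off the stack in reading order, each followed by `lbar`, so the next tree is
scanned with kind `l`. For the pointed tree this replaces `p` without changing the weight. -/
theorem scan_left (l : List LTree) (t : LTree) (e : Kind) (he : e = Kind.l ∨ e = Kind.p)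
    (s : List Sym) :
    scan none false false (((encLeft l).map mark).reverse ++ (enc t ++ s)) =
      colsWeight (l.reverse.flatMap (LTree.cols Kind.l 0) ++ LTree.cols e 0 t).tail +
        scan (some Kind.i) false false s := by
  induction l generalizing t e s with
  | nil => exact scan_none_enc t e false 0 s
  | cons u l ih =>
    have h1 : ((encLeft (u :: l)).map mark).reverse ++ (enc t ++ s) =
        ((encLeft l).map mark).reverse ++ (enc u ++ lbar :: (enc t ++ s)) := by
      simp [encLeft, map_mark_enc, mark]
    have h2 : colsWeight (LTree.cols e 0 t) = colsWeight (LTree.cols Kind.l 0 t) := by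
      rcases he with rfl | rfl
      · rfl
      · exact colsWeight_cols_l 0 0 t
    have h3 : l.reverse.flatMap (LTree.cols Kind.l 0) ++ LTree.cols Kind.l 0 u ≠ [] := by
      simp [cols_ne_nil]
    rw [h1, ih u Kind.l (Or.inl rfl), scan, scan_enc t Kind.l false 0 (by simp),
      List.reverse_cons, List.flatMap_append, List.flatMap_cons, List.flatMap_nil, List.append_nil,
      List.tail_append_of_ne_nil h3, colsWeight_append, h2]
    omega

theorem scan_tape (S : State) : scan none false false (tape S) = S.weight := by
  have h : S.left.reverse.flatMap (LTree.cols Kind.l 0) ++ LTree.cols Kind.p 0 S.cur ≠ [] := by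
    simp [cols_ne_nil]
  rw [tape, encRight, scan_left _ _ Kind.p (Or.inr rfl), scan_encRight, State.weight, State.cols,
    ← List.append_assoc, List.tail_append_of_ne_nil h, ← colsWeight,
    colsWeight_append, colsWeight_flatMap]

theorem length_tape (S : State) : (tape S).length = size S := by
  simp [tape, size]

/-! ### Counting in binary -/

/-- Increment a number in binary. -/
def incBits : List Bool → List Bool
  | [] => [true]
  | false :: b => true :: b
  | true :: b => false :: incBits b

theorem encodePosNum_succ (n : PosNum) :
    Computability.encodePosNum n.succ = incBits (Computability.encodePosNum n) := by
  induction n with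
  | one => rfl
  | bit1 n ih => simp [PosNum.succ, Computability.encodePosNum, incBits, ih]
  | bit0 n ih => simp [PosNum.succ, Computability.encodePosNum, incBits]

theorem encodeNat_succ (n : ℕ) :
    Computability.encodeNat (n + 1) = incBits (Computability.encodeNat n) := by
  rw [Computability.encodeNat, Computability.encodeNat, Nat.cast_succ, Num.add_one]
  cases (n : Num) with
  | zero => rfl
  | pos m => exact encodePosNum_succ m

theorem length_incBits_le (b : List Bool) : (incBits b).length ≤ b.length + 1 := by
  induction b with
  | nil => simp [incBits]
  | cons x b ih => cases x <;> simp [incBits, ih]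

/-- This linear bound is enough: linearly many increments of linear cost remain within quadratic
time. -/
theorem length_encodeNat_le (n : ℕ) : (Computability.encodeNat n).length ≤ n := by
  induction n with
  | zero => rfl
  | succ n ih =>
    rw [encodeNat_succ]
    exact (length_incBits_le _).trans (by omega)

section

variable {I V : List Letter} {L R T C : List Sym}

/-- The low bits are on top of the stack. The leading ones are removed and remembered as marks on
`cnt`, to be put back as zeros by the carry phase. -/
theorem run_inc_carry (n : Fin 5) (hn : n ≠ 0) (O : List Bool) :
    ∃ j X, j ≤ O.length ∧ List.replicate j false ++ X = incBits O ∧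
      Reach (j + 1) (some (.inc n), ⟨I, V, L, R, T, C, O⟩)
        (some (.carry (n - 1)), ⟨I, V, L, R, T, List.replicate j bar ++ C, X⟩) := by
  induction O generalizing C with
  | nil =>
    refine ⟨0, [true], le_rfl, rfl, Reach.head ?_ (Reach.refl 0 _)⟩
    simp [nxt, act, src, hn, Cf.peek, Cf.drop, Cf.push]
  | cons b O ih =>
    cases b with
    | false =>
      refine ⟨0, true :: O, by simp, rfl, Reach.head ?_ (Reach.refl 0 _)⟩
      simp [nxt, act, src, hn, Cf.peek, Cf.drop, Cf.push]
    | true =>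
      obtain ⟨j, X, h1, h2, h3⟩ := ih (C := bar :: C)
      refine ⟨j + 1, X, by simpa using h1, by simp [List.replicate_succ, incBits, h2],
        Reach.head (x := (some (.inc n), ⟨I, V, L, R, T, bar :: C, O⟩)) ?_ ?_⟩
      · simp [nxt, act, src, hn, Cf.peek, Cf.drop, Cf.push]
      · rwa [List.replicate_succ', List.append_assoc]

theorem run_carry (n : Fin 5) (j : ℕ) (X : List Bool) :
    Reach (j + 1) (some (.carry n), ⟨I, V, L, R, T, List.replicate j bar, X⟩)
      (some (.inc n), ⟨I, V, L, R, T, [], List.replicate j false ++ X⟩) := by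
  induction j generalizing X with
  | zero => exact Reach.head rfl (Reach.refl 0 _)
  | succ j ih =>
    refine Reach.head (x := (some (.carry n), ⟨I, V, L, R, T, List.replicate j bar, false :: X⟩))
      rfl ?_
    have := ih (false :: X)
    rwa [List.replicate_succ', List.append_assoc]

theorem run_inc (n : Fin 5) (hn : n ≠ 0) (N M : ℕ) (hM : N ≤ M) :
    Reach (2 * M + 2) (some (.inc n), ⟨I, V, L, R, T, [], Computability.encodeNat N⟩)
      (some (.inc (n - 1)), ⟨I, V, L, R, T, [], Computability.encodeNat (N + 1)⟩) := by
  obtain ⟨j, X, h1, h2, h3⟩ := run_inc_carry (I := I) (V := V) (L := L) (R := R) (T := T)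
    (C := []) n hn (Computability.encodeNat N)
  have h4 := run_carry (I := I) (V := V) (L := L) (R := R) (T := T) (n - 1) j X
  rw [h2, ← encodeNat_succ] at h4
  rw [List.append_nil] at h3
  have := length_encodeNat_le N
  exact (h3.trans h4).mono (by omega)

theorem run_inc_zero (m : ℕ) (hm : m < 5) (N M : ℕ) (hM : N + m ≤ M) :
    Reach (m * (2 * M + 2)) (some (.inc ⟨m, hm⟩), ⟨I, V, L, R, T, [], Computability.encodeNat N⟩)
      (some (.inc 0), ⟨I, V, L, R, T, [], Computability.encodeNat (N + m)⟩) := by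
  induction m generalizing N with
  | zero => exact Reach.refl _ _
  | succ m ih =>
    have h1 := run_inc (I := I) (V := V) (L := L) (R := R) (T := T) ⟨m + 1, hm⟩ (by simp) N M
      (by omega)
    have h2 := ih (by omega) (N + 1) (by omega)
    have e : (⟨m + 1, hm⟩ : Fin 5) - 1 = ⟨m, by omega⟩ := by
      have : m < 4 := by omega
      interval_cases m <;> rfl
    rw [e] at h1
    have e' : N + 1 + m = N + (m + 1) := by omega
    rw [e'] at h2
    exact (h1.trans h2).mono (le_of_eq (by ring))

end

/-- A symbol costs at most two steps and four increments of 2M + 2 steps each, which gives 8M + 10.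
The space bound adds four times this to the stacks present at the start of such a stretch. -/
theorem run_weigh (M : ℕ) (s : List Sym) (d : Option Kind) (f g : Bool) (N : ℕ)
    (hM : N + scan d f g s ≤ M) :
    Go (s.length * (8 * M + 10) + 1) (s.length + 33 * M + 44)
      (some (.weigh d f g), ⟨[], [], [], s, [], [], Computability.encodeNat N⟩)
      (none, haltCf (Computability.encodeNat (N + scan d f g s))) := by
  have hN := length_encodeNat_le N
  induction s generalizing d f g N with
  | nil =>
    refine (Reach.head (n := 0) rfl (Reach.refl _ _)).go ?_ |>.mono (by omega) le_rfl
    simp only [Cf.space, List.length_nil]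
    simp only [scan] at hM
    omega
  | cons x s ih =>
    have simple : ∀ (d' : Option Kind) (f' g' : Bool), scan d f g (x :: s) = scan d' f' g' s →
        nxt (some (.weigh d f g), ⟨[], [], [], x :: s, [], [], Computability.encodeNat N⟩) =
          (some (.weigh d' f' g'), ⟨[], [], [], s, [], [], Computability.encodeNat N⟩) →
        Go ((x :: s).length * (8 * M + 10) + 1) ((x :: s).length + 33 * M + 44)
          (some (.weigh d f g), ⟨[], [], [], x :: s, [], [], Computability.encodeNat N⟩)
          (none, haltCf (Computability.encodeNat (N + scan d f g (x :: s)))) := by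
      intro d' f' g' h1 h2
      rw [h1] at hM ⊢
      have h3 : Go 1 ((x :: s).length + 33 * M + 44) _ _ :=
        (Reach.head h2 (Reach.refl 0 _)).go (by
          simp only [Cf.space, List.length_nil, List.length_cons]; omega)
      refine (h3.trans ((ih d' f' g' N hM hN).mono le_rfl
        (by rw [List.length_cons]; omega))).mono ?_ le_rfl
      rw [List.length_cons, Nat.add_mul s.length 1, Nat.one_mul]
      omega
    cases x with
    | up => exact simple d true g rfl rfl
    | down => exact simple d f true rfl rfl
    | bar => exact simple _ false false rfl rfl
    | lbar => exact simple _ false false rfl rfl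
    | tok e =>
      simp only [scan] at hM ⊢
      have h1 : Reach 1
          (some (.weigh d f g), ⟨[], [], [], tok e :: s, [], [], Computability.encodeNat N⟩)
          (some (.inc (unit d f g e)), ⟨[], [], [], s, [], [], Computability.encodeNat N⟩) :=
        Reach.head rfl (Reach.refl 0 _)
      have h2 := run_inc_zero (I := []) (V := []) (L := []) (R := s) (T := [])
        (unit d f g e) (unit d f g e).isLt N M (by omega)
      have h3 : Reach 1
          (some (.inc 0), ⟨[], [], [], s, [], [], Computability.encodeNat (N + unit d f g e)⟩)
          (some (.weigh (some Kind.i) false false),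
            ⟨[], [], [], s, [], [], Computability.encodeNat (N + unit d f g e)⟩) :=
        Reach.head rfl (Reach.refl 0 _)
      have hu : (unit d f g e : ℕ) * (2 * M + 2) ≤ 4 * (2 * M + 2) :=
        Nat.mul_le_mul_right _ (by have := (unit d f g e).isLt; omega)
      have h4 : Go (8 * M + 10) ((tok e :: s).length + 33 * M + 44) _ _ :=
        (((h1.trans h2).trans h3).mono (n := 8 * M + 10) (by omega)).go (by
          simp only [Cf.space, List.length_nil, List.length_cons]; omega)
      have h5 := ih (some Kind.i) false false (N + unit d f g e) (by omega)
        (length_encodeNat_le _)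
      rw [← Nat.add_assoc]
      refine (h4.trans (h5.mono le_rfl (by rw [List.length_cons]; omega))).mono ?_ le_rfl
      rw [List.length_cons, Nat.add_mul s.length 1, Nat.one_mul]
      omega

theorem run_gather (L R : List Sym) :
    Reach (L.length + 1) (some .gather, ⟨[], [], L, R, [], [], []⟩)
      (some (.weigh none false false), ⟨[], [], [], (L.map mark).reverse ++ R, [], [], []⟩) := by
  induction L generalizing R with
  | nil => exact Reach.head rfl (Reach.refl 0 _)
  | cons x L ih =>
    refine Reach.head (x := (some .gather, ⟨[], [], L, mark x :: R, [], [], []⟩)) ?_ ?_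
    · cases x <;> rfl
    · have := ih (mark x :: R)
      rwa [List.map_cons, List.reverse_cons, List.append_assoc]

end Machine

end ThompsonF

namespace ThompsonF

namespace Machine

open LTree Machine.Sym Turing

/-! ### The whole computation -/

theorem run_load (w V : List Letter) :
    Reach (w.length + 1) (some .load, ⟨w, V, [], [], [], [], []⟩)
      (some .main, conf State.init (w.reverse ++ V)) := by
  induction w generalizing V with
  | nil => exact Reach.head rfl (Reach.refl 0 _)
  | cons s w ih =>
    refine Reach.head (x := (some .load, ⟨w, s :: V, [], [], [], [], []⟩)) rfl ?_
    rw [List.reverse_cons, List.append_assoc]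
    exact ih (s :: V)

theorem space_conf (S : State) (v : List Letter) : (conf S v).space = v.length + size S := by
  simp only [conf, Cf.space, size, List.length_nil]
  omega

/-- The quantity `size S + 4 * v.length` does not increase from letter to letter, so a single `Z`
bounds every intermediate configuration. -/
theorem run_letters (v : List Letter) (S : State) (Z : ℕ) (h : size S + 4 * v.length ≤ Z) :
    Go (v.length * (3 * Z + 7)) (13 * Z + 28) (some .main, conf S v)
      (some .main, conf (v.foldl (fun S s => State.mul s S) S) []) := by
  induction v generalizing S with
  | nil =>
    refine (Reach.refl _ _).go (n := 0) ?_ |>.mono (Nat.zero_le _) le_rfl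
    simp only [space_conf]
    omega
  | cons s v ih =>
    rw [List.length_cons] at h
    have h1 := size_mul_le s S
    have h2 : Go (3 * Z + 7) (13 * Z + 28) _ _ :=
      ((run_letter s S v).mono (n := 3 * Z + 7) (by omega)).go (by
        simp only [space_conf, List.length_cons]; omega)
    refine (h2.trans (ih _ (by omega))).mono ?_ le_rfl
    rw [List.length_cons, Nat.add_mul v.length 1, Nat.one_mul, Nat.add_comm]

theorem size_init : size State.init = 2 := rfl

theorem size_ofWord_le (w : List Letter) : size (State.ofWord w) ≤ 4 * w.length + 2 := by
  induction w with
  | nil => exact size_init.le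
  | cons s w ih =>
    have := size_mul_le s (State.ofWord w)
    rw [List.length_cons]
    change size (State.mul s (State.ofWord w)) ≤ _
    omega

theorem run_finish (S : State) (Z : ℕ) (h : size S ≤ Z) :
    Go (Z * (32 * Z + 10) + 1 + (Z + 2)) (133 * Z + 44) (some .main, conf S [])
      (none, haltCf (Computability.encodeNat S.weight)) := by
  have h1 : Reach (Z + 2) (some .main, conf S [])
      (some (.weigh none false false), ⟨[], [], [], tape S, [], [], []⟩) :=
    (Reach.head (x := (some .gather, conf S [])) rfl
      (run_gather (encLeft S.left) (encRight (S.cur :: S.right)))).mono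
        (by simp only [size] at h; omega)
  -- Table entries are at most 4, so 4Z bounds the counter throughout the scan.
  have h2 := run_weigh (4 * Z) (tape S) none false false 0 (by
    have := scan_le (tape S) none false false
    rw [length_tape] at this
    omega)
  rw [scan_tape, length_tape, Nat.zero_add] at h2
  have h3 : size S * (8 * (4 * Z) + 10) ≤ Z * (32 * Z + 10) :=
    Nat.mul_le_mul h (by omega)
  have h4 := (h1.go (s := 133 * Z + 44) (by
    simp only [space_conf, List.length_nil]; omega)).trans
      (h2.mono le_rfl (t := 133 * Z + 44) (by omega))
  exact h4.mono (by omega) le_rfl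

/-- A bound for the time. -/
def timeBound (n : ℕ) : ℕ := 600 * (n + 1) ^ 2

/-- A bound for the space. -/
def spaceBound (n : ℕ) : ℕ := 600 * (n + 1)

theorem run_all (w : List Letter) :
    Go (timeBound w.length) (spaceBound w.length) (some .load, initCf w)
      (none, haltCf (Computability.encodeNat (geodesicLength (element w)))) := by
  obtain ⟨n, hn⟩ : ∃ n, w.length = n := ⟨_, rfl⟩
  have h1 := (run_load w []).go (s := 600 * (n + 1)) (by
    simp only [Cf.space, List.length_nil]; omega)
  rw [List.append_nil] at h1
  -- Loading has reversed the word, so the last letter acts first, as left multiplication requires.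
  -- The value 4n + 2 is the initial size 2 plus a growth of 4 per letter.
  have h2 := run_letters w.reverse State.init (4 * n + 2) (by
    rw [size_init, List.length_reverse]; omega)
  rw [List.foldl_reverse, List.length_reverse] at h2
  have h3 := run_finish (State.ofWord w) (4 * n + 2) (hn ▸ size_ofWord_le w)
  rw [← geodesicLength_element] at h3
  rw [hn] at h1 h2 ⊢
  refine ((h1.trans (h2.mono le_rfl (by omega))).trans (h3.mono le_rfl (by omega))).mono ?_ le_rfl
  simp only [timeBound]
  nlinarith

theorem exists_output (w : List Letter) :
    ∃ m ≤ timeBound w.length, (flip bind tm.step)^[m] (some (initList tm w)) =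
      some (haltList tm (Computability.encodeNat (geodesicLength (element w)))) := by
  obtain ⟨m, hm, h, -⟩ := run_all w
  obtain ⟨m', hm', c, h1, h2⟩ := (sim_init w).evals (m := m) (by rw [h])
  rw [h] at h2
  exact ⟨m', hm'.trans hm, by rw [h1, h2.eq_haltList]⟩

/-- Every reachable configuration simulates some iterate of `nxt`, and the iterates past the halting
time all agree with the halting configuration. -/
theorem space_le (w : List Letter) (c : tm.Cfg)
    (hc : StateTransition.Reaches tm.step (initList tm w) c) :
    tm.space c ≤ spaceBound w.length := by
  obtain ⟨m, hm, h, h'⟩ := run_all w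
  obtain ⟨i, hi⟩ := (sim_init w).reaches hc
  rw [hi.space]
  rcases le_total i m with him | him
  · exact h' i him
  · obtain ⟨j, rfl⟩ := Nat.exists_eq_add_of_le him
    rw [Nat.add_comm, Function.iterate_add_apply, h, iterate_nxt_none, ← h]
    exact h' m le_rfl

/-- The machine computes the length of a word. -/
noncomputable def computable : TM2ComputableInTime (id : List Letter → List Letter)
    Computability.encodeNat (fun w => geodesicLength (element w)) where
  tm := tm
  inputAlphabet := Equiv.refl Letter
  outputAlphabet := Equiv.refl Bool
  time := timeBound
  outputsFun w :=
    { steps := (exists_output w).choose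
      evals_in_steps := by
        have h1 : ∀ l : List Letter, l.map (Equiv.refl Letter).invFun = l := fun l => List.map_id l
        have h2 : ∀ l : List Bool, l.map (Equiv.refl Bool).invFun = l := fun l => List.map_id l
        erw [h1, h2]
        exact (exists_output w).choose_spec.2
      steps_le_m := (exists_output w).choose_spec.1 }

theorem computable_inSpace : computable.InSpace spaceBound := by
  intro w c hc
  have h1 : ∀ l : List Letter, l.map (Equiv.refl Letter).invFun = l := fun l => List.map_id l
  erw [h1] at hc
  exact space_le w c hc

theorem finite_alphabet (k : tm.K) : Finite (tm.Γ k) := by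
  cases k
  · exact inferInstanceAs (Finite Letter)
  · exact inferInstanceAs (Finite Letter)
  · exact inferInstanceAs (Finite Sym)
  · exact inferInstanceAs (Finite Sym)
  · exact inferInstanceAs (Finite Sym)
  · exact inferInstanceAs (Finite Sym)
  · exact inferInstanceAs (Finite Bool)

theorem timeBound_isBigO :
    (fun n : ℕ => (timeBound n : ℝ)) =O[Filter.atTop] (fun n : ℕ => (n : ℝ) ^ 2) := by
  refine Asymptotics.IsBigO.of_bound 2400 ?_
  filter_upwards [Filter.eventually_ge_atTop 1] with n hn
  have hn : (1 : ℝ) ≤ n := by exact_mod_cast hn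
  rw [Real.norm_of_nonneg (by positivity), Real.norm_of_nonneg (by positivity), timeBound]
  push_cast
  nlinarith

theorem spaceBound_isBigO :
    (fun n : ℕ => (spaceBound n : ℝ)) =O[Filter.atTop] (fun n : ℕ => (n : ℝ)) := by
  refine Asymptotics.IsBigO.of_bound 1200 ?_
  filter_upwards [Filter.eventually_ge_atTop 1] with n hn
  have hn : (1 : ℝ) ≤ n := by exact_mod_cast hn
  rw [Real.norm_of_nonneg (by positivity), Real.norm_of_nonneg (by positivity), spaceBound]
  push_cast
  linarith

end Machine

end ThompsonF

theorem mainTheorem4 :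
    (∀ w : List ThompsonF.Letter,
      ThompsonF.geodesicLength (ThompsonF.element w) =
        (ThompsonF.ForestDiagram.ofWord w).weight) ∧
    ∃ (M : Turing.TM2ComputableInTime (id : List ThompsonF.Letter → List ThompsonF.Letter)
          Computability.encodeNat
          (fun w => ThompsonF.geodesicLength (ThompsonF.element w)))
      (S : ℕ → ℕ),
      (∀ k : M.tm.K, Finite (M.tm.Γ k)) ∧
      M.InSpace S ∧
      (fun n : ℕ => (M.time n : ℝ)) =O[Filter.atTop] (fun n : ℕ => (n : ℝ) ^ 2) ∧
      (fun n : ℕ => (S n : ℝ)) =O[Filter.atTop] (fun n : ℕ => (n : ℝ)) :=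
  ⟨ThompsonF.geodesicLength_eq_weight, ThompsonF.Machine.computable, ThompsonF.Machine.spaceBound,
    ThompsonF.Machine.finite_alphabet, ThompsonF.Machine.computable_inSpace,
    ThompsonF.Machine.timeBound_isBigO, ThompsonF.Machine.spaceBound_isBigO⟩
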